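/- Let $m\ge 0$ and let $M$ be a non-empty smooth ($C^\infty$) manifold of dimension $2m$ with a smooth pseudo-Riemannian metric $g$ of arbitrary signature, with Levi-Civita connection $\nabla$. Let $\phi$ be a smooth real conformal Killing–Yano 2-form on $M$: writing $\tau=d\phi$, there is a 1-form $K$ with $\nabla_X\phi=\frac13\,X\lrcorner\tau+\frac1{2m-1}\,g(X,\cdot)\wedge K$ for all vector fields $X$. Assume that at each point the endomorphism of $T_{\mathbb C}M=\mathbb C\otimes TM$ obtained from $\phi$ by raising an index has $2m$ distinct eigenvalues (so that it is diagonalisable, its eigenvalues come in pairs $\pm\lambda_\mu$, and it is invertible). A null eigenbasis at $x\in M$ is a family of complex vectors $V_\mu,V^\mu$ ($1\le\mu\le m$) in $T_{\mathbb C,x}M$ with $g(V_\mu,V_\nu)=g(V^\mu,V^\nu)=\phi(V_\mu,V_\nu)=\phi(V^\mu,V^\nu)=0$, $g(V_\mu,V^\nu)=\delta_{\mu\nu}$ and $\phi(V_\mu,V^\nu)=\lambda_\mu\delta_{\mu\nu}$ for some $\lambda_\mu\in\mathbb C$. It is a basis; let $\theta^\mu=g(V^\mu,\cdot)$, $\theta_\mu=g(V_\mu,\cdot)$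 be the dual basis. For an open set $U\subseteq M$, a family of eigendistributions on $U$ is a family $(D_s)$, indexed by the $2^m$ choices $s$ of one vector from each pair $\{V_\mu,V^\mu\}$, of smooth complex distributions of rank $m$ on $U$ such that at each $x\in U$ there is a null eigenbasis for which, for every $s$, $D_s(x)$ is spanned by the $m$ vectors chosen by $s$. We say that $\tau$ satisfies condition (T) if at each point, and for each null eigenbasis there, the components of $\tau$ whose three indices do not include a pair $V_\mu,V^\mu$ all vanish; that is, $\tau(A,B,C)=0$ whenever $A,B,C$ are among the $m$ vectors of one and the same choice $s$. (i) Each point of $M$ has an open neighbourhood that carries a family of eigendistributions. (ii) Let a null eigenbasis at a point be given. If $\theta^\mu\wedge\tau(V^\mu,\cdot,\cdot)=0$ and $\theta_\mu\wedge\tau(V_\mu,\cdot,\cdot)=0$ there for each $\mu$ (no summation), then the components of $\tau$ without such a pair vanish in that basis. The same conclusion holds if $\phi$ is closed, and it holds if $\dim M=4$. (iii) Assume (T). Let $(D_s)$ be a family of eigendistributions on an open set $U\subseteq M$. Then the $2^m$ subspaces $D_s(x)$ are pairwise distinct at each $x\in U$, each $D_s$ is maximal isotropic ($g$ vanishes on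 it, and it has rank $m$), and each $D_s$ is integrable, $[D_s,D_s]\subseteq D_s$. (iv) Assume (T) and that $g$ is positive definite. Then there is a family of eigendistributions on all of $M$. For every family of eigendistributions on an open set $U$, each $D_s$ is the $(1,0)$-tangent bundle (the $+i$-eigenbundle) of a Hermitian complex structure $J_s$ on $U$, that is, of a smooth $g$-orthogonal almost complex structure with vanishing Nijenhuis tensor, and these $2^m$ structures are pairwise distinct at each point of $U$. (v) Assume (T) and that $g$ is Lorentzian. Then there are two smooth fields of real null lines $L_+,L_-$ on $M$, distinct at each point, that are tangent to geodesic congruences (every local section $k$ satisfies $\nabla_kk\in L_\pm$), with the following property. There is a family of eigendistributions on all of $M$ such that for each of the two signs exactly $2^{m-1}$ of the $D_s$ have $D_s\cap\overline{D_s}=\mathbb C\otimes L_\pm$ at every point of $M$. Moreover, for every family of eigendistributions on an open set $U$, for each of the two signs exactly $2^{m-1}$ of the $D_s$ satisfy this at any given point of $U$, and, if $U$ is connected and non-empty, exactly $2^{m-1}$ of them satisfy it at all points of $U$ simultaneously. -/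

import Mathlib

open Set Filter Topology Manifold Bundle Module
open scoped ContDiff TensorProduct

noncomputable section

namespace CKY

section Tensors

variable (n : ℕ) (M : Type*) [TopologicalSpace M]
  [ChartedSpace (EuclideanSpace ℝ (Fin n)) M] [IsManifold (𝓡 n) ∞ M]

/-- A smooth pseudo-Riemannian metric (of arbitrary signature) on a smooth `n`-manifold. -/
structure PseudoRiemannianMetric where
  val (x : M) : TangentSpace (𝓡 n) x →L[ℝ] TangentSpace (𝓡 n) x →L[ℝ] ℝ
  symm (x : M) (v w : TangentSpace (𝓡 n) x) : val x v w = val x w v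
  nondegenerate (x : M) (v : TangentSpace (𝓡 n) x) (hv : ∀ w, val x v w = 0) : v = 0
  contMDiff : ContMDiff (𝓡 n)
    ((𝓡 n).prod 𝓘(ℝ, EuclideanSpace ℝ (Fin n) →L[ℝ] EuclideanSpace ℝ (Fin n) →L[ℝ] ℝ)) ∞
    (fun x => TotalSpace.mk'
      (EuclideanSpace ℝ (Fin n) →L[ℝ] EuclideanSpace ℝ (Fin n) →L[ℝ] ℝ) x (val x))

/-- A smooth (real) differential `2`-form on a smooth `n`-manifold. -/
structure TwoForm where
  val (x : M) : TangentSpace (𝓡 n) x →L[ℝ] TangentSpace (𝓡 n) x →L[ℝ] ℝ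
  skew (x : M) (v w : TangentSpace (𝓡 n) x) : val x v w = - val x w v
  contMDiff : ContMDiff (𝓡 n)
    ((𝓡 n).prod 𝓘(ℝ, EuclideanSpace ℝ (Fin n) →L[ℝ] EuclideanSpace ℝ (Fin n) →L[ℝ] ℝ)) ∞
    (fun x => TotalSpace.mk'
      (EuclideanSpace ℝ (Fin n) →L[ℝ] EuclideanSpace ℝ (Fin n) →L[ℝ] ℝ) x (val x))

end Tensors

section Calculus

variable {n : ℕ} {M : Type*} [TopologicalSpace M]
  [ChartedSpace (EuclideanSpace ℝ (Fin n)) M] [IsManifold (𝓡 n) ∞ M]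

/-- The vector field `X` is smooth on the set `U`. -/
def SmoothFieldOn (X : Π x : M, TangentSpace (𝓡 n) x) (U : Set M) : Prop :=
  ContMDiffOn (𝓡 n) ((𝓡 n).prod 𝓘(ℝ, EuclideanSpace ℝ (Fin n))) ∞
    (fun x => TotalSpace.mk' (EuclideanSpace ℝ (Fin n)) x (X x)) U

/-- The vector field `X` is differentiable at the point `x`. -/
def DiffFieldAt (X : Π x : M, TangentSpace (𝓡 n) x) (x : M) : Prop :=
  MDifferentiableAt (𝓡 n) ((𝓡 n).prod 𝓘(ℝ, EuclideanSpace ℝ (Fin n)))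
    (fun x => TotalSpace.mk' (EuclideanSpace ℝ (Fin n)) x (X x)) x

/-- The derivative `X f` of a function along a vector field. -/
def dirDeriv (X : Π x : M, TangentSpace (𝓡 n) x) (f : M → ℝ) (x : M) : ℝ :=
  mvfderiv (𝓡 n) f x (X x)

/-- The Koszul expression, which equals `g (∇_X Y, Z)` at `x`. -/
def koszul (g : PseudoRiemannianMetric n M) (X Y Z : Π x : M, TangentSpace (𝓡 n) x)
    (x : M) : ℝ :=
  (1 / 2) * (dirDeriv X (fun y => g.val y (Y y) (Z y)) x
    + dirDeriv Y (fun y => g.val y (X y) (Z y)) x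
    - dirDeriv Z (fun y => g.val y (X y) (Y y)) x
    + g.val x (VectorField.mlieBracket (𝓡 n) X Y x) (Z x)
    - g.val x (VectorField.mlieBracket (𝓡 n) X Z x) (Y x)
    - g.val x (VectorField.mlieBracket (𝓡 n) Y Z x) (X x))

open Classical in
/-- The Levi-Civita connection: `(∇_X Y)(x)` is the unique tangent vector `w` at `x` such that
`g (w, Z) = koszul g X Y Z` at `x` for every vector field `Z` that is differentiable at `x`. For `X`, `Y`
differentiable at `x` it exists, see `leviCivita_spec` and `leviCivita_unique`. -/
def leviCivita (g : PseudoRiemannianMetric n M) (X Y : Π x : M, TangentSpace (𝓡 n) x)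
    (x : M) : TangentSpace (𝓡 n) x :=
  if h : ∃ w : TangentSpace (𝓡 n) x, ∀ Z : Π x : M, TangentSpace (𝓡 n) x,
      DiffFieldAt Z x → g.val x w (Z x) = koszul g X Y Z x
  then h.choose else 0

/-- The covariant derivative `(∇_X φ)(Y, Z)` of a `2`-form. -/
def covDeriv (g : PseudoRiemannianMetric n M) (φ : TwoForm n M)
    (X Y Z : Π x : M, TangentSpace (𝓡 n) x) (x : M) : ℝ :=
  dirDeriv X (fun y => φ.val y (Y y) (Z y)) x
    - φ.val x (leviCivita g X Y x) (Z x) - φ.val x (Y x) (leviCivita g X Z x)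

/-- Cartan's formula for `(dφ)(X, Y, Z)` on vector fields. -/
def cartan (φ : TwoForm n M) (X Y Z : Π x : M, TangentSpace (𝓡 n) x) (x : M) : ℝ :=
  dirDeriv X (fun y => φ.val y (Y y) (Z y)) x
    - dirDeriv Y (fun y => φ.val y (X y) (Z y)) x
    + dirDeriv Z (fun y => φ.val y (X y) (Y y)) x
    - φ.val x (VectorField.mlieBracket (𝓡 n) X Y x) (Z x)
    + φ.val x (VectorField.mlieBracket (𝓡 n) X Z x) (Y x)
    - φ.val x (VectorField.mlieBracket (𝓡 n) Y Z x) (X x)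

/-- The exterior derivative `τ = dφ` on tangent vectors at `x`, computed by Cartan's formula on
extensions of the vectors to smooth vector fields near `x`; the choice of the extensions does not
matter, see `extDeriv_eq_cartan`. -/
def extDeriv (φ : TwoForm n M) (x : M) (u v w : TangentSpace (𝓡 n) x) : ℝ :=
  cartan φ (FiberBundle.extend (EuclideanSpace ℝ (Fin n)) u)
    (FiberBundle.extend (EuclideanSpace ℝ (Fin n)) v)
    (FiberBundle.extend (EuclideanSpace ℝ (Fin n)) w) x

theorem mdiff_bilin
    {B : Π x : M, TangentSpace (𝓡 n) x →L[ℝ] TangentSpace (𝓡 n) x →L[ℝ] ℝ}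
    (hB : ContMDiff (𝓡 n)
      ((𝓡 n).prod 𝓘(ℝ, EuclideanSpace ℝ (Fin n) →L[ℝ] EuclideanSpace ℝ (Fin n) →L[ℝ] ℝ)) ∞
      (fun x => TotalSpace.mk'
        (EuclideanSpace ℝ (Fin n) →L[ℝ] EuclideanSpace ℝ (Fin n) →L[ℝ] ℝ) x (B x)))
    {X Y : Π x : M, TangentSpace (𝓡 n) x} {x : M}
    (hX : DiffFieldAt X x) (hY : DiffFieldAt Y x) :
    MDifferentiableAt (𝓡 n) 𝓘(ℝ, ℝ) (fun y => B y (X y) (Y y)) x := by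
  have : MDifferentiableAt (𝓡 n) ((𝓡 n).prod 𝓘(ℝ, ℝ))
      (fun m ↦ TotalSpace.mk' ℝ (E := Bundle.Trivial M ℝ) m (B m (X m) (Y m))) x := by
    apply MDifferentiableAt.clm_bundle_apply₂ (F₁ := EuclideanSpace ℝ (Fin n))
      (F₂ := EuclideanSpace ℝ (Fin n))
    · exact hB.mdifferentiableAt (by simp)
    · exact hX
    · exact hY
  simp only [mdifferentiableAt_totalSpace] at this
  exact this.2

theorem dirDeriv_add (X : Π x : M, TangentSpace (𝓡 n) x) {f f' : M → ℝ} {x : M}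
    (hf : MDifferentiableAt (𝓡 n) 𝓘(ℝ, ℝ) f x) (hf' : MDifferentiableAt (𝓡 n) 𝓘(ℝ, ℝ) f' x) :
    dirDeriv X (fun y => f y + f' y) x = dirDeriv X f x + dirDeriv X f' x := by
  have := mvfderiv_add hf hf'
  simp only [dirDeriv]
  rw [show (fun y => f y + f' y) = f + f' from rfl, this]
  rfl

theorem dirDeriv_mul (X : Π x : M, TangentSpace (𝓡 n) x) {f f' : M → ℝ} {x : M}
    (hf : MDifferentiableAt (𝓡 n) 𝓘(ℝ, ℝ) f x) (hf' : MDifferentiableAt (𝓡 n) 𝓘(ℝ, ℝ) f' x) :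
    dirDeriv X (fun y => f y * f' y) x
      = dirDeriv X f x * f' x + f x * dirDeriv X f' x := by
  have := mvfderiv_mul hf hf'
  simp only [dirDeriv]
  rw [show (fun y => f y * f' y) = f * f' from rfl, this]
  simp [mul_comm, add_comm]

theorem dirDeriv_neg (X : Π x : M, TangentSpace (𝓡 n) x) (f : M → ℝ) (x : M) :
    dirDeriv X (fun y => - f y) x = - dirDeriv X f x := by
  simp only [dirDeriv]
  rw [show (fun y => - f y) = -f from rfl, mvfderiv_neg]
  rfl

theorem koszul_tensorial (g : PseudoRiemannianMetric n M)
    {X Y : Π x : M, TangentSpace (𝓡 n) x} {x : M}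
    (hX : DiffFieldAt X x) (hY : DiffFieldAt Y x) :
    TensorialAt (𝓡 n) (EuclideanSpace ℝ (Fin n)) (fun Z => koszul g X Y Z x) x where
  smul {f Z} hf hZ := by
    have h1 := dirDeriv_mul X hf (mdiff_bilin g.contMDiff hY hZ)
    have h2 := dirDeriv_mul Y hf (mdiff_bilin g.contMDiff hX hZ)
    have h3 := VectorField.mlieBracket_smul_right (V := X) hf hZ
    have h4 := VectorField.mlieBracket_smul_right (V := Y) hf hZ
    simp only [koszul, Pi.smul_apply', map_smul, smul_eq_mul, h1, h2, h3, h4]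
    simp [dirDeriv, g.symm x (Z x)]
    ring
  add {Z Z'} hZ hZ' := by
    have h1 := dirDeriv_add X (mdiff_bilin g.contMDiff hY hZ) (mdiff_bilin g.contMDiff hY hZ')
    have h2 := dirDeriv_add Y (mdiff_bilin g.contMDiff hX hZ) (mdiff_bilin g.contMDiff hX hZ')
    have h3 := VectorField.mlieBracket_add_right (V := X) hZ hZ'
    have h4 := VectorField.mlieBracket_add_right (V := Y) hZ hZ'
    simp only [koszul, Pi.add_apply, map_add, h1, h2, h3, h4]
    simp [dirDeriv]
    ring

theorem leviCivita_exists (g : PseudoRiemannianMetric n M)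
    {X Y : Π x : M, TangentSpace (𝓡 n) x} {x : M}
    (hX : DiffFieldAt X x) (hY : DiffFieldAt Y x) :
    ∃ w : TangentSpace (𝓡 n) x, ∀ Z : Π x : M, TangentSpace (𝓡 n) x,
      DiffFieldAt Z x → g.val x w (Z x) = koszul g X Y Z x := by
  let L : TangentSpace (𝓡 n) x →L[ℝ] ℝ :=
    TensorialAt.mkHom (fun Z => koszul g X Y Z x) x (koszul_tensorial g hX hY)
  have : FiniteDimensional ℝ (TangentSpace (𝓡 n) x) :=
    inferInstanceAs (FiniteDimensional ℝ (EuclideanSpace ℝ (Fin n)))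
  let B : LinearMap.BilinForm ℝ (TangentSpace (𝓡 n) x) := (g.val x).toBilinForm
  have hB : B.Nondegenerate := by
    have hr : B.IsRefl := fun v w h => by
      have := g.symm x v w
      simp_all [B]
    exact (LinearMap.IsRefl.nondegenerate_iff_separatingLeft hr).2
      (fun v hv => g.nondegenerate x v hv)
  refine ⟨(B.toDual hB).symm L.toLinearMap, fun Z hZ => ?_⟩
  have h := LinearMap.BilinForm.apply_toDual_symm_apply (hB := hB) L.toLinearMap (Z x)
  have h2 : L (Z x) = koszul g X Y Z x := TensorialAt.mkHom_apply _ hZ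
  rw [← h2]
  exact h

theorem leviCivita_spec (g : PseudoRiemannianMetric n M)
    {X Y Z : Π x : M, TangentSpace (𝓡 n) x} {x : M}
    (hX : DiffFieldAt X x) (hY : DiffFieldAt Y x) (hZ : DiffFieldAt Z x) :
    g.val x (leviCivita g X Y x) (Z x) = koszul g X Y Z x := by
  have h := leviCivita_exists g hX hY
  rw [leviCivita, dif_pos h]
  exact h.choose_spec Z hZ

theorem leviCivita_unique (g : PseudoRiemannianMetric n M)
    {X Y : Π x : M, TangentSpace (𝓡 n) x} {x : M}
    (hX : DiffFieldAt X x) (hY : DiffFieldAt Y x) (w : TangentSpace (𝓡 n) x)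
    (hw : ∀ Z : Π x : M, TangentSpace (𝓡 n) x,
      DiffFieldAt Z x → g.val x w (Z x) = koszul g X Y Z x) :
    w = leviCivita g X Y x := by
  rw [← sub_eq_zero]
  refine g.nondegenerate x _ fun v => ?_
  have hv : DiffFieldAt (FiberBundle.extend (EuclideanSpace ℝ (Fin n)) v) x :=
    FiberBundle.mdifferentiableAt_extend (𝓡 n) (EuclideanSpace ℝ (Fin n)) v
  have h1 := hw _ hv
  have h2 := leviCivita_spec g hX hY hv
  rw [FiberBundle.extend_apply_self] at h1 h2
  simp [h1, h2]

theorem cartan_swap₁₂ (φ : TwoForm n M) (X Y Z : Π x : M, TangentSpace (𝓡 n) x) (x : M) :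
    cartan φ X Y Z x = - cartan φ Y X Z x := by
  have h : (fun y => φ.val y (X y) (Y y)) = fun y => -(φ.val y (Y y) (X y)) :=
    funext fun y => φ.skew y _ _
  simp only [cartan]
  rw [h, dirDeriv_neg, VectorField.mlieBracket_swap_apply (V := Y) (W := X)]
  simp
  ring

theorem cartan_swap₂₃ (φ : TwoForm n M) (X Y Z : Π x : M, TangentSpace (𝓡 n) x) (x : M) :
    cartan φ X Y Z x = - cartan φ X Z Y x := by
  have h : (fun y => φ.val y (Y y) (Z y)) = fun y => -(φ.val y (Z y) (Y y)) :=
    funext fun y => φ.skew y _ _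
  simp only [cartan]
  rw [h, dirDeriv_neg, VectorField.mlieBracket_swap_apply (V := Z) (W := Y)]
  simp
  ring

theorem cartan_tensorial (φ : TwoForm n M)
    {X Y : Π x : M, TangentSpace (𝓡 n) x} {x : M}
    (hX : DiffFieldAt X x) (hY : DiffFieldAt Y x) :
    TensorialAt (𝓡 n) (EuclideanSpace ℝ (Fin n)) (fun Z => cartan φ X Y Z x) x where
  smul {f Z} hf hZ := by
    have h1 := dirDeriv_mul X hf (mdiff_bilin φ.contMDiff hY hZ)
    have h2 := dirDeriv_mul Y hf (mdiff_bilin φ.contMDiff hX hZ)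
    have h3 := VectorField.mlieBracket_smul_right (V := X) hf hZ
    have h4 := VectorField.mlieBracket_smul_right (V := Y) hf hZ
    simp only [cartan, Pi.smul_apply', map_smul, smul_eq_mul, h1, h2, h3, h4]
    simp [dirDeriv, φ.skew x (Z x)]
    ring
  add {Z Z'} hZ hZ' := by
    have h1 := dirDeriv_add X (mdiff_bilin φ.contMDiff hY hZ) (mdiff_bilin φ.contMDiff hY hZ')
    have h2 := dirDeriv_add Y (mdiff_bilin φ.contMDiff hX hZ) (mdiff_bilin φ.contMDiff hX hZ')
    have h3 := VectorField.mlieBracket_add_right (V := X) hZ hZ'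
    have h4 := VectorField.mlieBracket_add_right (V := Y) hZ hZ'
    simp only [cartan, Pi.add_apply, map_add, h1, h2, h3, h4]
    simp [dirDeriv]
    ring

theorem extDeriv_eq_cartan (φ : TwoForm n M)
    {X Y Z : Π x : M, TangentSpace (𝓡 n) x} {x : M}
    (hX : DiffFieldAt X x) (hY : DiffFieldAt Y x) (hZ : DiffFieldAt Z x) :
    extDeriv φ x (X x) (Y x) (Z x) = cartan φ X Y Z x := by
  have hX' : DiffFieldAt (FiberBundle.extend (EuclideanSpace ℝ (Fin n)) (X x)) x :=
    FiberBundle.mdifferentiableAt_extend (𝓡 n) (EuclideanSpace ℝ (Fin n)) (X x)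
  have hY' : DiffFieldAt (FiberBundle.extend (EuclideanSpace ℝ (Fin n)) (Y x)) x :=
    FiberBundle.mdifferentiableAt_extend (𝓡 n) (EuclideanSpace ℝ (Fin n)) (Y x)
  have hZ' : DiffFieldAt (FiberBundle.extend (EuclideanSpace ℝ (Fin n)) (Z x)) x :=
    FiberBundle.mdifferentiableAt_extend (𝓡 n) (EuclideanSpace ℝ (Fin n)) (Z x)
  rw [extDeriv, (cartan_tensorial φ hX' hY').pointwise hZ' hZ (by simp), cartan_swap₂₃,
    (cartan_tensorial φ hX' hZ).pointwise hY' hY (by simp), cartan_swap₁₂,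
    cartan_swap₂₃, (cartan_tensorial φ hZ hY).pointwise hX' hX (by simp),
    cartan_swap₂₃ φ X Y Z, cartan_swap₁₂ φ X Z Y, cartan_swap₂₃ φ Z X Y]

end Calculus

section Complexification

variable {V : Type*} [AddCommGroup V] [Module ℝ V]

/-- The real part `ℂ ⊗ V → V`, `z ⊗ v ↦ (re z) v`. -/
def cre : ℂ ⊗[ℝ] V →ₗ[ℝ] V := (TensorProduct.lid ℝ V).toLinearMap ∘ₗ Complex.reLm.rTensor V

/-- The imaginary part `ℂ ⊗ V → V`, `z ⊗ v ↦ (im z) v`. -/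
def cim : ℂ ⊗[ℝ] V →ₗ[ℝ] V := (TensorProduct.lid ℝ V).toLinearMap ∘ₗ Complex.imLm.rTensor V

/-- The complex vector `a + i b`. -/
def cmk (a b : V) : ℂ ⊗[ℝ] V := (1 : ℂ) ⊗ₜ[ℝ] a + Complex.I ⊗ₜ[ℝ] b

/-- The complex-trilinear extension of a real trilinear form to `ℂ ⊗ V`. -/
def cext₃ (T : V → V → V → ℝ) (A B C : ℂ ⊗[ℝ] V) : ℂ :=
  ⟨T (cre A) (cre B) (cre C) - T (cre A) (cim B) (cim C)
      - T (cim A) (cre B) (cim C) - T (cim A) (cim B) (cre C),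
    T (cim A) (cre B) (cre C) + T (cre A) (cim B) (cre C)
      + T (cre A) (cre B) (cim C) - T (cim A) (cim B) (cim C)⟩

/-- The real vectors `k ∈ V` lying in a complex subspace `D ⊆ ℂ ⊗ V`; they form the real subspace
whose complexification is `D ∩ conj D`. -/
def realPoints (D : Submodule ℂ (ℂ ⊗[ℝ] V)) : Submodule ℝ V :=
  (D.restrictScalars ℝ).comap (TensorProduct.mk ℝ ℂ V 1)

end Complexification

section Geometry

variable {n : ℕ} {M : Type*} [TopologicalSpace M]
  [ChartedSpace (EuclideanSpace ℝ (Fin n)) M] [IsManifold (𝓡 n) ∞ M]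

/-- The metric is positive definite. -/
def PseudoRiemannianMetric.IsRiemannian (g : PseudoRiemannianMetric n M) : Prop :=
  ∀ (x : M) (v : TangentSpace (𝓡 n) x), v ≠ 0 → 0 < g.val x v v

/-- The metric has Lorentzian signature (in either sign convention): at each point there is a
vector `t` with `g (t, t) ≠ 0` such that `g` is definite, of the sign opposite to that of
`g (t, t)`, on the orthogonal complement of `t`. -/
def PseudoRiemannianMetric.IsLorentzian (g : PseudoRiemannianMetric n M) : Prop :=
  ∀ x : M, ∃ t : TangentSpace (𝓡 n) x, g.val x t t ≠ 0 ∧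
    ∀ v : TangentSpace (𝓡 n) x, v ≠ 0 → g.val x t v = 0 → g.val x t t * g.val x v v < 0

/-- The metric, extended complex-bilinearly to `ℂ ⊗ T_x M`. -/
def PseudoRiemannianMetric.cval (g : PseudoRiemannianMetric n M) (x : M) :
    LinearMap.BilinForm ℂ (ℂ ⊗[ℝ] TangentSpace (𝓡 n) x) :=
  LinearMap.BilinForm.baseChange ℂ (g.val x).toBilinForm

/-- The `2`-form, extended complex-bilinearly to `ℂ ⊗ T_x M`. -/
def TwoForm.cval (φ : TwoForm n M) (x : M) :
    LinearMap.BilinForm ℂ (ℂ ⊗[ℝ] TangentSpace (𝓡 n) x) :=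
  LinearMap.BilinForm.baseChange ℂ (φ.val x).toBilinForm

/-- The `2`-form `φ` is conformal Killing-Yano: there is a `1`-form `K` such that
`∇_X φ = (1/3) X ⌟ dφ + (1/(n-1)) X^* ∧ K` for all (locally defined) smooth vector fields `X`. -/
def IsConformalKillingYano (g : PseudoRiemannianMetric n M) (φ : TwoForm n M) : Prop :=
  ∃ K : Π x : M, TangentSpace (𝓡 n) x →ₗ[ℝ] ℝ,
    ∀ U : Set M, IsOpen U → ∀ X Y Z : Π x : M, TangentSpace (𝓡 n) x,
      SmoothFieldOn X U → SmoothFieldOn Y U → SmoothFieldOn Z U → ∀ x ∈ U,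
        covDeriv g φ X Y Z x = (1 / 3) * extDeriv φ x (X x) (Y x) (Z x)
          + (1 / ((n : ℝ) - 1)) *
            (g.val x (X x) (Y x) * K x (Z x) - g.val x (X x) (Z x) * K x (Y x))

/-- The (complex) eigenvalues at `x` of the endomorphism of `ℂ ⊗ T_x M` obtained from `φ` by
raising an index with the metric: the `z` for which there is `l ≠ 0` with
`φ (·, l) = z g (·, l)`. -/
def eigenvalues (g : PseudoRiemannianMetric n M) (φ : TwoForm n M) (x : M) : Set ℂ :=
  {z | ∃ l : ℂ ⊗[ℝ] TangentSpace (𝓡 n) x, l ≠ 0 ∧ ∀ A, φ.cval x A l = z * g.cval x A l}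

/-- The complex vector field `Z` is smooth on `U`. -/
def SmoothCFieldOn (Z : Π x : M, ℂ ⊗[ℝ] TangentSpace (𝓡 n) x) (U : Set M) : Prop :=
  SmoothFieldOn (fun x => cre (Z x)) U ∧ SmoothFieldOn (fun x => cim (Z x)) U

/-- The Lie bracket, extended complex-bilinearly to complex vector fields. -/
def cbracket (Z W : Π x : M, ℂ ⊗[ℝ] TangentSpace (𝓡 n) x) (x : M) :
    ℂ ⊗[ℝ] TangentSpace (𝓡 n) x :=
  cmk (VectorField.mlieBracket (𝓡 n) (fun y => cre (Z y)) (fun y => cre (W y)) x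
      - VectorField.mlieBracket (𝓡 n) (fun y => cim (Z y)) (fun y => cim (W y)) x)
    (VectorField.mlieBracket (𝓡 n) (fun y => cre (Z y)) (fun y => cim (W y)) x
      + VectorField.mlieBracket (𝓡 n) (fun y => cim (Z y)) (fun y => cre (W y)) x)

/-- `D` is a smooth distribution of complex rank `k` on `U`: it is locally spanned by smooth,
pointwise linearly independent complex vector fields `Z 0, …, Z (k-1)`. -/
def IsSmoothDistribution (D : Π x : M, Submodule ℂ (ℂ ⊗[ℝ] TangentSpace (𝓡 n) x)) (k : ℕ)
    (U : Set M) : Prop :=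
  ∀ p ∈ U, ∃ V : Set M, IsOpen V ∧ p ∈ V ∧ V ⊆ U ∧
    ∃ Z : Fin k → Π x : M, ℂ ⊗[ℝ] TangentSpace (𝓡 n) x, (∀ i, SmoothCFieldOn (Z i) V) ∧
      ∀ x ∈ V, LinearIndependent ℂ (fun i => Z i x) ∧
        D x = Submodule.span ℂ (Set.range fun i => Z i x)

/-- Frobenius integrability `[D, D] ⊆ D` of a complex distribution on `U`. -/
def IsIntegrable (D : Π x : M, Submodule ℂ (ℂ ⊗[ℝ] TangentSpace (𝓡 n) x)) (U : Set M) : Prop :=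
  ∀ V : Set M, IsOpen V → V ⊆ U → ∀ Z W : Π x : M, ℂ ⊗[ℝ] TangentSpace (𝓡 n) x,
    SmoothCFieldOn Z V → SmoothCFieldOn W V → (∀ x ∈ V, Z x ∈ D x) → (∀ x ∈ V, W x ∈ D x) →
      ∀ x ∈ V, cbracket Z W x ∈ D x

/-- `J` is a Hermitian complex structure on `U`: a smooth, `g`-orthogonal almost complex structure
whose Nijenhuis tensor vanishes. -/
structure IsHermitianStructure (g : PseudoRiemannianMetric n M)
    (J : Π x : M, TangentSpace (𝓡 n) x →ₗ[ℝ] TangentSpace (𝓡 n) x) (U : Set M) : Prop where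
  sq : ∀ x ∈ U, ∀ v, J x (J x v) = -v
  orthogonal : ∀ x ∈ U, ∀ v w, g.val x (J x v) (J x w) = g.val x v w
  smooth : ∀ V : Set M, IsOpen V → V ⊆ U → ∀ X : Π x : M, TangentSpace (𝓡 n) x,
    SmoothFieldOn X V → SmoothFieldOn (fun x => J x (X x)) V
  nijenhuis : ∀ V : Set M, IsOpen V → V ⊆ U → ∀ X Y : Π x : M, TangentSpace (𝓡 n) x,
    SmoothFieldOn X V → SmoothFieldOn Y V → ∀ x ∈ V,
      VectorField.mlieBracket (𝓡 n) (fun y => J y (X y)) (fun y => J y (Y y)) x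
        - J x (VectorField.mlieBracket (𝓡 n) (fun y => J y (X y)) Y x)
        - J x (VectorField.mlieBracket (𝓡 n) X (fun y => J y (Y y)) x)
        - VectorField.mlieBracket (𝓡 n) X Y x = 0

/-- `L` is (the field of tangent lines of) a smooth geodesic null congruence on `M`: a smooth field
of null lines such that `∇_k k` is proportional to `k` for all local sections `k`, i.e. such that
the integral curves of `L` are geodesics up to parametrisation. -/
structure IsGeodesicNullCongruence (g : PseudoRiemannianMetric n M)
    (L : Π x : M, Submodule ℝ (TangentSpace (𝓡 n) x)) : Prop where
  smooth : ∀ p : M, ∃ V : Set M, IsOpen V ∧ p ∈ V ∧ ∃ k : Π x : M, TangentSpace (𝓡 n) x,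
    SmoothFieldOn k V ∧ ∀ x ∈ V, k x ≠ 0 ∧ L x = Submodule.span ℝ {k x}
  null : ∀ x, ∀ k ∈ L x, g.val x k k = 0
  geodesic : ∀ V : Set M, IsOpen V → ∀ k : Π x : M, TangentSpace (𝓡 n) x,
    SmoothFieldOn k V → (∀ x ∈ V, k x ∈ L x) → ∀ x ∈ V, leviCivita g k k x ∈ L x

end Geometry

section Eigendistributions

variable {m : ℕ} {M : Type*} [TopologicalSpace M]
  [ChartedSpace (EuclideanSpace ℝ (Fin (2 * m))) M] [IsManifold (𝓡 (2 * m)) ∞ M]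

/-- The `2m` complex vectors `v μ = V_μ`, `w μ = V^μ` at `x` form a null basis putting `φ` into
normal form: if `θ^μ`, `θ_μ` is the dual basis then `g = ∑ (θ^μ ⊗ θ_μ + θ_μ ⊗ θ^μ)` and
`φ = ∑ lam_μ θ^μ ∧ θ_μ`. (That the `2m` vectors are a basis follows from the values of `g`; the
dual basis is `θ^μ = g (V^μ, ·)`, `θ_μ = g (V_μ, ·)`.) -/
structure IsNullEigenbasis (g : PseudoRiemannianMetric (2 * m) M) (φ : TwoForm (2 * m) M) (x : M)
    (v w : Fin m → ℂ ⊗[ℝ] TangentSpace (𝓡 (2 * m)) x) (lam : Fin m → ℂ) : Prop where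
  g_vv : ∀ μ ν, g.cval x (v μ) (v ν) = 0
  g_ww : ∀ μ ν, g.cval x (w μ) (w ν) = 0
  g_vw : ∀ μ ν, g.cval x (v μ) (w ν) = if μ = ν then 1 else 0
  φ_vv : ∀ μ ν, φ.cval x (v μ) (v ν) = 0
  φ_ww : ∀ μ ν, φ.cval x (w μ) (w ν) = 0
  φ_vw : ∀ μ ν, φ.cval x (v μ) (w ν) = if μ = ν then lam μ else 0

/-- The choice of one vector from each pair `(v μ, w μ)` that is encoded by `s`. -/
def pick {x : M} (v w : Fin m → ℂ ⊗[ℝ] TangentSpace (𝓡 (2 * m)) x) (s : Fin m → Bool)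
    (μ : Fin m) : ℂ ⊗[ℝ] TangentSpace (𝓡 (2 * m)) x :=
  if s μ then v μ else w μ

/-- `D` is the family, indexed by `s : Fin m → Bool`, of the `2^m` distributions on `U` associated
to `φ`: each of them is smooth of rank `m`, and at each point `x` of `U` they are spanned by the
`2^m` choices of one vector from each pair of a null eigenbasis. -/
def IsEigendistributionFamily (g : PseudoRiemannianMetric (2 * m) M) (φ : TwoForm (2 * m) M)
    (U : Set M)
    (D : (Fin m → Bool) → Π x : M, Submodule ℂ (ℂ ⊗[ℝ] TangentSpace (𝓡 (2 * m)) x)) : Prop :=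
  (∀ s, IsSmoothDistribution (D s) m U) ∧
    ∀ x ∈ U, ∃ v w lam, IsNullEigenbasis g φ x v w lam ∧
      ∀ s, D s x = Submodule.span ℂ (Set.range (pick v w s))

/-- The components of `τ = dφ` at `x` in the null basis `v`, `w` vanish, except possibly those
whose indices include a pair `v μ`, `w μ`. Equivalently, `τ` restricts to zero on each of the `2^m`
subspaces spanned by one vector from each pair. -/
def TauComponentsVanish (φ : TwoForm (2 * m) M) (x : M)
    (v w : Fin m → ℂ ⊗[ℝ] TangentSpace (𝓡 (2 * m)) x) : Prop :=
  ∀ (s : Fin m → Bool) (κ μ ν : Fin m),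
    cext₃ (extDeriv φ x) (pick v w s κ) (pick v w s μ) (pick v w s ν) = 0

/-- The `3`-form `a ∧ τ (k, ·, ·)` vanishes at `x`, where `a = g (k, ·)`. -/
def WedgeContractionVanish (g : PseudoRiemannianMetric (2 * m) M) (φ : TwoForm (2 * m) M) (x : M)
    (k : ℂ ⊗[ℝ] TangentSpace (𝓡 (2 * m)) x) : Prop :=
  ∀ A B C : ℂ ⊗[ℝ] TangentSpace (𝓡 (2 * m)) x,
    g.cval x k A * cext₃ (extDeriv φ x) k B C + g.cval x k B * cext₃ (extDeriv φ x) k C A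
      + g.cval x k C * cext₃ (extDeriv φ x) k A B = 0

end Eigendistributions

end CKY

end

/-!
A 2-form `φ` with simple spectrum has a null eigenbasis at each point: eigenvectors for `z` and `y`
with `z + y ≠ 0` are orthogonal for both `g` and `φ`, so `V_μ` pairs only with `V^μ`. By the
implicit function theorem the eigenlines depend smoothly on the point.

Differentiate `φ (A, B) = 0` along `X`, where `A`, `B`, `X` are sections of `D_s` and `A`, `B` are
eigenvectors for `a`, `b`. The term in `K` of the conformal Killing-Yano equation drops out because
`D_s` is isotropic, so `(a + b) g (∇_X A, B)` is a multiple of `τ (X, A, B)`, which vanishes under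
condition (T). As `a + b ≠ 0` and `D_s` is its own orthogonal complement, `∇_X A` lies in `D_s`.
Hence `D_s` is integrable, and in Riemannian signature so is the complex structure whose
`(1,0)`-space is `D_s`.

The eigenbases globalise if one eigenvalue from each pair `±z` can be chosen, and the chosen ones
enumerated, in a canonical way. In Riemannian signature all eigenvalues are imaginary. In Lorentzian
signature exactly one pair is real and the others are imaginary; the two real eigenlines are `L_±`.
The real points of `D_s` form the one of these lines that `s` selects, so this line inherits
`∇_k k ∈ L_±` from `∇_{D_s} D_s ⊆ D_s`.
-/

noncomputable section

namespace CKY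

section Select

variable {ι W : Type*}

/-- The family consisting of one vector from each pair `(v μ, w μ)`, namely `v μ` where `s μ` is
`true`. It is `pick` for vectors of an arbitrary space. -/
def select (v w : ι → W) (s : ι → Bool) (μ : ι) : W := if s μ then v μ else w μ

theorem select_of_eq_true {v w : ι → W} {s : ι → Bool} {μ : ι} (h : s μ = true) :
    select v w s μ = v μ := by simp [select, h]

theorem select_of_eq_false {v w : ι → W} {s : ι → Bool} {μ : ι} (h : s μ = false) :
    select v w s μ = w μ := by simp [select, h]

theorem select_swap (v w : ι → W) (s : ι → Bool) :
    select w v (fun μ => !s μ) = select v w s := by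
  funext μ
  cases h : s μ <;> simp [select, h]

end Select

section HyperbolicBasis

variable {K W ι : Type*} [Field K] [AddCommGroup W] [Module K W]

theorem select_mem_span (v w : ι → W) (s : ι → Bool) (μ : ι) :
    select v w s μ ∈ Submodule.span K (range (select v w s)) :=
  Submodule.subset_span (mem_range_self μ)

theorem apply_eq_zero_of_mem_span {B : LinearMap.BilinForm K W} {b : ι → W}
    (hb : ∀ i j, B (b i) (b j) = 0) {x y : W} (hx : x ∈ Submodule.span K (range b))
    (hy : y ∈ Submodule.span K (range b)) : B x y = 0 := by
  have hleft (i : ι) : Submodule.span K (range b) ≤ LinearMap.ker (B (b i)) :=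
    Submodule.span_le.2 (range_subset_iff.2 fun j => hb i j)
  have hright : Submodule.span K (range b) ≤ LinearMap.ker (B.flip y) :=
    Submodule.span_le.2 (range_subset_iff.2 fun i => hleft i hy)
  exact hright hx

variable [DecidableEq ι] {B : LinearMap.BilinForm K W} {v w : ι → W}

/-- The vectors `v μ`, `w μ` are a basis of `W` that consists of hyperbolic pairs for the symmetric
form `B`. Symmetry is recorded only through the values of `B` on the basis. -/
structure IsHyperbolicBasis (B : LinearMap.BilinForm K W) (v w : ι → W) : Prop where
  vv : ∀ μ ν, B (v μ) (v ν) = 0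
  ww : ∀ μ ν, B (w μ) (w ν) = 0
  vw : ∀ μ ν, B (v μ) (w ν) = if μ = ν then 1 else 0
  wv : ∀ μ ν, B (w μ) (v ν) = if μ = ν then 1 else 0
  span_eq_top : Submodule.span K (range (Sum.elim v w)) = ⊤

namespace IsHyperbolicBasis

theorem swap (h : IsHyperbolicBasis B v w) : IsHyperbolicBasis B w v where
  vv := h.ww
  ww := h.vv
  vw := h.wv
  wv := h.vw
  span_eq_top := by rw [← h.span_eq_top, Sum.elim_range, Sum.elim_range, union_comm]

theorem linearIndependent_elim [Finite ι] (vv : ∀ μ ν, B (v μ) (v ν) = 0)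
    (ww : ∀ μ ν, B (w μ) (w ν) = 0) (vw : ∀ μ ν, B (v μ) (w ν) = if μ = ν then 1 else 0)
    (wv : ∀ μ ν, B (w μ) (v ν) = if μ = ν then 1 else 0) :
    LinearIndependent K (Sum.elim v w) := by
  cases nonempty_fintype ι
  refine Fintype.linearIndependent_iff.2 fun c hc => ?_
  rw [Fintype.sum_sum_type] at hc
  simp only [Sum.elim_inl, Sum.elim_inr] at hc
  rintro (μ | μ)
  · simpa [vw, ww] using congrArg (fun z => B z (w μ)) hc
  · simpa [vv, wv] using congrArg (fun z => B z (v μ)) hc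

theorem of_finrank_eq [Fintype ι] [FiniteDimensional K W]
    (hd : finrank K W = 2 * Fintype.card ι)
    (vv : ∀ μ ν, B (v μ) (v ν) = 0) (ww : ∀ μ ν, B (w μ) (w ν) = 0)
    (vw : ∀ μ ν, B (v μ) (w ν) = if μ = ν then 1 else 0)
    (wv : ∀ μ ν, B (w μ) (v ν) = if μ = ν then 1 else 0) : IsHyperbolicBasis B v w where
  vv := vv
  ww := ww
  vw := vw
  wv := wv
  span_eq_top := (linearIndependent_elim vv ww vw wv).span_eq_top_of_card_eq_finrank'
    (by rw [Fintype.card_sum, hd, two_mul])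

theorem w_apply (h : IsHyperbolicBasis B v w) (A : W) (μ : ι) : B (w μ) A = B A (w μ) := by
  have : B (w μ) = B.flip (w μ) := LinearMap.ext_on_range h.span_eq_top <| by
    rintro (ν | ν) <;> simp [h.wv, h.vw, h.ww, eq_comm]
  exact LinearMap.congr_fun this A

theorem apply_select_select (h : IsHyperbolicBasis B v w) (s : ι → Bool) (μ ν : ι) :
    B (select v w s μ) (select v w s ν) = 0 := by
  by_cases hμν : μ = ν
  · subst hμν
    cases hμ : s μ <;> simp [select, hμ, h.vv, h.ww]
  · cases hμ : s μ <;> cases hν : s ν <;> simp [select, hμ, hν, h.vv, h.ww, h.vw, h.wv, hμν]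

theorem isotropic (h : IsHyperbolicBasis B v w) (s : ι → Bool) {x y : W}
    (hx : x ∈ Submodule.span K (range (select v w s)))
    (hy : y ∈ Submodule.span K (range (select v w s))) : B x y = 0 :=
  apply_eq_zero_of_mem_span (h.apply_select_select s) hx hy

theorem v_mem_span_select_iff (h : IsHyperbolicBasis B v w) (s : ι → Bool) (μ : ι) :
    v μ ∈ Submodule.span K (range (select v w s)) ↔ s μ = true := by
  refine ⟨fun hv => ?_, fun hs => ?_⟩
  · by_contra hs
    have := h.isotropic s hv (select_mem_span v w s μ)
    simp [select_of_eq_false (eq_false_of_ne_true hs), h.vw] at this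
  · simpa only [select_of_eq_true hs] using select_mem_span (K := K) v w s μ

theorem w_mem_span_select_iff (h : IsHyperbolicBasis B v w) (s : ι → Bool) (μ : ι) :
    w μ ∈ Submodule.span K (range (select v w s)) ↔ s μ = false := by
  rw [← select_swap v w s, h.swap.v_mem_span_select_iff, Bool.not_eq_true']

theorem span_select_injective (h : IsHyperbolicBasis B v w) :
    Function.Injective fun s => Submodule.span K (range (select v w s)) := fun s t hst => by
  funext μ
  rw [Bool.eq_iff_iff, ← h.v_mem_span_select_iff, ← h.v_mem_span_select_iff]
  exact iff_of_eq (congrArg (v μ ∈ ·) hst)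

theorem eq_sum [Fintype ι] (h : IsHyperbolicBasis B v w) (A : W) :
    A = ∑ μ, B A (w μ) • v μ + ∑ μ, B A (v μ) • w μ := by
  have hA : A ∈ Submodule.span K (range (Sum.elim v w)) := h.span_eq_top ▸ Submodule.mem_top
  obtain ⟨c, rfl⟩ := (Submodule.mem_span_range_iff_exists_fun K).1 hA
  simp [Fintype.sum_sum_type, h.vv, h.wv, h.vw, h.ww]

variable [Finite ι]

theorem ext (h : IsHyperbolicBasis B v w) {A A' : W} (hv : ∀ μ, B A (v μ) = B A' (v μ))
    (hw : ∀ μ, B A (w μ) = B A' (w μ)) : A = A' := by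
  cases nonempty_fintype ι
  rw [h.eq_sum A, h.eq_sum A']
  simp only [hv, hw]

theorem linearIndependent (h : IsHyperbolicBasis B v w) : LinearIndependent K (Sum.elim v w) :=
  linearIndependent_elim h.vv h.ww h.vw h.wv

theorem finrank_eq (h : IsHyperbolicBasis B v w) : finrank K W = Nat.card (ι ⊕ ι) :=
  finrank_eq_nat_card_basis (Basis.mk h.linearIndependent h.span_eq_top.ge)

theorem linearIndependent_select (h : IsHyperbolicBasis B v w) (s : ι → Bool) :
    LinearIndependent K (select v w s) := by
  have hinj : Function.Injective fun μ => (if s μ then Sum.inl μ else Sum.inr μ : ι ⊕ ι) := by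
    intro μ ν hμν
    cases hμ : s μ <;> cases hν : s ν <;> simp_all
  convert h.linearIndependent.comp _ hinj using 1
  funext μ
  cases hμ : s μ <;> simp [select, hμ]

theorem finrank_span_select (h : IsHyperbolicBasis B v w) (s : ι → Bool) :
    finrank K (Submodule.span K (range (select v w s))) = Nat.card ι :=
  finrank_eq_nat_card_basis (Basis.span (h.linearIndependent_select s))

theorem mem_span_select_of_orthogonal (h : IsHyperbolicBasis B v w) (s : ι → Bool) {A : W}
    (hA : ∀ μ, B A (select v w s μ) = 0) : A ∈ Submodule.span K (range (select v w s)) := by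
  cases nonempty_fintype ι
  rw [h.eq_sum A]
  refine add_mem (sum_mem fun μ _ => ?_) (sum_mem fun μ _ => ?_)
  · cases hs : s μ
    · have hAw := select_of_eq_false (v := v) (w := w) hs ▸ hA μ
      simp [hAw]
    · exact Submodule.smul_mem _ _ ((h.v_mem_span_select_iff s μ).2 hs)
  · cases hs : s μ
    · exact Submodule.smul_mem _ _ ((h.w_mem_span_select_iff s μ).2 hs)
    · have hAv := select_of_eq_true (v := v) (w := w) hs ▸ hA μ
      simp [hAv]

end IsHyperbolicBasis

end HyperbolicBasis

section Pencil

variable {K W ι : Type*} [Field K] [AddCommGroup W] [Module K W]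

/-- The eigenvalues of the pencil `Ω - z B`, on the side used by `eigenvalues`. -/
def pencilEigenvalues (B Ω : LinearMap.BilinForm K W) : Set K :=
  {z | ∃ l : W, l ≠ 0 ∧ ∀ A, Ω A l = z * B A l}

/-- All eigenvalues of the pencil `Ω - z B` are simple, encoded by counting them. -/
def HasSimpleSpectrum (B Ω : LinearMap.BilinForm K W) : Prop :=
  (pencilEigenvalues B Ω).ncard = finrank K W

/-- A hyperbolic basis for the symmetric form `B` that also puts the skew form `Ω` into normal
form: `w μ` and `v μ` are eigenvectors of the pencil `Ω - z B` for `lam μ` and `- lam μ`. -/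
structure IsPencilBasis [DecidableEq ι] (B Ω : LinearMap.BilinForm K W) (v w : ι → W)
    (lam : ι → K) : Prop extends IsHyperbolicBasis B v w where
  Ω_vv : ∀ μ ν, Ω (v μ) (v ν) = 0
  Ω_ww : ∀ μ ν, Ω (w μ) (w ν) = 0
  Ω_vw : ∀ μ ν, Ω (v μ) (w ν) = if μ = ν then lam μ else 0
  Ω_wv : ∀ μ ν, Ω (w μ) (v ν) = if μ = ν then -lam μ else 0

variable {B Ω : LinearMap.BilinForm K W} {v w : ι → W} {lam : ι → K}

namespace IsPencilBasis

variable [DecidableEq ι]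

theorem swap (h : IsPencilBasis B Ω v w lam) : IsPencilBasis B Ω w v (-lam) where
  toIsHyperbolicBasis := h.toIsHyperbolicBasis.swap
  Ω_vv := h.Ω_ww
  Ω_ww := h.Ω_vv
  Ω_vw := h.Ω_wv
  Ω_wv μ ν := by simp [h.Ω_vw]

theorem isotropic_skew (h : IsPencilBasis B Ω v w lam) (s : ι → Bool) {x y : W}
    (hx : x ∈ Submodule.span K (range (select v w s)))
    (hy : y ∈ Submodule.span K (range (select v w s))) : Ω x y = 0 := by
  refine apply_eq_zero_of_mem_span (fun μ ν => ?_) hx hy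
  by_cases hμν : μ = ν
  · subst hμν
    cases hμ : s μ <;> simp [select, hμ, h.Ω_vv, h.Ω_ww]
  · cases hμ : s μ <;> cases hν : s ν <;>
      simp [select, hμ, hν, h.Ω_vv, h.Ω_ww, h.Ω_vw, h.Ω_wv, hμν]

theorem Ω_apply_w (h : IsPencilBasis B Ω v w lam) (A : W) (μ : ι) :
    Ω A (w μ) = lam μ * B A (w μ) := by
  have : Ω.flip (w μ) = lam μ • B.flip (w μ) := LinearMap.ext_on_range h.span_eq_top <| by
    rintro (ν | ν)
    · by_cases hν : ν = μ <;> simp [h.Ω_vw, h.vw, hν]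
    · simp [h.Ω_ww, h.ww]
  exact LinearMap.congr_fun this A

theorem Ω_apply_v (h : IsPencilBasis B Ω v w lam) (A : W) (μ : ι) :
    Ω A (v μ) = -lam μ * B A (v μ) :=
  h.swap.Ω_apply_w A μ

theorem Ω_w_apply (h : IsPencilBasis B Ω v w lam) (A : W) (μ : ι) :
    Ω (w μ) A = -lam μ * B (w μ) A := by
  have : Ω (w μ) = -lam μ • B (w μ) := LinearMap.ext_on_range h.span_eq_top <| by
    rintro (ν | ν)
    · by_cases hν : μ = ν <;> simp [h.Ω_wv, h.wv, hν]
    · simp [h.Ω_ww, h.ww]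
  exact LinearMap.congr_fun this A

section Eigenvector

variable {l : W} {z : K}

theorem apply_w_eq_zero_of_ne (h : IsPencilBasis B Ω v w lam) (hl : ∀ A, Ω A l = z * B A l)
    {μ : ι} (hz : z ≠ -lam μ) : B l (w μ) = 0 := by
  have hw := hl (w μ)
  rw [h.Ω_w_apply, h.w_apply] at hw
  have : (z - -lam μ) * B l (w μ) = 0 := by linear_combination -hw
  exact (mul_eq_zero.1 this).resolve_left (sub_ne_zero.2 hz)

theorem apply_v_eq_zero_of_ne (h : IsPencilBasis B Ω v w lam) (hl : ∀ A, Ω A l = z * B A l)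
    {μ : ι} (hz : z ≠ lam μ) : B l (v μ) = 0 :=
  h.swap.apply_w_eq_zero_of_ne hl (by simpa using hz)

variable [Finite ι]

theorem pencilEigenvalues_eq (h : IsPencilBasis B Ω v w lam) :
    pencilEigenvalues B Ω = range (Sum.elim lam (-lam)) := by
  refine Subset.antisymm ?_ ?_
  · rintro z ⟨l, hl, hz⟩
    by_contra hne
    have hw (μ : ι) : B l (w μ) = 0 :=
      h.apply_w_eq_zero_of_ne hz fun h0 => hne ⟨Sum.inr μ, h0.symm⟩
    have hv (μ : ι) : B l (v μ) = 0 :=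
      h.apply_v_eq_zero_of_ne hz fun h0 => hne ⟨Sum.inl μ, h0.symm⟩
    exact hl (h.ext (by simp [hv]) (by simp [hw]))
  · rintro _ ⟨μ | μ, rfl⟩
    · exact ⟨w μ, h.linearIndependent.ne_zero (Sum.inr μ), fun A => h.Ω_apply_w A μ⟩
    · exact ⟨v μ, h.linearIndependent.ne_zero (Sum.inl μ), fun A => h.Ω_apply_v A μ⟩

theorem lam_mem (h : IsPencilBasis B Ω v w lam) (μ : ι) : lam μ ∈ pencilEigenvalues B Ω :=
  h.pencilEigenvalues_eq ▸ ⟨Sum.inl μ, rfl⟩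

theorem injective_elim (h : IsPencilBasis B Ω v w lam) (hs : HasSimpleSpectrum B Ω) :
    Function.Injective (Sum.elim lam (-lam)) := by
  rw [HasSimpleSpectrum, h.pencilEigenvalues_eq, ← image_univ, h.finrank_eq] at hs
  refine injOn_univ.1 ((ncard_image_iff (toFinite univ)).1 ?_)
  rw [hs, ncard_univ]

theorem lam_injective (h : IsPencilBasis B Ω v w lam) (hs : HasSimpleSpectrum B Ω) :
    Function.Injective lam :=
  (h.injective_elim hs).comp Sum.inl_injective

theorem lam_ne_neg_lam (h : IsPencilBasis B Ω v w lam) (hs : HasSimpleSpectrum B Ω) (μ ν : ι) :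
    lam μ ≠ -lam ν := fun h0 =>
  Sum.inl_ne_inr (h.injective_elim hs (a₁ := Sum.inl μ) (a₂ := Sum.inr ν) h0)

theorem eq_smul_w (h : IsPencilBasis B Ω v w lam) (hs : HasSimpleSpectrum B Ω) {μ : ι}
    (hl : ∀ A, Ω A l = lam μ * B A l) : l = B l (v μ) • w μ := by
  have hw (ν : ι) : B l (w ν) = 0 := h.apply_w_eq_zero_of_ne hl (h.lam_ne_neg_lam hs μ ν)
  have hv (ν : ι) (hν : ν ≠ μ) : B l (v ν) = 0 :=
    h.apply_v_eq_zero_of_ne hl fun h0 => hν (h.lam_injective hs h0).symm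
  refine h.ext (fun ν => ?_) fun ν => by simp [hw, h.ww]
  by_cases hν : ν = μ
  · simp [hν, h.wv]
  · simp [hv ν hν, h.wv, Ne.symm hν]

theorem eq_smul_v (h : IsPencilBasis B Ω v w lam) (hs : HasSimpleSpectrum B Ω) {μ : ι}
    (hl : ∀ A, Ω A l = -lam μ * B A l) : l = B l (w μ) • v μ :=
  h.swap.eq_smul_w hs hl

end Eigenvector

variable [Finite ι]

theorem span_select_le {v' w' : ι → W} (h : IsPencilBasis B Ω v w lam)
    (h' : IsPencilBasis B Ω v' w' lam) (hs : HasSimpleSpectrum B Ω) (s : ι → Bool) :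
    Submodule.span K (range (select v w s)) ≤ Submodule.span K (range (select v' w' s)) := by
  refine Submodule.span_le.2 (range_subset_iff.2 fun μ => ?_)
  cases hμ : s μ
  · rw [select_of_eq_false hμ, h'.eq_smul_w hs fun A => h.Ω_apply_w A μ]
    exact Submodule.smul_mem _ _ ((h'.w_mem_span_select_iff s μ).2 hμ)
  · rw [select_of_eq_true hμ, h'.eq_smul_v hs fun A => h.Ω_apply_v A μ]
    exact Submodule.smul_mem _ _ ((h'.v_mem_span_select_iff s μ).2 hμ)

theorem span_select_eq {v' w' : ι → W} (h : IsPencilBasis B Ω v w lam)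
    (h' : IsPencilBasis B Ω v' w' lam) (hs : HasSimpleSpectrum B Ω) (s : ι → Bool) :
    Submodule.span K (range (select v w s)) = Submodule.span K (range (select v' w' s)) :=
  le_antisymm (h.span_select_le h' hs s) (h'.span_select_le h hs s)

end IsPencilBasis

end Pencil

section PencilExistence

variable {K W ι : Type*} [Field K] [AddCommGroup W] [Module K W] {B Ω : LinearMap.BilinForm K W}

theorem apply_eq_zero_of_add_ne_zero (hB : B.IsSymm) (hΩ : ∀ a b, Ω a b = -Ω b a) {x y : W}
    {p q : K} (hx : ∀ A, Ω A x = p * B A x) (hy : ∀ A, Ω A y = q * B A y) (hpq : p + q ≠ 0) :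
    B x y = 0 := by
  have hxy := hy x
  rw [hΩ, hx, hB.eq] at hxy
  have : (p + q) * B x y = 0 := by linear_combination -hxy
  exact (mul_eq_zero.1 this).resolve_left hpq

theorem hasEigenvector_of_apply_eq (hB : B.Nondegenerate) {F : Module.End K W}
    (hF : ∀ A l, Ω A l = B A (F l)) {z : K} {l : W} (hl : l ≠ 0)
    (hz : ∀ A, Ω A l = z * B A l) : F.HasEigenvector z l := by
  refine ⟨?_, hl⟩
  rw [Module.End.mem_eigenspace_iff, ← sub_eq_zero]
  refine hB.2 _ fun A => ?_
  rw [map_sub, ← hF, hz, map_smul, smul_eq_mul, sub_self]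

theorem neg_mem_pencilEigenvalues_and_apply_ne_zero (hBn : B.Nondegenerate) (hB : B.IsSymm)
    (hΩ : ∀ a b, Ω a b = -Ω b a) {u : K → W}
    (hu : ∀ z ∈ pencilEigenvalues B Ω, u z ≠ 0 ∧ ∀ A, Ω A (u z) = z * B A (u z))
    (hspan : Submodule.span K (u '' pencilEigenvalues B Ω) = ⊤) {z : K}
    (hz : z ∈ pencilEigenvalues B Ω) :
    -z ∈ pencilEigenvalues B Ω ∧ B (u (-z)) (u z) ≠ 0 := by
  by_contra! hcon
  have horth : B.flip (u z) = 0 := LinearMap.ext_on hspan <| by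
    rintro _ ⟨y, hy, rfl⟩
    by_cases hyz : y + z = 0
    · obtain rfl := eq_neg_of_add_eq_zero_left hyz
      exact hcon hy
    · exact apply_eq_zero_of_add_ne_zero hB hΩ (hu y hy).2 (hu z hz).2 hyz
  exact (hu z hz).1 (hBn.2 _ fun A => LinearMap.congr_fun horth A)

theorem IsHyperbolicBasis.isPencilBasis [DecidableEq ι] {v w : ι → W} {lam : ι → K}
    (h : IsHyperbolicBasis B v w) (hw : ∀ A μ, Ω A (w μ) = lam μ * B A (w μ))
    (hv : ∀ A μ, Ω A (v μ) = -lam μ * B A (v μ)) : IsPencilBasis B Ω v w lam where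
  toIsHyperbolicBasis := h
  Ω_vv μ ν := by rw [hv, h.vv, mul_zero]
  Ω_ww μ ν := by rw [hw, h.ww, mul_zero]
  Ω_vw μ ν := by by_cases hμν : μ = ν <;> simp [hw, h.vw, hμν]
  Ω_wv μ ν := by by_cases hμν : μ = ν <;> simp [hv, h.wv, hμν]

variable [FiniteDimensional K W]

theorem exists_pencil_endomorphism (hBn : B.Nondegenerate) (hB : B.IsSymm) :
    ∃ F : Module.End K W, ∀ A l, Ω A l = B A (F l) := by
  refine ⟨(B.toDual hBn).symm.toLinearMap ∘ₗ Ω.flip, fun A l => ?_⟩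
  rw [hB.eq]
  simp

theorem pencilEigenvalues_finite (hBn : B.Nondegenerate) (hB : B.IsSymm) :
    (pencilEigenvalues B Ω).Finite := by
  obtain ⟨F, hF⟩ := exists_pencil_endomorphism (Ω := Ω) hBn hB
  refine F.finite_hasEigenvalue.subset ?_
  rintro z ⟨l, hl, hz⟩
  exact Module.End.hasEigenvalue_of_hasEigenvector (hasEigenvector_of_apply_eq hBn hF hl hz)

theorem exists_pencil_eigenvectors (hBn : B.Nondegenerate) (hB : B.IsSymm)
    (hs : HasSimpleSpectrum B Ω) :
    ∃ u : K → W, (∀ z ∈ pencilEigenvalues B Ω, u z ≠ 0 ∧ ∀ A, Ω A (u z) = z * B A (u z)) ∧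
      Submodule.span K (u '' pencilEigenvalues B Ω) = ⊤ := by
  classical
  obtain ⟨F, hF⟩ := exists_pencil_endomorphism (Ω := Ω) hBn hB
  choose! u hu using fun z (hz : z ∈ pencilEigenvalues B Ω) => hz
  refine ⟨u, hu, ?_⟩
  have hli : LinearIndependent K fun z : pencilEigenvalues B Ω => u z :=
    Module.End.eigenvectors_linearIndependent' F (fun z : pencilEigenvalues B Ω => (z : K))
      Subtype.coe_injective _
      fun z => hasEigenvector_of_apply_eq hBn hF (hu z z.2).1 (hu z z.2).2
  have : Fintype (pencilEigenvalues B Ω) := (pencilEigenvalues_finite hBn hB).fintype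
  rw [image_eq_range]
  exact hli.span_eq_top_of_card_eq_finrank' (by rw [← hs, Fintype.card_eq_nat_card]; rfl)

theorem neg_mem_pencilEigenvalues (hBn : B.Nondegenerate) (hB : B.IsSymm)
    (hΩ : ∀ a b, Ω a b = -Ω b a) (hs : HasSimpleSpectrum B Ω) {z : K}
    (hz : z ∈ pencilEigenvalues B Ω) : -z ∈ pencilEigenvalues B Ω := by
  obtain ⟨u, hu, hspan⟩ := exists_pencil_eigenvectors hBn hB hs
  exact (neg_mem_pencilEigenvalues_and_apply_ne_zero hBn hB hΩ hu hspan hz).1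

theorem isPencilBasis_of_eigenvectors [Fintype ι] [DecidableEq ι] (hB : B.IsSymm)
    (hΩ : ∀ a b, Ω a b = -Ω b a) (hd : finrank K W = 2 * Fintype.card ι) {v w : ι → W}
    {lam : ι → K} (hw : ∀ A μ, Ω A (w μ) = lam μ * B A (w μ))
    (hv : ∀ A μ, Ω A (v μ) = -lam μ * B A (v μ)) (hr : ∀ μ, B (v μ) (w μ) ≠ 0)
    (hinj : Function.Injective lam) (hne : ∀ μ ν, lam μ + lam ν ≠ 0) :
    IsPencilBasis B Ω (fun μ => (B (v μ) (w μ))⁻¹ • v μ) w lam := by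
  have hvv (μ ν : ι) : B (v μ) (v ν) = 0 :=
    apply_eq_zero_of_add_ne_zero hB hΩ (hv · μ) (hv · ν)
      fun h0 => hne μ ν (by linear_combination -h0)
  have hww (μ ν : ι) : B (w μ) (w ν) = 0 :=
    apply_eq_zero_of_add_ne_zero hB hΩ (hw · μ) (hw · ν) (hne μ ν)
  have hvw (μ ν : ι) : (B (v μ) (w μ))⁻¹ * B (v μ) (w ν) = if μ = ν then 1 else 0 := by
    split_ifs with h
    · subst h
      exact inv_mul_cancel₀ (hr μ)
    · rw [apply_eq_zero_of_add_ne_zero hB hΩ (hv · μ) (hw · ν)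
        fun h0 => h (hinj (by linear_combination -h0)), mul_zero]
  have hwv (μ ν : ι) : (B (v ν) (w ν))⁻¹ * B (w μ) (v ν) = if μ = ν then 1 else 0 := by
    rw [hB.eq (w μ), hvw, if_congr eq_comm rfl rfl]
  have hbasis : IsHyperbolicBasis B (fun μ => (B (v μ) (w μ))⁻¹ • v μ) w :=
    IsHyperbolicBasis.of_finrank_eq hd (by simp [hvv]) hww (by simpa using hvw) (by simpa using hwv)
  exact hbasis.isPencilBasis hw fun A μ => by simp [hv, mul_left_comm]

theorem exists_isPencilBasis [Fintype ι] [DecidableEq ι] (hBn : B.Nondegenerate) (hB : B.IsSymm)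
    (hΩ : ∀ a b, Ω a b = -Ω b a) (hs : HasSimpleSpectrum B Ω)
    (hd : finrank K W = 2 * Fintype.card ι) {lam : ι → K}
    (hmem : ∀ μ, lam μ ∈ pencilEigenvalues B Ω) (hinj : Function.Injective lam)
    (hne : ∀ μ ν, lam μ + lam ν ≠ 0) : ∃ v w, IsPencilBasis B Ω v w lam := by
  obtain ⟨u, hu, hspan⟩ := exists_pencil_eigenvectors hBn hB hs
  have hpair (μ : ι) :=
    neg_mem_pencilEigenvalues_and_apply_ne_zero hBn hB hΩ hu hspan (hmem μ)
  exact ⟨_, _, isPencilBasis_of_eigenvectors hB hΩ hd (fun A μ => (hu _ (hmem μ)).2 A)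
    (fun A μ => (hu _ (hpair μ).1).2 A) (fun μ => (hpair μ).2) hinj hne⟩

end PencilExistence

section HalfSpectrum

theorem ncard_sep_eq_of_neg {α : Type*} [AddGroup α] {S : Set α} (hS : S.Finite)
    (hneg : ∀ z ∈ S, -z ∈ S) {P : α → Prop} (hP0 : ¬P 0)
    (hP : ∀ z ∈ S, z ≠ 0 → (P z ↔ ¬P (-z))) {m : ℕ} (hm : S.ncard = 2 * m) :
    {z ∈ S | P z}.ncard = m := by
  have hT : {z ∈ S | P z}.Finite := hS.subset (sep_subset _ _)
  have himage : S \ {0} = {z ∈ S | P z} ∪ -{z ∈ S | P z} := by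
    ext z
    have hzneg : -z ∈ S ↔ z ∈ S := ⟨fun h => neg_neg z ▸ hneg _ h, hneg z⟩
    by_cases hz : z = 0
    · simp [hz, hP0]
    · by_cases hzS : z ∈ S
      · simp [hz, hzS, hzneg, hP z hzS hz, not_or_of_imp]
      · simp [hzS, hzneg]
  have hdisj : Disjoint {z ∈ S | P z} (-{z ∈ S | P z}) := by
    refine Set.disjoint_left.2 fun z hz hz' => (hP z hz.1 ?_).1 hz.2 hz'.2
    rintro rfl
    exact hP0 hz.2
  have hcard : (S \ {0}).ncard = 2 * {z ∈ S | P z}.ncard := by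
    rw [himage, ncard_union_eq hdisj hT hT.neg, ncard_neg, two_mul]
  by_cases h0 : 0 ∈ S
  · have := ncard_sdiff_singleton_add_one h0 hS
    omega
  · rw [sdiff_singleton_eq_self h0] at hcard
    omega

theorem exists_strictMono_comp_range_eq {α Γ : Type*} [LinearOrder Γ] {T : Set α}
    (hT : T.Finite) {κ : α → Γ} (hκ : InjOn κ T) {m : ℕ} (hm : T.ncard = m) :
    ∃ lam : Fin m → α, range lam = T ∧ StrictMono (κ ∘ lam) := by
  have hfin : (κ '' T).Finite := hT.image κ
  have hcard : hfin.toFinset.card = m := by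
    rw [← ncard_eq_toFinset_card _ hfin, hκ.ncard_image, hm]
  let e := hfin.toFinset.orderEmbOfFin hcard
  have he : range e = κ '' T := by simp [e]
  choose lam hlam hκlam using fun μ => he.subset (mem_range_self μ)
  refine ⟨lam, (range_subset_iff.2 hlam).antisymm fun z hz => ?_, ?_⟩
  · obtain ⟨μ, hμ⟩ := he.symm.subset (mem_image_of_mem κ hz)
    exact ⟨μ, hκ (hlam μ) hz ((hκlam μ).trans hμ)⟩
  · exact (funext hκlam : κ ∘ lam = e) ▸ e.strictMono

theorem exists_isPencilBasis_of_half {K W Γ : Type*} [Field K] [AddCommGroup W] [Module K W]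
    [FiniteDimensional K W] [LinearOrder Γ] {B Ω : LinearMap.BilinForm K W} {m : ℕ}
    (hBn : B.Nondegenerate) (hB : B.IsSymm) (hΩ : ∀ a b, Ω a b = -Ω b a)
    (hs : HasSimpleSpectrum B Ω) (hd : finrank K W = 2 * m) {P : K → Prop} (hP0 : ¬P 0)
    (hP : ∀ z ∈ pencilEigenvalues B Ω, z ≠ 0 → (P z ↔ ¬P (-z))) {κ : K → Γ}
    (hκ : InjOn κ {z ∈ pencilEigenvalues B Ω | P z}) :
    ∃ (v w : Fin m → W) (lam : Fin m → K), IsPencilBasis B Ω v w lam ∧ (∀ μ, P (lam μ)) ∧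
      StrictMono (κ ∘ lam) := by
  have hfin : (pencilEigenvalues B Ω).Finite := pencilEigenvalues_finite hBn hB
  obtain ⟨lam, hrange, hmono⟩ := exists_strictMono_comp_range_eq (hfin.subset (sep_subset _ _)) hκ
    (ncard_sep_eq_of_neg hfin (fun z => neg_mem_pencilEigenvalues hBn hB hΩ hs) hP0 hP
      (hs.trans hd))
  have hlam (μ : Fin m) : lam μ ∈ pencilEigenvalues B Ω ∧ P (lam μ) :=
    hrange.subset (mem_range_self μ)
  have hne (μ ν : Fin m) : lam μ + lam ν ≠ 0 := fun h0 => by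
    refine (hP _ (hlam μ).1 fun h => hP0 (h ▸ (hlam μ).2)).1 (hlam μ).2 ?_
    rw [neg_eq_of_add_eq_zero_right h0]
    exact (hlam ν).2
  obtain ⟨v, w, h⟩ := exists_isPencilBasis hBn hB hΩ hs (by rw [hd, Fintype.card_fin])
    (fun μ => (hlam μ).1) (hmono.injective.of_comp) hne
  exact ⟨v, w, lam, h, fun μ => (hlam μ).2, hmono⟩

/-- The enumeration `lam` lists, by increasing `im - re`, numbers of the half plane
`0 < re + im`. This half plane contains one of `± z` for each nonzero `z` that is real or
imaginary, and for such `z` in it a real `z` has negative and an imaginary one positive `im - re`;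
unlike a lexicographic order the condition is open. -/
structure IsOrderedHalf {m : ℕ} (lam : Fin m → ℂ) : Prop where
  pos : ∀ μ, 0 < (lam μ).re + (lam μ).im
  strictMono : StrictMono fun μ => (lam μ).im - (lam μ).re

/-- The condition on a set `S = -S` of complex numbers under which exactly one enumeration of one
number from each pair `± z` is an `IsOrderedHalf`. -/
structure IsOrderable (S : Set ℂ) : Prop where
  ne_zero : ∀ z ∈ S, z.re + z.im ≠ 0
  injOn : InjOn (fun z => z.im - z.re) {z ∈ S | 0 < z.re + z.im}

variable {W : Type*} [AddCommGroup W] [Module ℂ W] {B Ω : LinearMap.BilinForm ℂ W} {m : ℕ}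

theorem exists_isPencilBasis_complex [FiniteDimensional ℂ W] (hBn : B.Nondegenerate)
    (hB : B.IsSymm) (hΩ : ∀ a b, Ω a b = -Ω b a) (hs : HasSimpleSpectrum B Ω)
    (hd : finrank ℂ W = 2 * m) :
    ∃ (v w : Fin m → W) (lam : Fin m → ℂ), IsPencilBasis B Ω v w lam := by
  let κ (z : ℂ) : ℝ ×ₗ ℝ := toLex (z.re, z.im)
  have hκ : Function.Injective κ := fun z y h => by
    have h' := Prod.ext_iff.1 (toLex_inj.1 h)
    exact Complex.ext h'.1 h'.2
  have hP (z : ℂ) (hz : z ≠ 0) : 0 < κ z ↔ ¬0 < κ (-z) := by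
    have hκz : κ z ≠ 0 := fun h => hz (hκ h)
    have hneg : κ (-z) = -κ z := rfl
    rw [hneg, neg_pos, not_lt, hκz.symm.le_iff_lt]
  obtain ⟨v, w, lam, h, -⟩ := exists_isPencilBasis_of_half (P := (0 < κ ·)) hBn hB hΩ hs hd
    (lt_irrefl (0 : ℝ ×ₗ ℝ)) (fun z _ => hP z) hκ.injOn
  exact ⟨v, w, lam, h⟩

theorem exists_isPencilBasis_isOrderedHalf [FiniteDimensional ℂ W] (hBn : B.Nondegenerate)
    (hB : B.IsSymm) (hΩ : ∀ a b, Ω a b = -Ω b a) (hs : HasSimpleSpectrum B Ω)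
    (hd : finrank ℂ W = 2 * m) (hS : IsOrderable (pencilEigenvalues B Ω)) :
    ∃ (v w : Fin m → W) (lam : Fin m → ℂ), IsPencilBasis B Ω v w lam ∧ IsOrderedHalf lam := by
  have hP (z : ℂ) (hz : z ∈ pencilEigenvalues B Ω) :
      0 < z.re + z.im ↔ ¬0 < (-z).re + (-z).im := by
    rw [Complex.neg_re, Complex.neg_im, ← neg_add, neg_pos, not_lt,
      (hS.ne_zero z hz).symm.le_iff_lt]
  obtain ⟨v, w, lam, h, hpos, hmono⟩ :=
    exists_isPencilBasis_of_half (P := fun z => 0 < z.re + z.im) hBn hB hΩ hs hd (by simp)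
      (fun z hz _ => hP z hz) hS.injOn
  exact ⟨v, w, lam, h, hpos, hmono⟩

theorem IsPencilBasis.range_eq_of_isOrderedHalf {v w : Fin m → W} {lam : Fin m → ℂ}
    (h : IsPencilBasis B Ω v w lam) (ho : IsOrderedHalf lam) :
    range lam = {z ∈ pencilEigenvalues B Ω | 0 < z.re + z.im} := by
  refine Subset.antisymm ?_ ?_
  · rintro _ ⟨μ, rfl⟩
    exact ⟨h.lam_mem μ, ho.pos μ⟩
  · rintro z ⟨hz, hpos⟩
    rw [h.pencilEigenvalues_eq] at hz
    obtain ⟨μ | μ, rfl⟩ := hz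
    · exact mem_range_self μ
    · have := ho.pos μ
      simp only [Sum.elim_inr, Pi.neg_apply, Complex.neg_re, Complex.neg_im] at hpos
      linarith

theorem IsPencilBasis.eq_of_isOrderedHalf {v w v' w' : Fin m → W} {lam lam' : Fin m → ℂ}
    (h : IsPencilBasis B Ω v w lam) (h' : IsPencilBasis B Ω v' w' lam')
    (hS : IsOrderable (pencilEigenvalues B Ω)) (ho : IsOrderedHalf lam)
    (ho' : IsOrderedHalf lam') : lam = lam' := by
  have hrange := (h.range_eq_of_isOrderedHalf ho).trans (h'.range_eq_of_isOrderedHalf ho').symm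
  let κ (z : ℂ) : ℝ := z.im - z.re
  have hκ : κ ∘ lam = κ ∘ lam' := by
    refine (StrictMono.range_inj ho.strictMono ho'.strictMono).1 ?_
    exact (range_comp κ lam).trans ((congrArg (κ '' ·) hrange).trans (range_comp κ lam').symm)
  funext μ
  exact hS.injOn ⟨h.lam_mem μ, ho.pos μ⟩ ⟨h'.lam_mem μ, ho'.pos μ⟩ (congrFun hκ μ)

end HalfSpectrum

section Complexification

variable {V : Type*} [AddCommGroup V] [Module ℝ V]

@[simp] theorem cre_tmul (z : ℂ) (a : V) : cre (z ⊗ₜ[ℝ] a) = z.re • a := by simp [cre]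

@[simp] theorem cim_tmul (z : ℂ) (a : V) : cim (z ⊗ₜ[ℝ] a) = z.im • a := by simp [cim]

@[simp] theorem cre_cmk (a b : V) : cre (cmk a b) = a := by simp [cmk]

@[simp] theorem cim_cmk (a b : V) : cim (cmk a b) = b := by simp [cmk]

@[simp] theorem cmk_cre_cim (A : ℂ ⊗[ℝ] V) : cmk (cre A) (cim A) = A := by
  induction A using TensorProduct.induction_on with
  | zero => simp [cmk]
  | tmul z a =>
    rw [cmk, cre_tmul, cim_tmul, ← TensorProduct.smul_tmul, ← TensorProduct.smul_tmul,
      ← TensorProduct.add_tmul]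
    congr 1
    simp
  | add x y hx hy =>
    conv_rhs => rw [← hx, ← hy]
    simp only [cmk, map_add, TensorProduct.tmul_add]
    abel

theorem ctensor_ext {A B : ℂ ⊗[ℝ] V} (hre : cre A = cre B) (him : cim A = cim B) : A = B := by
  rw [← cmk_cre_cim A, ← cmk_cre_cim B, hre, him]

@[simp] theorem cre_smul (z : ℂ) (A : ℂ ⊗[ℝ] V) :
    cre (z • A) = z.re • cre A - z.im • cim A := by
  induction A using TensorProduct.induction_on with
  | zero => simp
  | tmul y a => simp [TensorProduct.smul_tmul', sub_smul, mul_smul]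
  | add x y hx hy =>
    simp only [smul_add, map_add, hx, hy]
    abel

@[simp] theorem cim_smul (z : ℂ) (A : ℂ ⊗[ℝ] V) :
    cim (z • A) = z.re • cim A + z.im • cre A := by
  induction A using TensorProduct.induction_on with
  | zero => simp
  | tmul y a => simp [TensorProduct.smul_tmul', add_smul, mul_smul]
  | add x y hx hy =>
    simp only [smul_add, map_add, hx, hy]
    abel

theorem baseChange_eq (b : LinearMap.BilinForm ℝ V) (A B : ℂ ⊗[ℝ] V) :
    LinearMap.BilinForm.baseChange ℂ b A B =
      ⟨b (cre A) (cre B) - b (cim A) (cim B), b (cre A) (cim B) + b (cim A) (cre B)⟩ := by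
  conv_lhs => rw [← cmk_cre_cim A, ← cmk_cre_cim B]
  apply Complex.ext
  · simp [cmk, LinearMap.BilinForm.baseChange_tmul, sub_eq_add_neg]
  · simp [cmk, LinearMap.BilinForm.baseChange_tmul, add_comm]

/-- Complex conjugation on `ℂ ⊗ V`. -/
def cconj : ℂ ⊗[ℝ] V →ₛₗ[starRingEnd ℂ] ℂ ⊗[ℝ] V where
  toFun A := cmk (cre A) (-cim A)
  map_add' A B := by
    apply ctensor_ext
    · simp
    · simp [add_comm]
  map_smul' z A := by
    apply ctensor_ext
    · simp
    · simp [add_comm]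

@[simp] theorem cre_cconj (A : ℂ ⊗[ℝ] V) : cre (cconj A) = cre A := cre_cmk _ _

@[simp] theorem cim_cconj (A : ℂ ⊗[ℝ] V) : cim (cconj A) = -cim A := cim_cmk _ _

theorem cconj_cconj (A : ℂ ⊗[ℝ] V) : cconj (cconj A) = A := by
  apply ctensor_ext <;> simp

theorem cconj_one_tmul (a : V) : cconj ((1 : ℂ) ⊗ₜ[ℝ] a) = 1 ⊗ₜ a := by
  apply ctensor_ext <;> simp

theorem baseChange_cconj (b : LinearMap.BilinForm ℝ V) (A B : ℂ ⊗[ℝ] V) :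
    LinearMap.BilinForm.baseChange ℂ b (cconj A) (cconj B) =
      (starRingEnd ℂ) (LinearMap.BilinForm.baseChange ℂ b A B) := by
  rw [baseChange_eq, baseChange_eq]
  apply Complex.ext
  · simp
  · simp [add_comm]

end Complexification

section ComplexifiedForms

variable {n : ℕ} {M : Type*} [TopologicalSpace M] [ChartedSpace (EuclideanSpace ℝ (Fin n)) M]

instance finiteDimensional_tangentSpace (x : M) : FiniteDimensional ℝ (TangentSpace (𝓡 n) x) :=
  inferInstanceAs (FiniteDimensional ℝ (EuclideanSpace ℝ (Fin n)))

theorem finrank_complexified_tangentSpace (x : M) :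
    finrank ℂ (ℂ ⊗[ℝ] TangentSpace (𝓡 n) x) = n := by
  rw [Module.finrank_baseChange]
  exact finrank_euclideanSpace_fin

variable [IsManifold (𝓡 n) ∞ M] (g : PseudoRiemannianMetric n M) (φ : TwoForm n M) (x : M)

theorem PseudoRiemannianMetric.cval_eq (A B : ℂ ⊗[ℝ] TangentSpace (𝓡 n) x) :
    g.cval x A B = ⟨g.val x (cre A) (cre B) - g.val x (cim A) (cim B),
      g.val x (cre A) (cim B) + g.val x (cim A) (cre B)⟩ :=
  baseChange_eq _ A B

theorem TwoForm.cval_eq (A B : ℂ ⊗[ℝ] TangentSpace (𝓡 n) x) :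
    φ.cval x A B = ⟨φ.val x (cre A) (cre B) - φ.val x (cim A) (cim B),
      φ.val x (cre A) (cim B) + φ.val x (cim A) (cre B)⟩ :=
  baseChange_eq _ A B

theorem PseudoRiemannianMetric.cval_isSymm : (g.cval x).IsSymm where
  eq A B := by
    rw [g.cval_eq, g.cval_eq, g.symm x (cre A), g.symm x (cim A),
      g.symm x (cre A), g.symm x (cim A), add_comm]

theorem PseudoRiemannianMetric.cval_symm (A B : ℂ ⊗[ℝ] TangentSpace (𝓡 n) x) :
    g.cval x A B = g.cval x B A :=
  (g.cval_isSymm x).eq A B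

theorem TwoForm.cval_skew (A B : ℂ ⊗[ℝ] TangentSpace (𝓡 n) x) :
    φ.cval x A B = -φ.cval x B A := by
  rw [φ.cval_eq, φ.cval_eq, φ.skew x (cre A), φ.skew x (cim A), φ.skew x (cre A) (cim B),
    φ.skew x (cim A) (cre B)]
  apply Complex.ext
  · simp only [Complex.neg_re]
    ring
  · simp only [Complex.neg_im]
    ring

theorem PseudoRiemannianMetric.cval_nondegenerate : (g.cval x).Nondegenerate := by
  have hrefl : (g.cval x).IsRefl := (g.cval_isSymm x).isRefl
  refine (LinearMap.IsRefl.nondegenerate_iff_separatingLeft hrefl).2 fun A hA => ?_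
  have hreal (t : TangentSpace (𝓡 n) x) : g.val x (cre A) t = 0 ∧ g.val x (cim A) t = 0 := by
    have ht := hA (1 ⊗ₜ t)
    rw [g.cval_eq, Complex.ext_iff] at ht
    simpa using ht
  apply ctensor_ext
  · simpa using g.nondegenerate x _ fun t => (hreal t).1
  · simpa using g.nondegenerate x _ fun t => (hreal t).2

theorem PseudoRiemannianMetric.cval_cconj (A B : ℂ ⊗[ℝ] TangentSpace (𝓡 n) x) :
    g.cval x (cconj A) (cconj B) = (starRingEnd ℂ) (g.cval x A B) :=
  baseChange_cconj _ A B

theorem TwoForm.cval_cconj (A B : ℂ ⊗[ℝ] TangentSpace (𝓡 n) x) :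
    φ.cval x (cconj A) (cconj B) = (starRingEnd ℂ) (φ.cval x A B) :=
  baseChange_cconj _ A B

theorem PseudoRiemannianMetric.cval_tmul (a b : TangentSpace (𝓡 n) x) :
    g.cval x (1 ⊗ₜ a) (1 ⊗ₜ b) = g.val x a b := by
  rw [g.cval_eq]
  simp [Complex.ext_iff]

end ComplexifiedForms

section SmoothFields

variable {n : ℕ} {M : Type*} [TopologicalSpace M] [ChartedSpace (EuclideanSpace ℝ (Fin n)) M]
  {U : Set M}

/-- The complex function `f` is smooth on `U`. -/
abbrev SmoothCOn (n : ℕ) {M : Type*} [TopologicalSpace M]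
    [ChartedSpace (EuclideanSpace ℝ (Fin n)) M] (f : M → ℂ) (U : Set M) : Prop :=
  ContMDiffOn (𝓡 n) 𝓘(ℝ, ℂ) ∞ f U

theorem SmoothCOn.re {f : M → ℂ} (hf : SmoothCOn n f U) :
    ContMDiffOn (𝓡 n) 𝓘(ℝ, ℝ) ∞ (fun x => (f x).re) U :=
  (Complex.reCLM.contMDiff (n := ∞)).comp_contMDiffOn hf

theorem SmoothCOn.im {f : M → ℂ} (hf : SmoothCOn n f U) :
    ContMDiffOn (𝓡 n) 𝓘(ℝ, ℝ) ∞ (fun x => (f x).im) U :=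
  (Complex.imCLM.contMDiff (n := ∞)).comp_contMDiffOn hf

theorem smoothCOn_mk {a b : M → ℝ} (ha : ContMDiffOn (𝓡 n) 𝓘(ℝ, ℝ) ∞ a U)
    (hb : ContMDiffOn (𝓡 n) 𝓘(ℝ, ℝ) ∞ b U) : SmoothCOn n (fun x => (⟨a x, b x⟩ : ℂ)) U := by
  refine ((Complex.equivRealProdCLM.symm.toContinuousLinearMap.contMDiff
    (n := ∞)).comp_contMDiffOn (ha.prodMk_space hb)).congr fun x _ => ?_
  apply Complex.ext <;> simp

theorem SmoothCOn.inv {f : M → ℂ} (hf : SmoothCOn n f U) (h : ∀ x ∈ U, f x ≠ 0) :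
    SmoothCOn n (fun x => (f x)⁻¹) U := by
  have hinv : ContDiffOn ℝ ∞ (fun z : ℂ => z⁻¹) {0}ᶜ := fun z hz =>
    (contDiffAt_inv ℝ hz).contDiffWithinAt
  exact hinv.contMDiffOn.comp hf h

variable [IsManifold (𝓡 n) ∞ M]

theorem contMDiffOn_bilin_apply
    {B : Π x : M, TangentSpace (𝓡 n) x →L[ℝ] TangentSpace (𝓡 n) x →L[ℝ] ℝ}
    (hB : ContMDiffOn (𝓡 n)
      ((𝓡 n).prod 𝓘(ℝ, EuclideanSpace ℝ (Fin n) →L[ℝ] EuclideanSpace ℝ (Fin n) →L[ℝ] ℝ)) ∞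
      (fun x => TotalSpace.mk'
        (EuclideanSpace ℝ (Fin n) →L[ℝ] EuclideanSpace ℝ (Fin n) →L[ℝ] ℝ) x (B x)) U)
    {X Y : Π x : M, TangentSpace (𝓡 n) x} (hX : SmoothFieldOn X U) (hY : SmoothFieldOn Y U) :
    ContMDiffOn (𝓡 n) 𝓘(ℝ, ℝ) ∞ (fun y => B y (X y) (Y y)) U := by
  have hsection : ContMDiffOn (𝓡 n) ((𝓡 n).prod 𝓘(ℝ, ℝ)) ∞
      (fun y ↦ TotalSpace.mk' ℝ (E := Bundle.Trivial M ℝ) y (B y (X y) (Y y))) U :=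
    ContMDiffOn.clm_bundle_apply₂ (F₁ := EuclideanSpace ℝ (Fin n))
      (F₂ := EuclideanSpace ℝ (Fin n)) hB hX hY
  exact fun x hx => (contMDiffWithinAt_totalSpace.1 (hsection x hx)).2

variable {X Y : Π x : M, TangentSpace (𝓡 n) x}

theorem SmoothFieldOn.mono {V : Set M} (hX : SmoothFieldOn X U) (h : V ⊆ U) :
    SmoothFieldOn X V :=
  ContMDiffOn.mono hX h

theorem SmoothFieldOn.diffFieldAt (hX : SmoothFieldOn X U) (hU : IsOpen U) {x : M} (hx : x ∈ U) :
    DiffFieldAt X x :=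
  (ContMDiffOn.contMDiffAt hX (hU.mem_nhds hx)).mdifferentiableAt (by simp)

theorem SmoothFieldOn.add (hX : SmoothFieldOn X U) (hY : SmoothFieldOn Y U) :
    SmoothFieldOn (fun x => X x + Y x) U :=
  ContMDiffOn.add_section hX hY

theorem SmoothFieldOn.sub (hX : SmoothFieldOn X U) (hY : SmoothFieldOn Y U) :
    SmoothFieldOn (fun x => X x - Y x) U :=
  ContMDiffOn.sub_section hX hY

theorem SmoothFieldOn.neg (hX : SmoothFieldOn X U) : SmoothFieldOn (fun x => -X x) U :=
  ContMDiffOn.neg_section hX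

theorem SmoothFieldOn.smul {f : M → ℝ} (hf : ContMDiffOn (𝓡 n) 𝓘(ℝ, ℝ) ∞ f U)
    (hX : SmoothFieldOn X U) : SmoothFieldOn (fun x => f x • X x) U :=
  ContMDiffOn.smul_section hf hX

theorem SmoothFieldOn.sum {ι : Type*} {s : Finset ι} {X : ι → Π x : M, TangentSpace (𝓡 n) x}
    (hX : ∀ i ∈ s, SmoothFieldOn (X i) U) : SmoothFieldOn (fun x => ∑ i ∈ s, X i x) U :=
  ContMDiffOn.sum_section hX

theorem smoothFieldOn_zero : SmoothFieldOn (fun _ => 0 : Π x : M, TangentSpace (𝓡 n) x) U :=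
  (contMDiff_zeroSection ℝ (TangentSpace (𝓡 n) : M → Type _)).contMDiffOn

variable {Z W : Π x : M, ℂ ⊗[ℝ] TangentSpace (𝓡 n) x}

theorem PseudoRiemannianMetric.smoothOn_val (g : PseudoRiemannianMetric n M)
    (hX : SmoothFieldOn X U) (hY : SmoothFieldOn Y U) :
    ContMDiffOn (𝓡 n) 𝓘(ℝ, ℝ) ∞ (fun y => g.val y (X y) (Y y)) U :=
  contMDiffOn_bilin_apply g.contMDiff.contMDiffOn hX hY

theorem TwoForm.smoothOn_val (φ : TwoForm n M) (hX : SmoothFieldOn X U) (hY : SmoothFieldOn Y U) :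
    ContMDiffOn (𝓡 n) 𝓘(ℝ, ℝ) ∞ (fun y => φ.val y (X y) (Y y)) U :=
  contMDiffOn_bilin_apply φ.contMDiff.contMDiffOn hX hY

theorem PseudoRiemannianMetric.smoothCOn_cval (g : PseudoRiemannianMetric n M)
    (hZ : SmoothCFieldOn Z U) (hW : SmoothCFieldOn W U) :
    SmoothCOn n (fun x => g.cval x (Z x) (W x)) U := by
  simp only [g.cval_eq]
  exact smoothCOn_mk ((g.smoothOn_val hZ.1 hW.1).sub (g.smoothOn_val hZ.2 hW.2))
    ((g.smoothOn_val hZ.1 hW.2).add (g.smoothOn_val hZ.2 hW.1))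

theorem TwoForm.smoothCOn_cval (φ : TwoForm n M) (hZ : SmoothCFieldOn Z U)
    (hW : SmoothCFieldOn W U) : SmoothCOn n (fun x => φ.cval x (Z x) (W x)) U := by
  simp only [φ.cval_eq]
  exact smoothCOn_mk ((φ.smoothOn_val hZ.1 hW.1).sub (φ.smoothOn_val hZ.2 hW.2))
    ((φ.smoothOn_val hZ.1 hW.2).add (φ.smoothOn_val hZ.2 hW.1))

theorem SmoothCFieldOn.mono {V : Set M} (hZ : SmoothCFieldOn Z U) (h : V ⊆ U) :
    SmoothCFieldOn Z V :=
  ⟨hZ.1.mono h, hZ.2.mono h⟩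

theorem SmoothCFieldOn.smul {f : M → ℂ} (hf : SmoothCOn n f U) (hZ : SmoothCFieldOn Z U) :
    SmoothCFieldOn (fun x => f x • Z x) U := by
  constructor
  · simp only [cre_smul]
    exact (hZ.1.smul hf.re).sub (hZ.2.smul hf.im)
  · simp only [cim_smul]
    exact (hZ.2.smul hf.re).add (hZ.1.smul hf.im)

theorem SmoothCFieldOn.const_smul (c : ℂ) (hZ : SmoothCFieldOn Z U) :
    SmoothCFieldOn (fun x => c • Z x) U :=
  hZ.smul contMDiffOn_const

theorem SmoothCFieldOn.sum {ι : Type*} {s : Finset ι}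
    {Z : ι → Π x : M, ℂ ⊗[ℝ] TangentSpace (𝓡 n) x}
    (hZ : ∀ i ∈ s, SmoothCFieldOn (Z i) U) : SmoothCFieldOn (fun x => ∑ i ∈ s, Z i x) U := by
  constructor
  · simp only [map_sum]
    exact SmoothFieldOn.sum fun i hi => (hZ i hi).1
  · simp only [map_sum]
    exact SmoothFieldOn.sum fun i hi => (hZ i hi).2

theorem smoothCFieldOn_cmk (hX : SmoothFieldOn X U) (hY : SmoothFieldOn Y U) :
    SmoothCFieldOn (fun x => cmk (X x) (Y x)) U := by
  constructor
  · simpa only [cre_cmk] using hX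
  · simpa only [cim_cmk] using hY

theorem SmoothCFieldOn.cconj (hZ : SmoothCFieldOn Z U) :
    SmoothCFieldOn (fun x => cconj (Z x)) U :=
  smoothCFieldOn_cmk hZ.1 hZ.2.neg

theorem SmoothFieldOn.one_tmul (hX : SmoothFieldOn X U) :
    SmoothCFieldOn (fun x => (1 : ℂ) ⊗ₜ[ℝ] X x) U := by
  simpa only [cmk, TensorProduct.tmul_zero, add_zero] using
    smoothCFieldOn_cmk hX smoothFieldOn_zero

theorem exists_smooth_local_basis (p : M) :
    ∃ (U : Set M) (b : Π x : M, Basis (Fin n) ℝ (TangentSpace (𝓡 n) x)), IsOpen U ∧ p ∈ U ∧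
      ∀ i, SmoothFieldOn (fun x => b x i) U := by
  classical
  let t := trivializationAt (EuclideanSpace ℝ (Fin n)) (TangentSpace (𝓡 n) : M → Type _) p
  let b₀ := (EuclideanSpace.basisFun (Fin n) ℝ).toBasis
  have h := t.isLocalFrameOn_localFrame_baseSet (𝓡 n) ∞ b₀
  refine ⟨t.baseSet, fun x => if hx : x ∈ t.baseSet then
      Basis.mk (h.linearIndependent hx) (h.generating hx) else b₀,
    t.open_baseSet, mem_baseSet_trivializationAt _ _ p, fun i => ?_⟩
  refine (h.contMDiffOn i).congr fun x hx => ?_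
  simp [hx]

theorem exists_smooth_local_complex_basis (p : M) :
    ∃ (U : Set M) (b : Π x : M, Basis (Fin n) ℂ (ℂ ⊗[ℝ] TangentSpace (𝓡 n) x)), IsOpen U ∧
      p ∈ U ∧ ∀ i, SmoothCFieldOn (fun x => b x i) U := by
  obtain ⟨U, b, hU, hpU, hb⟩ := exists_smooth_local_basis (n := n) p
  refine ⟨U, fun x => Algebra.TensorProduct.basis ℂ (b x), hU, hpU, fun i => ?_⟩
  simpa only [Algebra.TensorProduct.basis_apply] using (hb i).one_tmul

end SmoothFields

section Eigenbasis

variable {m : ℕ} {M : Type*} [TopologicalSpace M]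
  [ChartedSpace (EuclideanSpace ℝ (Fin (2 * m))) M] [IsManifold (𝓡 (2 * m)) ∞ M]
  {g : PseudoRiemannianMetric (2 * m) M} {φ : TwoForm (2 * m) M} {x : M}
  {v w : Fin m → ℂ ⊗[ℝ] TangentSpace (𝓡 (2 * m)) x} {lam : Fin m → ℂ}

theorem IsNullEigenbasis.isPencilBasis (h : IsNullEigenbasis g φ x v w lam) :
    IsPencilBasis (g.cval x) (φ.cval x) v w lam where
  toIsHyperbolicBasis :=
    IsHyperbolicBasis.of_finrank_eq (by rw [finrank_complexified_tangentSpace, Fintype.card_fin])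
      h.g_vv h.g_ww h.g_vw fun μ ν => by rw [g.cval_symm, h.g_vw, if_congr eq_comm rfl rfl]
  Ω_vv := h.φ_vv
  Ω_ww := h.φ_ww
  Ω_vw := h.φ_vw
  Ω_wv μ ν := by
    rw [φ.cval_skew, h.φ_vw]
    by_cases hμν : μ = ν
    · subst hμν
      simp
    · simp [hμν, Ne.symm hμν]

theorem IsPencilBasis.isNullEigenbasis (h : IsPencilBasis (g.cval x) (φ.cval x) v w lam) :
    IsNullEigenbasis g φ x v w lam :=
  ⟨h.vv, h.ww, h.vw, h.Ω_vv, h.Ω_ww, h.Ω_vw⟩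

theorem hasSimpleSpectrum_iff :
    HasSimpleSpectrum (g.cval x) (φ.cval x) ↔ (eigenvalues g φ x).ncard = 2 * m := by
  rw [HasSimpleSpectrum, finrank_complexified_tangentSpace]
  rfl

end Eigenbasis

section SmoothEigenpair

variable {E : Type*} [NormedAddCommGroup E] [NormedSpace ℂ E]

/-- The equation `Φ u = z G u` for an eigenvector `u` with eigenvalue `z` of a pencil `(Φ, G)`,
together with the normalisation of `u` by a linear functional `a`. -/
def pencilMap (a : E →L[ℂ] ℂ) (q : ((E →L[ℂ] E) × (E →L[ℂ] E)) × (E × ℂ)) : E × ℂ :=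
  (q.1.1 q.2.1 - q.2.2 • q.1.2 q.2.1, a q.2.1)

theorem contDiff_pencilMap (a : E →L[ℂ] ℂ) : ContDiff ℂ ω (pencilMap a) := by
  unfold pencilMap
  fun_prop

theorem fderiv_pencilMap (a : E →L[ℂ] ℂ) (Φ G : E →L[ℂ] E) (u δ : E) (z κ : ℂ) :
    fderiv ℂ (pencilMap a) ((Φ, G), (u, z)) (0, (δ, κ)) =
      (Φ δ - (κ • G u + z • G δ), a δ) := by
  have hd : DifferentiableAt ℂ (pencilMap a) ((Φ, G), (u, z)) :=
    (contDiff_pencilMap a).differentiable (by simp) _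
  have hline : pencilMap a ∘ (fun y => ((Φ, G), y)) =
      fun y : E × ℂ => (Φ y.1 - y.2 • G y.1, a y.1) := rfl
  have hchain := (hd.hasFDerivAt.comp (u, z) (hasFDerivAt_prodMk_right (Φ, G) (u, z)))
  rw [hline] at hchain
  have hfst : HasFDerivAt (fun y : E × ℂ => y.1) (ContinuousLinearMap.fst ℂ E ℂ) (u, z) :=
    hasFDerivAt_fst
  have hdirect : HasFDerivAt (fun y : E × ℂ => (Φ y.1 - y.2 • G y.1, a y.1)) _ (u, z) :=
    ((Φ.hasFDerivAt.comp (u, z) hfst).sub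
      (hasFDerivAt_snd.smul (G.hasFDerivAt.comp (u, z) hfst))).prodMk
      (a.hasFDerivAt.comp (u, z) hfst)
  have := congrArg (fun L => L (δ, κ)) (hchain.unique hdirect)
  simpa [add_comm] using this

variable [FiniteDimensional ℂ E]

theorem exists_smooth_eigenpair {Φ₀ G₀ : E →L[ℂ] E} {u₀ : E} {z₀ : ℂ} (a : E →L[ℂ] ℂ)
    (h₀ : Φ₀ u₀ = z₀ • G₀ u₀)
    (hinj : ∀ (δ : E) (κ : ℂ), Φ₀ δ = κ • G₀ u₀ + z₀ • G₀ δ → a δ = 0 → δ = 0 ∧ κ = 0) :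
    ∃ (O : Set ((E →L[ℂ] E) × (E →L[ℂ] E))) (ψ : (E →L[ℂ] E) × (E →L[ℂ] E) → E × ℂ),
      IsOpen O ∧ (Φ₀, G₀) ∈ O ∧ ContDiffOn ℝ ∞ ψ O ∧ ψ (Φ₀, G₀) = (u₀, z₀) ∧
        ∀ q ∈ O, q.1 (ψ q).1 = (ψ q).2 • q.2 (ψ q).1 := by
  have hcd : ContDiffAt ℂ ω (pencilMap a) ((Φ₀, G₀), (u₀, z₀)) :=
    (contDiff_pencilMap a).contDiffAt
  let T := fderiv ℂ (pencilMap a) ((Φ₀, G₀), (u₀, z₀)) ∘L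
    .inr ℂ ((E →L[ℂ] E) × (E →L[ℂ] E)) (E × ℂ)
  have hT : Function.Injective T.toLinearMap := by
    rw [← LinearMap.ker_eq_bot, LinearMap.ker_eq_bot']
    rintro ⟨δ, κ⟩ hδκ
    have hfd : fderiv ℂ (pencilMap a) ((Φ₀, G₀), (u₀, z₀)) (0, (δ, κ)) = 0 := hδκ
    rw [fderiv_pencilMap, Prod.mk_eq_zero, sub_eq_zero] at hfd
    exact Prod.mk_eq_zero.2 (hinj δ κ hfd.1 hfd.2)
  have hTinv : T.IsInvertible :=
    ⟨(LinearEquiv.ofInjectiveEndo T.toLinearMap hT).toContinuousLinearEquiv, by ext <;> rfl⟩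
  let ψ := hcd.implicitFunction (by simp) hTinv
  have hψ : ∀ᶠ q in 𝓝 (Φ₀, G₀), ContDiffAt ℂ ω ψ q :=
    (hcd.contDiffAt_implicitFunction (by simp) hTinv).eventually (by simp)
  have hval : ∀ᶠ q in 𝓝 (Φ₀, G₀), pencilMap a (q, ψ q) = pencilMap a ((Φ₀, G₀), (u₀, z₀)) :=
    hcd.eventually_apply_implicitFunction (by simp) hTinv
  obtain ⟨O, hO, hOo, hOm⟩ := eventually_nhds_iff.1 (hψ.and hval)
  refine ⟨O, ψ, hOo, hOm, fun q hq =>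
    (((hO q hq).1.restrict_scalars ℝ).of_le (by simp)).contDiffWithinAt,
    hcd.implicitFunction_apply_self (by simp) hTinv, fun q hq => ?_⟩
  have hfst := congrArg Prod.fst (hO q hq).2
  simp only [pencilMap, h₀, sub_self] at hfst
  exact sub_eq_zero.1 hfst

end SmoothEigenpair

section CoordinateMap

variable {K W κ : Type*} [Field K] [AddCommGroup W] [Module K W] [Fintype κ]

/-- The endomorphism of `κ → K` given by the matrix `B (b i) (b j)` of a bilinear form `B` in the
basis `b`. -/
def coordMap (b : Basis κ K W) (B : LinearMap.BilinForm K W) : (κ → K) →ₗ[K] κ → K :=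
  LinearMap.pi fun i => B (b i) ∘ₗ b.equivFun.symm.toLinearMap

theorem coordMap_apply (b : Basis κ K W) (B : LinearMap.BilinForm K W) (c : κ → K) (i : κ) :
    coordMap b B c i = B (b i) (b.equivFun.symm c) :=
  rfl

theorem coordMap_eq_smul_add_smul_iff (b : Basis κ K W) {B Ω : LinearMap.BilinForm K W}
    {c c' : κ → K} {z z' : K} :
    coordMap b Ω c = z' • coordMap b B c' + z • coordMap b B c ↔
      ∀ A, Ω A (b.equivFun.symm c) =
        z' * B A (b.equivFun.symm c') + z * B A (b.equivFun.symm c) := by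
  constructor
  · intro h
    have hflip : Ω.flip (b.equivFun.symm c) =
        z' • B.flip (b.equivFun.symm c') + z • B.flip (b.equivFun.symm c) :=
      b.ext fun i => by simpa [coordMap_apply] using congrFun h i
    exact fun A => by simpa using LinearMap.congr_fun hflip A
  · exact fun h => funext fun i => h (b i)

theorem coordMap_eq_smul_iff (b : Basis κ K W) {B Ω : LinearMap.BilinForm K W} {c : κ → K}
    {z : K} :
    coordMap b Ω c = z • coordMap b B c ↔
      ∀ A, Ω A (b.equivFun.symm c) = z * B A (b.equivFun.symm c) := by
  simpa only [zero_smul, zero_mul, zero_add] using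
    coordMap_eq_smul_add_smul_iff b (B := B) (Ω := Ω) (c := c) (c' := 0) (z := z) (z' := 0)

theorem exists_normalizing_coordinate (b : Basis κ K W) {B Ω : LinearMap.BilinForm K W} {u₀ : W}
    {z₀ : K} (hu₀ : u₀ ≠ 0) (hsimple : ∀ (u : W) (z : K),
      (∀ A, Ω A u = z * B A u₀ + z₀ * B A u) →
      z = 0 ∧ ∃ c : K, u = c • u₀) :
    ∃ k, ∀ (δ : κ → K) (z : K), coordMap b Ω δ =
      z • coordMap b B (b.equivFun u₀) + z₀ • coordMap b B δ → δ k = 0 → δ = 0 ∧ z = 0 := by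
  obtain ⟨k, hk⟩ : ∃ k, b.equivFun u₀ k ≠ 0 :=
    Function.ne_iff.1 (b.equivFun.map_ne_zero_iff.2 hu₀)
  refine ⟨k, fun δ z hδ hδk => ?_⟩
  rw [coordMap_eq_smul_add_smul_iff, LinearEquiv.symm_apply_apply] at hδ
  obtain ⟨hz, c, hc⟩ := hsimple _ z hδ
  obtain rfl : δ = c • b.equivFun u₀ := by rw [← map_smul, ← hc, LinearEquiv.apply_symm_apply]
  have hc0 : c = 0 := (mul_eq_zero.1 hδk).resolve_right hk
  exact ⟨by rw [hc0, zero_smul], hz⟩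

end CoordinateMap

section LocalEigenpair

variable {n : ℕ} {M : Type*} [TopologicalSpace M] [ChartedSpace (EuclideanSpace ℝ (Fin n)) M]
  {U : Set M}

theorem contMDiffOn_clm_of_apply_single {F : M → (Fin n → ℂ) →L[ℂ] (Fin n → ℂ)}
    (hF : ∀ i j, SmoothCOn n (fun x => F x (Pi.single j 1) i) U) :
    ContMDiffOn (𝓡 n) 𝓘(ℝ, (Fin n → ℂ) →L[ℂ] (Fin n → ℂ)) ∞ F U := by
  let L : (Fin n → Fin n → ℂ) →ₗ[ℝ] (Fin n → ℂ) →L[ℂ] (Fin n → ℂ) :=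
    ((LinearMap.toContinuousLinearMap.toLinearMap ∘ₗ
      (Matrix.toLin' (R := ℂ) (m := Fin n) (n := Fin n)).toLinearMap).restrictScalars ℝ)
  have hL : ContDiff ℝ ∞ L := L.toContinuousLinearMap.contDiff
  refine (hL.contMDiff.comp_contMDiffOn
    (contMDiffOn_pi_space.2 fun i => contMDiffOn_pi_space.2 (hF i))).congr fun x _ => ?_
  refine ContinuousLinearMap.coe_injective ((Matrix.toLin'_toMatrix' _).symm.trans ?_)
  rfl

variable [IsManifold (𝓡 n) ∞ M]

/-- The smooth complex vector field `Z` consists on `U` of eigenvectors of the endomorphism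
obtained from `φ` by raising an index, with eigenvalue the smooth function `Λ`. -/
structure IsSmoothEigenpairOn (g : PseudoRiemannianMetric n M) (φ : TwoForm n M)
    (Z : Π x : M, ℂ ⊗[ℝ] TangentSpace (𝓡 n) x) (Λ : M → ℂ) (U : Set M) : Prop where
  smooth_field : SmoothCFieldOn Z U
  smooth_value : SmoothCOn n Λ U
  apply_eq : ∀ x ∈ U, ∀ A, φ.cval x A (Z x) = Λ x * g.cval x A (Z x)

variable {g : PseudoRiemannianMetric n M} {φ : TwoForm n M}

theorem IsSmoothEigenpairOn.mono {Z : Π x : M, ℂ ⊗[ℝ] TangentSpace (𝓡 n) x} {Λ : M → ℂ}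
    {V : Set M} (h : IsSmoothEigenpairOn g φ Z Λ U) (hVU : V ⊆ U) :
    IsSmoothEigenpairOn g φ Z Λ V :=
  ⟨h.smooth_field.mono hVU, ContMDiffOn.mono h.smooth_value hVU, fun x hx => h.apply_eq x (hVU hx)⟩

theorem exists_isSmoothEigenpairOn {p : M} {u₀ : ℂ ⊗[ℝ] TangentSpace (𝓡 n) p} {z₀ : ℂ}
    (hu₀ : u₀ ≠ 0) (h₀ : ∀ A, φ.cval p A u₀ = z₀ * g.cval p A u₀)
    (hsimple : ∀ (u : ℂ ⊗[ℝ] TangentSpace (𝓡 n) p) (z : ℂ),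
      (∀ A, φ.cval p A u = z * g.cval p A u₀ + z₀ * g.cval p A u) → z = 0 ∧ ∃ c : ℂ, u = c • u₀) :
    ∃ (U : Set M) (Z : Π x : M, ℂ ⊗[ℝ] TangentSpace (𝓡 n) x) (Λ : M → ℂ),
      IsOpen U ∧ p ∈ U ∧ IsSmoothEigenpairOn g φ Z Λ U ∧ Z p = u₀ ∧ Λ p = z₀ := by
  obtain ⟨U, b, hU, hpU, hb⟩ := exists_smooth_local_complex_basis (n := n) p
  let q (x : M) : ((Fin n → ℂ) →L[ℂ] (Fin n → ℂ)) × ((Fin n → ℂ) →L[ℂ] (Fin n → ℂ)) :=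
    ((coordMap (b x) (φ.cval x)).toContinuousLinearMap,
      (coordMap (b x) (g.cval x)).toContinuousLinearMap)
  have hq : ContMDiffOn (𝓡 n) 𝓘(ℝ, ((Fin n → ℂ) →L[ℂ] (Fin n → ℂ)) ×
      ((Fin n → ℂ) →L[ℂ] (Fin n → ℂ))) ∞ q U := by
    refine ContMDiffOn.prodMk_space (contMDiffOn_clm_of_apply_single fun i j => ?_)
      (contMDiffOn_clm_of_apply_single fun i j => ?_)
    · simpa [coordMap_apply] using φ.smoothCOn_cval (hb i) (hb j)
    · simpa [coordMap_apply] using g.smoothCOn_cval (hb i) (hb j)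
  obtain ⟨k, hk⟩ := exists_normalizing_coordinate (b p) hu₀ hsimple
  obtain ⟨O, ψ, hO, hmO, hψ, hψ₀, heq⟩ := exists_smooth_eigenpair (Φ₀ := (q p).1) (G₀ := (q p).2)
    (u₀ := (b p).equivFun u₀) (z₀ := z₀) (.proj k)
    ((coordMap_eq_smul_iff (b p)).2 (by simpa only [LinearEquiv.symm_apply_apply] using h₀)) hk
  have hψq : ContMDiffOn (𝓡 n) 𝓘(ℝ, (Fin n → ℂ) × ℂ) ∞ (ψ ∘ q) (U ∩ q ⁻¹' O) :=
    hψ.contMDiffOn.comp (hq.mono inter_subset_left) inter_subset_right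
  have hcoord : ContMDiffOn (𝓡 n) 𝓘(ℝ, Fin n → ℂ) ∞ (fun x => (ψ (q x)).1) (U ∩ q ⁻¹' O) :=
    contDiff_fst.contMDiff.comp_contMDiffOn hψq
  refine ⟨U ∩ q ⁻¹' O, fun x => (b x).equivFun.symm (ψ (q x)).1, fun x => (ψ (q x)).2,
    hq.continuousOn.isOpen_inter_preimage hU hO, ⟨hpU, hmO⟩,
    ⟨?_, contDiff_snd.contMDiff.comp_contMDiffOn hψq, fun x hx A => ?_⟩, ?_, ?_⟩
  · simp only [Basis.equivFun_symm_apply]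
    exact SmoothCFieldOn.sum fun j _ =>
      .smul (contMDiffOn_pi_space.1 hcoord j) ((hb j).mono inter_subset_left)
  · exact (coordMap_eq_smul_iff (b x)).1 (heq _ hx.2) A
  · exact (congrArg (fun y => (b p).equivFun.symm y.1) hψ₀).trans (LinearEquiv.symm_apply_apply _ _)
  · exact congrArg Prod.snd hψ₀

end LocalEigenpair

section LocalEigenbasis

variable {m : ℕ} {M : Type*} [TopologicalSpace M]
  [ChartedSpace (EuclideanSpace ℝ (Fin (2 * m))) M] [IsManifold (𝓡 (2 * m)) ∞ M]
  {g : PseudoRiemannianMetric (2 * m) M} {φ : TwoForm (2 * m) M} {p : M}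
  {v₀ w₀ : Fin m → ℂ ⊗[ℝ] TangentSpace (𝓡 (2 * m)) p} {lam₀ : Fin m → ℂ}

theorem IsPencilBasis.exists_isSmoothEigenpairOn
    (h : IsPencilBasis (g.cval p) (φ.cval p) v₀ w₀ lam₀)
    (hs : HasSimpleSpectrum (g.cval p) (φ.cval p)) (μ : Fin m) :
    ∃ (U : Set M) (Z : Π x : M, ℂ ⊗[ℝ] TangentSpace (𝓡 (2 * m)) x) (Λ : M → ℂ),
      IsOpen U ∧ p ∈ U ∧ IsSmoothEigenpairOn g φ Z Λ U ∧ Z p = w₀ μ ∧ Λ p = lam₀ μ := by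
  refine CKY.exists_isSmoothEigenpairOn (h.linearIndependent.ne_zero (Sum.inr μ))
    (fun A => h.Ω_apply_w A μ) fun u z hu => ?_
  have hz : z = 0 := by
    have hvμ := hu (v₀ μ)
    rw [φ.cval_skew, h.Ω_apply_v, h.vw, if_pos rfl, g.cval_symm p u] at hvμ
    linear_combination -hvμ
  subst hz
  exact ⟨rfl, _, h.eq_smul_w hs fun A => by rw [hu, zero_mul, zero_add]⟩

/-- Smooth complex vector fields `v μ`, `w μ` and functions `lam μ` on `U` that form a pencil basis
for the metric and the `2`-form at each point of `U`. -/
structure IsSmoothPencilBasisOn (g : PseudoRiemannianMetric (2 * m) M) (φ : TwoForm (2 * m) M)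
    (v w : Fin m → Π x : M, ℂ ⊗[ℝ] TangentSpace (𝓡 (2 * m)) x) (lam : Fin m → M → ℂ)
    (U : Set M) : Prop where
  smooth_v : ∀ μ, SmoothCFieldOn (v μ) U
  smooth_w : ∀ μ, SmoothCFieldOn (w μ) U
  smooth_lam : ∀ μ, SmoothCOn (2 * m) (lam μ) U
  isPencilBasis : ∀ x ∈ U, IsPencilBasis (g.cval x) (φ.cval x) (v · x) (w · x) (lam · x)

variable {U : Set M} {v w : Fin m → Π x : M, ℂ ⊗[ℝ] TangentSpace (𝓡 (2 * m)) x}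
  {lam lam' : Fin m → M → ℂ}

theorem isSmoothPencilBasisOn_of_eigenpairs (hv : ∀ μ, IsSmoothEigenpairOn g φ (v μ) (lam' μ) U)
    (hw : ∀ μ, IsSmoothEigenpairOn g φ (w μ) (lam μ) U)
    (hr : ∀ x ∈ U, ∀ μ, g.cval x (v μ x) (w μ x) ≠ 0)
    (hinj : ∀ x ∈ U, ∀ μ ν, μ ≠ ν → lam μ x ≠ lam ν x)
    (hne : ∀ x ∈ U, ∀ μ ν, lam μ x + lam ν x ≠ 0) :
    IsSmoothPencilBasisOn g φ (fun μ x => (g.cval x (v μ x) (w μ x))⁻¹ • v μ x) w lam U where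
  smooth_v μ := .smul (SmoothCOn.inv (g.smoothCOn_cval (hv μ).smooth_field (hw μ).smooth_field)
    fun x hx => hr x hx μ) (hv μ).smooth_field
  smooth_w μ := (hw μ).smooth_field
  smooth_lam μ := (hw μ).smooth_value
  isPencilBasis x hx := by
    have hneg (μ : Fin m) : lam' μ x = -lam μ x := by
      by_contra hcon
      exact hr x hx μ (apply_eq_zero_of_add_ne_zero (g.cval_isSymm x) (φ.cval_skew x)
        ((hv μ).apply_eq x hx) ((hw μ).apply_eq x hx) fun h => hcon (eq_neg_of_add_eq_zero_left h))
    refine isPencilBasis_of_eigenvectors (g.cval_isSymm x) (φ.cval_skew x)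
      (by rw [finrank_complexified_tangentSpace, Fintype.card_fin])
      (fun A μ => (hw μ).apply_eq x hx A)
      (fun A μ => by rw [(hv μ).apply_eq x hx, hneg]) (hr x hx)
      (fun μ ν hμν => ?_) (hne x hx)
    by_contra hcon
    exact hinj x hx μ ν hcon hμν

theorem exists_isSmoothPencilBasisOn (h : IsPencilBasis (g.cval p) (φ.cval p) v₀ w₀ lam₀)
    (hs : HasSimpleSpectrum (g.cval p) (φ.cval p)) :
    ∃ (U : Set M) (v w : Fin m → Π x : M, ℂ ⊗[ℝ] TangentSpace (𝓡 (2 * m)) x)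
      (lam : Fin m → M → ℂ), IsOpen U ∧ p ∈ U ∧ IsSmoothPencilBasisOn g φ v w lam U ∧
        (v · p) = v₀ ∧ (w · p) = w₀ ∧ (lam · p) = lam₀ := by
  choose U₁ w lam hU₁ hp₁ hw hw₀ hlam₀ using h.exists_isSmoothEigenpairOn hs
  choose U₂ v lam' hU₂ hp₂ hv hv₀ _ using h.swap.exists_isSmoothEigenpairOn hs
  let U : Set M := (⋂ μ, U₁ μ) ∩ ⋂ μ, U₂ μ
  have hU : IsOpen U := (isOpen_iInter_of_finite hU₁).inter (isOpen_iInter_of_finite hU₂)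
  have hpU : p ∈ U := ⟨mem_iInter.2 hp₁, mem_iInter.2 hp₂⟩
  replace hw (μ : Fin m) := (hw μ).mono (inter_subset_left.trans (iInter_subset _ μ) : U ⊆ _)
  replace hv (μ : Fin m) := (hv μ).mono (inter_subset_right.trans (iInter_subset _ μ) : U ⊆ _)
  have hlam (μ : Fin m) : ContinuousAt (lam μ) p :=
    (hw μ).smooth_value.continuousOn.continuousAt (hU.mem_nhds hpU)
  have hr : ∀ᶠ x in 𝓝 p, ∀ μ, g.cval x (v μ x) (w μ x) ≠ 0 := eventually_all.2 fun μ =>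
    ((g.smoothCOn_cval (hv μ).smooth_field (hw μ).smooth_field).continuousOn.continuousAt
      (hU.mem_nhds hpU)).eventually_ne (by simp [hv₀, hw₀, h.vw])
  have hinj : ∀ᶠ x in 𝓝 p, ∀ μ ν, μ ≠ ν → lam μ x ≠ lam ν x :=
    eventually_all.2 fun μ => eventually_all.2 fun ν => eventually_imp_distrib_left.2 fun hμν =>
      (((hlam μ).sub (hlam ν)).eventually_ne (sub_ne_zero.2 (by
        simpa only [hlam₀] using (h.lam_injective hs).ne hμν))).mono fun x => sub_ne_zero.1
  have hne : ∀ᶠ x in 𝓝 p, ∀ μ ν, lam μ x + lam ν x ≠ 0 :=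
    eventually_all.2 fun μ => eventually_all.2 fun ν => ((hlam μ).add (hlam ν)).eventually_ne (by
      simpa [hlam₀, ← eq_neg_iff_add_eq_zero] using h.lam_ne_neg_lam hs μ ν)
  obtain ⟨O, hO, hOo, hpO⟩ := eventually_nhds_iff.1 (hr.and (hinj.and hne))
  refine ⟨U ∩ O, _, w, lam, hU.inter hOo, ⟨hpU, hpO⟩, isSmoothPencilBasisOn_of_eigenpairs
    (fun μ => (hv μ).mono inter_subset_left) (fun μ => (hw μ).mono inter_subset_left)
    (fun x hx => (hO x hx.2).1) (fun x hx => (hO x hx.2).2.1) (fun x hx => (hO x hx.2).2.2),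
    funext fun μ => ?_, funext hw₀, funext hlam₀⟩
  simp [hv₀, hw₀, h.vw]

end LocalEigenbasis

section Trilinear

variable {K W : Type*} [Field K] [AddCommGroup W] [Module K W]

/-- `T` is trilinear and changes sign under transpositions. Linearity is only required in the last
argument, since the transpositions carry it to the other two. -/
structure IsSkewTrilinear (K : Type*) {W : Type*} [Field K] [AddCommGroup W] [Module K W]
    (T : W → W → W → K) : Prop where
  linear : ∀ u v, IsLinearMap K (T u v)
  swap₁₂ : ∀ u v w, T u v w = -T v u w
  swap₂₃ : ∀ u v w, T u v w = -T u w v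

namespace IsSkewTrilinear

variable {T : W → W → W → K}

theorem rotate (h : IsSkewTrilinear K T) (u v w : W) : T u v w = T v w u := by
  rw [h.swap₁₂, h.swap₂₃, neg_neg]

theorem self₁₂ [CharZero K] (h : IsSkewTrilinear K T) (u w : W) : T u u w = 0 :=
  self_eq_neg.1 (h.swap₁₂ u u w)

theorem self₁₃ [CharZero K] (h : IsSkewTrilinear K T) (u v : W) : T u v u = 0 := by
  rw [← h.rotate, h.self₁₂]

theorem self₂₃ [CharZero K] (h : IsSkewTrilinear K T) (u v : W) : T u v v = 0 := by
  rw [h.rotate, h.self₁₂]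

theorem eq_zero_of_mem_span {ι : Type*} {b : ι → W} (h : IsSkewTrilinear K T)
    (hb : ∀ i j k, T (b i) (b j) (b k) = 0) {u v w : W} (hu : u ∈ Submodule.span K (range b))
    (hv : v ∈ Submodule.span K (range b)) (hw : w ∈ Submodule.span K (range b)) : T u v w = 0 := by
  have last (u v : W) (huv : ∀ k, T u v (b k) = 0) {w : W}
      (hw : w ∈ Submodule.span K (range b)) : T u v w = 0 := by
    have hle : Submodule.span K (range b) ≤ LinearMap.ker ((h.linear u v).mk' (T u v)) :=
      Submodule.span_le.2 (range_subset_iff.2 huv)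
    exact hle hw
  refine last _ _ (fun k => ?_) hw
  rw [← h.rotate]
  refine last _ _ (fun j => ?_) hv
  rw [← h.rotate]
  refine last _ _ (fun i => ?_) hu
  rw [← h.rotate, hb]

end IsSkewTrilinear

theorem IsSkewTrilinear.cext₃ {V : Type*} [AddCommGroup V] [Module ℝ V] {T : V → V → V → ℝ}
    (h : IsSkewTrilinear ℝ T) : IsSkewTrilinear ℂ (CKY.cext₃ T) where
  linear A B := by
    constructor
    · intro C C'
      apply Complex.ext <;>
      · simp only [CKY.cext₃, map_add, (h.linear _ _).map_add, Complex.add_re, Complex.add_im]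
        ring
    · intro z C
      apply Complex.ext <;>
      · simp only [CKY.cext₃, cre_smul, cim_smul, (h.linear _ _).map_add, (h.linear _ _).map_sub,
          (h.linear _ _).map_smul, smul_eq_mul, Complex.mul_re, Complex.mul_im]
        ring
  swap₁₂ A B C := by
    apply Complex.ext
    · simp only [CKY.cext₃, Complex.neg_re]
      linear_combination h.swap₁₂ (cre A) (cre B) (cre C) - h.swap₁₂ (cre A) (cim B) (cim C)
        - h.swap₁₂ (cim A) (cre B) (cim C) - h.swap₁₂ (cim A) (cim B) (cre C)
    · simp only [CKY.cext₃, Complex.neg_im]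
      linear_combination h.swap₁₂ (cim A) (cre B) (cre C) + h.swap₁₂ (cre A) (cim B) (cre C)
        + h.swap₁₂ (cre A) (cre B) (cim C) - h.swap₁₂ (cim A) (cim B) (cim C)
  swap₂₃ A B C := by
    apply Complex.ext
    · simp only [CKY.cext₃, Complex.neg_re]
      linear_combination h.swap₂₃ (cre A) (cre B) (cre C) - h.swap₂₃ (cre A) (cim B) (cim C)
        - h.swap₂₃ (cim A) (cre B) (cim C) - h.swap₂₃ (cim A) (cim B) (cre C)
    · simp only [CKY.cext₃, Complex.neg_im]
      linear_combination h.swap₂₃ (cim A) (cre B) (cre C) + h.swap₂₃ (cre A) (cim B) (cre C)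
        + h.swap₂₃ (cre A) (cre B) (cim C) - h.swap₂₃ (cim A) (cim B) (cim C)

end Trilinear

section LeviCivita

variable {n : ℕ} {M : Type*} [TopologicalSpace M]
  [ChartedSpace (EuclideanSpace ℝ (Fin n)) M]
  {X Y Z : Π x : M, TangentSpace (𝓡 n) x} {x : M}

theorem dirDeriv_congr (X : Π x : M, TangentSpace (𝓡 n) x) {f f' : M → ℝ} (h : f =ᶠ[𝓝 x] f') :
    dirDeriv X f x = dirDeriv X f' x := by
  simp only [dirDeriv, mvfderiv, h.mfderiv_eq]
  congr 1

variable [IsManifold (𝓡 n) ∞ M]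

theorem diffFieldAt_extend (v : TangentSpace (𝓡 n) x) :
    DiffFieldAt (FiberBundle.extend (EuclideanSpace ℝ (Fin n)) v) x :=
  FiberBundle.mdifferentiableAt_extend (𝓡 n) (EuclideanSpace ℝ (Fin n)) v

theorem isSkewTrilinear_extDeriv (φ : TwoForm n M) (x : M) :
    IsSkewTrilinear ℝ (extDeriv φ x) where
  linear u v := by
    have hT := cartan_tensorial φ (diffFieldAt_extend u) (diffFieldAt_extend v)
    have heq : extDeriv φ x u v = TensorialAt.mkHom _ x hT :=
      funext fun w => (TensorialAt.mkHom_apply_eq_extend hT w).symm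
    rw [heq]
    exact (TensorialAt.mkHom _ x hT).toLinearMap.isLinear
  swap₁₂ _ _ _ := cartan_swap₁₂ φ _ _ _ x
  swap₂₃ _ _ _ := cartan_swap₂₃ φ _ _ _ x

variable (g : PseudoRiemannianMetric n M)

theorem dirDeriv_metric (hX : DiffFieldAt X x) (hY : DiffFieldAt Y x) (hZ : DiffFieldAt Z x) :
    dirDeriv X (fun y => g.val y (Y y) (Z y)) x =
      g.val x (leviCivita g X Y x) (Z x) + g.val x (Y x) (leviCivita g X Z x) := by
  have hsymm : (fun y => g.val y (Z y) (Y y)) = fun y => g.val y (Y y) (Z y) :=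
    funext fun y => g.symm y _ _
  have hswap := VectorField.mlieBracket_swap_apply (I := 𝓡 n) (V := Y) (W := Z) (x := x)
  rw [leviCivita_spec g hX hY hZ, g.symm x (Y x), leviCivita_spec g hX hZ hY]
  simp only [koszul, hsymm, hswap, map_neg, neg_apply]
  ring

theorem mlieBracket_eq_leviCivita_sub (hX : DiffFieldAt X x) (hY : DiffFieldAt Y x) :
    VectorField.mlieBracket (𝓡 n) X Y x = leviCivita g X Y x - leviCivita g Y X x := by
  rw [← sub_eq_zero]
  refine g.nondegenerate x _ fun u => ?_
  have hsymm : (fun y => g.val y (Y y) (X y)) = fun y => g.val y (X y) (Y y) :=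
    funext fun y => g.symm y _ _
  have hswap := VectorField.mlieBracket_swap_apply (I := 𝓡 n) (V := Y) (W := X) (x := x)
  have hXY := leviCivita_spec g hX hY (diffFieldAt_extend u)
  have hYX := leviCivita_spec g hY hX (diffFieldAt_extend u)
  simp only [koszul, hsymm, hswap, map_neg, neg_apply, FiberBundle.extend_apply_self] at hXY hYX
  simp only [map_sub, sub_apply]
  linear_combination hYX - hXY

/-- The Levi-Civita connection `∇_Z W`, extended complex-bilinearly to complex vector fields. -/
def cnabla (Z W : Π x : M, ℂ ⊗[ℝ] TangentSpace (𝓡 n) x) (x : M) : ℂ ⊗[ℝ] TangentSpace (𝓡 n) x :=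
  cmk (leviCivita g (fun y => cre (Z y)) (fun y => cre (W y)) x
      - leviCivita g (fun y => cim (Z y)) (fun y => cim (W y)) x)
    (leviCivita g (fun y => cre (Z y)) (fun y => cim (W y)) x
      + leviCivita g (fun y => cim (Z y)) (fun y => cre (W y)) x)

variable {A B C : Π x : M, ℂ ⊗[ℝ] TangentSpace (𝓡 n) x} {U V : Set M}

theorem cbracket_eq_cnabla_sub (hV : IsOpen V) (hA : SmoothCFieldOn A V) (hC : SmoothCFieldOn C V)
    (hx : x ∈ V) : cbracket A C x = cnabla g A C x - cnabla g C A x := by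
  have torsion {X Y : Π x : M, TangentSpace (𝓡 n) x} (hX : SmoothFieldOn X V)
      (hY : SmoothFieldOn Y V) :=
    mlieBracket_eq_leviCivita_sub g (hX.diffFieldAt hV hx) (hY.diffFieldAt hV hx)
  apply ctensor_ext
  · simp only [cbracket, cnabla, cre_cmk, map_sub, torsion hA.1 hC.1, torsion hA.2 hC.2]
    abel
  · simp only [cbracket, cnabla, cim_cmk, map_sub, torsion hA.1 hC.2, torsion hA.2 hC.1]
    abel

theorem baseChange_cnabla_add_eq_neg_cext₃ {g}
    {b : Π x : M, TangentSpace (𝓡 n) x →L[ℝ] TangentSpace (𝓡 n) x →L[ℝ] ℝ}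
    {S : TangentSpace (𝓡 n) x → TangentSpace (𝓡 n) x → TangentSpace (𝓡 n) x → ℝ}
    (hS : ∀ X Y Z : Π x : M, TangentSpace (𝓡 n) x,
      SmoothFieldOn X V → SmoothFieldOn Y V → SmoothFieldOn Z V →
        dirDeriv X (fun y => b y (Y y) (Z y)) x - b x (leviCivita g X Y x) (Z x)
          - b x (Y x) (leviCivita g X Z x) = S (X x) (Y x) (Z x))
    (hV : IsOpen V) (hx : x ∈ V) (hA : SmoothCFieldOn A V) (hB : SmoothCFieldOn B V)
    (hC : SmoothCFieldOn C V)
    (h₀ : ∀ y ∈ V, LinearMap.BilinForm.baseChange ℂ (b y).toBilinForm (B y) (C y) = 0) :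
    LinearMap.BilinForm.baseChange ℂ (b x).toBilinForm (cnabla g A B x) (C x) +
      LinearMap.BilinForm.baseChange ℂ (b x).toBilinForm (B x) (cnabla g A C x) =
        -cext₃ S (A x) (B x) (C x) := by
  simp only [baseChange_eq, ContinuousLinearMap.toBilinForm_apply, Complex.ext_iff,
    Complex.zero_re, Complex.zero_im, sub_eq_zero, ← eq_neg_iff_add_eq_zero] at h₀
  have dre (X : Π x : M, TangentSpace (𝓡 n) x) :=
    dirDeriv_congr X (eventually_of_mem (hV.mem_nhds hx) fun y hy => (h₀ y hy).1)
  have dim (X : Π x : M, TangentSpace (𝓡 n) x) :=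
    dirDeriv_congr X (eventually_of_mem (hV.mem_nhds hx) fun y hy => (h₀ y hy).2)
  simp only [dirDeriv_neg] at dim
  simp only [baseChange_eq, ContinuousLinearMap.toBilinForm_apply]
  apply Complex.ext
  · simp only [cnabla, cext₃, cre_cmk, cim_cmk, map_sub, map_add, sub_apply, add_apply,
      Complex.add_re, Complex.neg_re]
    linear_combination -hS _ _ _ hA.1 hB.1 hC.1 + hS _ _ _ hA.1 hB.2 hC.2
      + hS _ _ _ hA.2 hB.2 hC.1 + hS _ _ _ hA.2 hB.1 hC.2
      + dre (fun y => cre (A y)) - dim (fun y => cim (A y))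
  · simp only [cnabla, cext₃, cre_cmk, cim_cmk, map_sub, map_add, sub_apply, add_apply,
      Complex.add_im, Complex.neg_im]
    linear_combination -hS _ _ _ hA.1 hB.1 hC.2 - hS _ _ _ hA.1 hB.2 hC.1
      - hS _ _ _ hA.2 hB.1 hC.1 + hS _ _ _ hA.2 hB.2 hC.2
      + dim (fun y => cre (A y)) + dre (fun y => cim (A y))

theorem cval_cnabla_add_eq_zero (hV : IsOpen V) (hx : x ∈ V) (hA : SmoothCFieldOn A V)
    (hB : SmoothCFieldOn B V) (hC : SmoothCFieldOn C V)
    (h₀ : ∀ y ∈ V, g.cval y (B y) (C y) = 0) :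
    g.cval x (cnabla g A B x) (C x) + g.cval x (B x) (cnabla g A C x) = 0 := by
  refine (baseChange_cnabla_add_eq_neg_cext₃ (S := 0) (fun X Y Z hX hY hZ => ?_) hV hx hA hB hC
    h₀).trans (by apply Complex.ext <;> simp [cext₃])
  rw [dirDeriv_metric g (hX.diffFieldAt hV hx) (hY.diffFieldAt hV hx) (hZ.diffFieldAt hV hx)]
  simp

variable {g} {φ : TwoForm n M}

theorem IsConformalKillingYano.cval_cnabla_add_eq_zero (hφ : IsConformalKillingYano g φ)
    (hV : IsOpen V) (hx : x ∈ V) (hA : SmoothCFieldOn A V) (hB : SmoothCFieldOn B V)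
    (hC : SmoothCFieldOn C V) (h₀ : ∀ y ∈ V, φ.cval y (B y) (C y) = 0)
    (hAB : g.cval x (A x) (B x) = 0) (hAC : g.cval x (A x) (C x) = 0)
    (hτ : cext₃ (extDeriv φ x) (A x) (B x) (C x) = 0) :
    φ.cval x (cnabla g A B x) (C x) + φ.cval x (B x) (cnabla g A C x) = 0 := by
  obtain ⟨K, hK⟩ := hφ
  refine (baseChange_cnabla_add_eq_neg_cext₃ (S := fun u v w => (1 / 3) * extDeriv φ x u v w
    + (1 / ((n : ℝ) - 1)) * (g.val x u v * K x w - g.val x u w * K x v))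
    (fun X Y Z hX hY hZ => hK V hV X Y Z hX hY hZ x hx) hV hx hA hB hC h₀).trans (neg_eq_zero.2 ?_)
  rw [g.cval_eq, Complex.ext_iff] at hAB hAC
  rw [Complex.ext_iff] at hτ
  simp only [cext₃, Complex.zero_re, Complex.zero_im] at hAB hAC hτ
  set k : ℝ := 1 / ((n : ℝ) - 1)
  apply Complex.ext
  · simp only [cext₃, Complex.zero_re]
    linear_combination 1 / 3 * hτ.1
      + k * (hAB.1 * K x (cre (C x)) - hAB.2 * K x (cim (C x))
        - hAC.1 * K x (cre (B x)) + hAC.2 * K x (cim (B x)))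
  · simp only [cext₃, Complex.zero_im]
    linear_combination 1 / 3 * hτ.2
      + k * (hAB.1 * K x (cim (C x)) + hAB.2 * K x (cre (C x))
        - hAC.1 * K x (cim (B x)) - hAC.2 * K x (cre (B x)))

theorem IsConformalKillingYano.apply_cnabla_eq_zero (hφ : IsConformalKillingYano g φ)
    (hV : IsOpen V) (hx : x ∈ V) (hA : SmoothCFieldOn A V) (hB : SmoothCFieldOn B V)
    (hC : SmoothCFieldOn C V) (hg : ∀ y ∈ V, g.cval y (B y) (C y) = 0)
    (h₀ : ∀ y ∈ V, φ.cval y (B y) (C y) = 0)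
    (hAB : g.cval x (A x) (B x) = 0) (hAC : g.cval x (A x) (C x) = 0)
    (hτ : cext₃ (extDeriv φ x) (A x) (B x) (C x) = 0) {z z' : ℂ} (hz : z + z' ≠ 0)
    (hBz : ∀ D, φ.cval x D (B x) = z * g.cval x D (B x))
    (hCz : ∀ D, φ.cval x D (C x) = z' * g.cval x D (C x)) :
    g.cval x (B x) (cnabla g A C x) = 0 := by
  have hmetric := CKY.cval_cnabla_add_eq_zero g hV hx hA hB hC hg
  have hform := hφ.cval_cnabla_add_eq_zero hV hx hA hB hC h₀ hAB hAC hτ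
  rw [hCz, φ.cval_skew x (B x), hBz, g.cval_symm x (cnabla g A C x)] at hform
  refine (mul_eq_zero.1 ?_).resolve_left hz
  linear_combination z' * hmetric - hform

theorem IsSmoothDistribution.exists_extension
    {D : Π x : M, Submodule ℂ (ℂ ⊗[ℝ] TangentSpace (𝓡 n) x)} {k : ℕ}
    (hD : IsSmoothDistribution D k U) (hx : x ∈ U) {b : ℂ ⊗[ℝ] TangentSpace (𝓡 n) x}
    (hb : b ∈ D x) : ∃ V : Set M, IsOpen V ∧ x ∈ V ∧ V ⊆ U ∧
      ∃ Z : Π x : M, ℂ ⊗[ℝ] TangentSpace (𝓡 n) x, SmoothCFieldOn Z V ∧ (∀ y ∈ V, Z y ∈ D y) ∧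
        Z x = b := by
  obtain ⟨V, hV, hxV, hVU, Z, hZ, hspan⟩ := hD x hx
  rw [(hspan x hxV).2, Submodule.mem_span_range_iff_exists_fun] at hb
  obtain ⟨c, hc⟩ := hb
  refine ⟨V, hV, hxV, hVU, fun y => ∑ i, c i • Z i y,
    SmoothCFieldOn.sum fun i _ => (hZ i).const_smul (c i), fun y hy => ?_, hc⟩
  rw [(hspan y hy).2]
  exact sum_mem fun i _ => Submodule.smul_mem _ _ (Submodule.subset_span (mem_range_self i))

end LeviCivita

section Reselect

variable {K W ι : Type*} [Field K] [AddCommGroup W] [Module K W] [DecidableEq ι]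
  {B Ω : LinearMap.BilinForm K W} {v w : ι → W} {lam : ι → K}

theorem IsHyperbolicBasis.reselect (h : IsHyperbolicBasis B v w) (s : ι → Bool) :
    IsHyperbolicBasis B (select w v s) (select v w s) where
  vv := h.swap.apply_select_select s
  ww := h.apply_select_select s
  vw μ ν := by grind [select, h.vv μ ν, h.ww μ ν, h.vw μ ν, h.wv μ ν]
  wv μ ν := by grind [select, h.vv μ ν, h.ww μ ν, h.vw μ ν, h.wv μ ν]
  span_eq_top := by
    refine top_le_iff.1 (h.span_eq_top.symm.trans_le (Submodule.span_mono ?_))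
    rintro _ ⟨μ | μ, rfl⟩ <;> cases hμ : s μ
    · exact ⟨.inl μ, select_of_eq_false hμ⟩
    · exact ⟨.inr μ, select_of_eq_true hμ⟩
    · exact ⟨.inr μ, select_of_eq_false hμ⟩
    · exact ⟨.inl μ, select_of_eq_true hμ⟩

theorem IsPencilBasis.reselect (h : IsPencilBasis B Ω v w lam) (s : ι → Bool) :
    IsPencilBasis B Ω (select w v s) (select v w s) fun μ => if s μ then -lam μ else lam μ :=
  (h.toIsHyperbolicBasis.reselect s).isPencilBasis
    (fun A μ => by grind [select, h.Ω_apply_v A μ, h.Ω_apply_w A μ])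
    (fun A μ => by grind [select, h.Ω_apply_v A μ, h.Ω_apply_w A μ])

end Reselect

theorem IsOrderedHalf.eventually {X : Type*} [TopologicalSpace X] {m : ℕ} {lam : Fin m → X → ℂ}
    {p : X} (hlam : ∀ μ, ContinuousAt (lam μ) p) (h : IsOrderedHalf (lam · p)) :
    ∀ᶠ x in 𝓝 p, IsOrderedHalf (lam · x) := by
  have hre (μ : Fin m) : ContinuousAt (fun x => (lam μ x).re) p :=
    Complex.continuous_re.continuousAt.comp (hlam μ)
  have him (μ : Fin m) : ContinuousAt (fun x => (lam μ x).im) p :=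
    Complex.continuous_im.continuousAt.comp (hlam μ)
  have hpos : ∀ᶠ x in 𝓝 p, ∀ μ, 0 < (lam μ x).re + (lam μ x).im :=
    eventually_all.2 fun μ => ((hre μ).add (him μ)).eventually_const_lt (h.pos μ)
  have hmono : ∀ᶠ x in 𝓝 p, ∀ μ ν, μ < ν →
      (lam μ x).im - (lam μ x).re < (lam ν x).im - (lam ν x).re :=
    eventually_all.2 fun μ => eventually_all.2 fun ν => eventually_imp_distrib_left.2 fun hμν =>
      ((him μ).sub (hre μ)).eventually_lt ((him ν).sub (hre ν)) (h.strictMono hμν)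
  filter_upwards [hpos, hmono] with x hx hx'
  exact ⟨hx, fun μ ν hμν => hx' μ ν hμν⟩

section Families

variable {m : ℕ} {M : Type*} [TopologicalSpace M]
  [ChartedSpace (EuclideanSpace ℝ (Fin (2 * m))) M] [IsManifold (𝓡 (2 * m)) ∞ M]
  {g : PseudoRiemannianMetric (2 * m) M} {φ : TwoForm (2 * m) M}

theorem IsSmoothPencilBasisOn.smooth_select {U : Set M}
    {v w : Fin m → Π x : M, ℂ ⊗[ℝ] TangentSpace (𝓡 (2 * m)) x} {lam : Fin m → M → ℂ}
    (h : IsSmoothPencilBasisOn g φ v w lam U) (s : Fin m → Bool) (μ : Fin m) :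
    SmoothCFieldOn (fun x => select (v · x) (w · x) s μ) U := by
  cases hμ : s μ
  · simpa only [select_of_eq_false hμ] using h.smooth_w μ
  · simpa only [select_of_eq_true hμ] using h.smooth_v μ

theorem IsSmoothPencilBasisOn.isEigendistributionFamily {U : Set M} (hU : IsOpen U)
    {v w : Fin m → Π x : M, ℂ ⊗[ℝ] TangentSpace (𝓡 (2 * m)) x} {lam : Fin m → M → ℂ}
    (h : IsSmoothPencilBasisOn g φ v w lam U) :
    IsEigendistributionFamily g φ U
      fun s x => Submodule.span ℂ (range (select (v · x) (w · x) s)) :=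
  ⟨fun s _ hp => ⟨U, hU, hp, Subset.rfl, _, h.smooth_select s, fun x hx =>
    ⟨(h.isPencilBasis x hx).linearIndependent_select s, rfl⟩⟩,
    fun x hx => ⟨_, _, _, (h.isPencilBasis x hx).isNullEigenbasis, fun _ => rfl⟩⟩

theorem exists_local_isEigendistributionFamily {p : M}
    (hs : HasSimpleSpectrum (g.cval p) (φ.cval p)) :
    ∃ U : Set M, IsOpen U ∧ p ∈ U ∧ ∃ D, IsEigendistributionFamily g φ U D := by
  obtain ⟨v₀, w₀, lam₀, h₀⟩ := exists_isPencilBasis_complex (g.cval_nondegenerate p)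
    (g.cval_isSymm p) (φ.cval_skew p) hs (finrank_complexified_tangentSpace p)
  obtain ⟨U, v, w, lam, hU, hpU, h, -⟩ := exists_isSmoothPencilBasisOn h₀ hs
  exact ⟨U, hU, hpU, _, h.isEigendistributionFamily hU⟩

-- An enumeration of half of the eigenvalues by an order is unique, hence the local families
-- agree on overlaps.
theorem exists_global_isEigendistributionFamily
    (hs : ∀ x : M, HasSimpleSpectrum (g.cval x) (φ.cval x))
    (hS : ∀ x : M, IsOrderable (pencilEigenvalues (g.cval x) (φ.cval x))) :
    ∃ (v w : Π x : M, Fin m → ℂ ⊗[ℝ] TangentSpace (𝓡 (2 * m)) x) (lam : M → Fin m → ℂ),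
      (∀ x, IsPencilBasis (g.cval x) (φ.cval x) (v x) (w x) (lam x) ∧ IsOrderedHalf (lam x)) ∧
      IsEigendistributionFamily g φ univ
        fun s x => Submodule.span ℂ (range (select (v x) (w x) s)) := by
  choose v w lam h ho using fun x : M => exists_isPencilBasis_isOrderedHalf
    (g.cval_nondegenerate x) (g.cval_isSymm x) (φ.cval_skew x) (hs x)
    (finrank_complexified_tangentSpace x) (hS x)
  refine ⟨v, w, lam, fun x => ⟨h x, ho x⟩, fun s p _ => ?_, fun x _ =>
    ⟨_, _, _, (h x).isNullEigenbasis, fun _ => rfl⟩⟩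
  obtain ⟨U, v', w', lam', hU, hpU, h', -, -, hlam'⟩ := exists_isSmoothPencilBasisOn (h p) (hs p)
  have hcont (μ : Fin m) : ContinuousAt (lam' μ) p :=
    (h'.smooth_lam μ).continuousOn.continuousAt (hU.mem_nhds hpU)
  obtain ⟨O, hO, hOo, hpO⟩ := eventually_nhds_iff.1
    (IsOrderedHalf.eventually hcont (hlam' ▸ ho p))
  refine ⟨U ∩ O, hU.inter hOo, ⟨hpU, hpO⟩, subset_univ _, _,
    fun μ => (h'.smooth_select s μ).mono inter_subset_left, fun x hx =>
      ⟨(h'.isPencilBasis x hx.1).linearIndependent_select s, ?_⟩⟩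
  have hlam : lam x = (lam' · x) :=
    (h x).eq_of_isOrderedHalf (h'.isPencilBasis x hx.1) (hS x) (ho x) (hO x hx.2)
  exact (hlam ▸ h x).span_select_eq (h'.isPencilBasis x hx.1) (hs x) s

section TauCondition

variable {x : M} {v w : Fin m → ℂ ⊗[ℝ] TangentSpace (𝓡 (2 * m)) x} {lam : Fin m → ℂ}

theorem IsHyperbolicBasis.cext₃_select_eq_zero (h : IsHyperbolicBasis (g.cval x) v w)
    (hw : ∀ μ, WedgeContractionVanish g φ x (w μ) ∧ WedgeContractionVanish g φ x (v μ))
    (s : Fin m → Bool) (κ μ ν : Fin m) :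
    cext₃ (extDeriv φ x) (select v w s κ) (select v w s μ) (select v w s ν) = 0 := by
  cases hκ : s κ
  · have e := (hw κ).1 (v κ) (select v w s μ) (select v w s ν)
    rwa [h.wv, if_pos rfl, ← select_of_eq_false (v := v) (w := w) hκ,
      h.apply_select_select, h.apply_select_select, one_mul,
      zero_mul, zero_mul, add_zero, add_zero] at e
  · have e := (hw κ).2 (w κ) (select v w s μ) (select v w s ν)
    rwa [h.vw, if_pos rfl, ← select_of_eq_true (v := v) (w := w) hκ,
      h.apply_select_select, h.apply_select_select, one_mul,
      zero_mul, zero_mul, add_zero, add_zero] at e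

theorem tauComponentsVanish_of_ne (h : ∀ (s : Fin m → Bool) (κ μ ν : Fin m), κ ≠ μ → κ ≠ ν →
      μ ≠ ν → cext₃ (extDeriv φ x) (select v w s κ) (select v w s μ) (select v w s ν) = 0) :
    TauComponentsVanish φ x v w := by
  intro s κ μ ν
  have hτ := (isSkewTrilinear_extDeriv φ x).cext₃
  by_cases hκμ : κ = μ
  · rw [hκμ, hτ.self₁₂]
  by_cases hκν : κ = ν
  · rw [hκν, hτ.self₁₃]
  by_cases hμν : μ = ν
  · rw [hμν, hτ.self₂₃]
  · exact h s κ μ ν hκμ hκν hμν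

theorem IsNullEigenbasis.tauComponentsVanish (h : IsNullEigenbasis g φ x v w lam)
    (hw : (∀ μ, WedgeContractionVanish g φ x (w μ) ∧ WedgeContractionVanish g φ x (v μ)) ∨
      (∀ a b c, extDeriv φ x a b c = 0) ∨ m = 2) : TauComponentsVanish φ x v w := by
  refine tauComponentsVanish_of_ne fun s κ μ ν hκμ hκν hμν => ?_
  obtain hwedge | hclosed | rfl := hw
  · exact h.isPencilBasis.cext₃_select_eq_zero hwedge s κ μ ν
  · apply Complex.ext <;> simp [cext₃, hclosed]
  · omega

end TauCondition

/-- Condition (T): the components of `τ = dφ` without a pair `V_μ`, `V^μ` vanish in each null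
eigenbasis. -/
def SatisfiesTauCondition (g : PseudoRiemannianMetric (2 * m) M) (φ : TwoForm (2 * m) M) : Prop :=
  ∀ (x : M) (v w : Fin m → ℂ ⊗[ℝ] TangentSpace (𝓡 (2 * m)) x) (lam : Fin m → ℂ),
    IsNullEigenbasis g φ x v w lam → TauComponentsVanish φ x v w

namespace IsEigendistributionFamily

variable {U V : Set M}
  {D : (Fin m → Bool) → Π x : M, Submodule ℂ (ℂ ⊗[ℝ] TangentSpace (𝓡 (2 * m)) x)}
  {x : M} {A X : Π x : M, ℂ ⊗[ℝ] TangentSpace (𝓡 (2 * m)) x}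

theorem exists_isPencilBasis (hD : IsEigendistributionFamily g φ U D) (hx : x ∈ U) :
    ∃ v w lam, IsPencilBasis (g.cval x) (φ.cval x) v w lam ∧
      ∀ s, D s x = Submodule.span ℂ (range (select v w s)) := by
  obtain ⟨v, w, lam, h, hs⟩ := hD.2 x hx
  exact ⟨v, w, lam, h.isPencilBasis, hs⟩

theorem exists_isPencilBasis_eq_span (hD : IsEigendistributionFamily g φ U D) (hx : x ∈ U)
    (s : Fin m → Bool) : ∃ (v w : Fin m → ℂ ⊗[ℝ] TangentSpace (𝓡 (2 * m)) x)
      (lam : Fin m → ℂ), IsPencilBasis (g.cval x) (φ.cval x) v w lam ∧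
      D s x = Submodule.span ℂ (range w) := by
  obtain ⟨v, w, lam, h, hs⟩ := hD.exists_isPencilBasis hx
  exact ⟨_, _, _, h.reselect s, hs s⟩

theorem injective (hD : IsEigendistributionFamily g φ U D) (hx : x ∈ U) :
    Function.Injective fun s => D s x := by
  obtain ⟨v, w, lam, h, hs⟩ := hD.exists_isPencilBasis hx
  simpa only [hs] using h.span_select_injective

theorem finrank_eq (hD : IsEigendistributionFamily g φ U D) (hx : x ∈ U) (s : Fin m → Bool) :
    finrank ℂ (D s x) = m := by
  obtain ⟨v, w, lam, h, hs⟩ := hD.exists_isPencilBasis hx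
  rw [hs, h.finrank_span_select, Nat.card_fin]

theorem isotropic (hD : IsEigendistributionFamily g φ U D) (s : Fin m → Bool) (hx : x ∈ U)
    {A B : ℂ ⊗[ℝ] TangentSpace (𝓡 (2 * m)) x} (hA : A ∈ D s x) (hB : B ∈ D s x) :
    g.cval x A B = 0 := by
  obtain ⟨v, w, lam, h, hs⟩ := hD.exists_isPencilBasis hx
  exact h.isotropic s (hs s ▸ hA) (hs s ▸ hB)

theorem isotropic_skew (hD : IsEigendistributionFamily g φ U D) (s : Fin m → Bool) (hx : x ∈ U)
    {A B : ℂ ⊗[ℝ] TangentSpace (𝓡 (2 * m)) x} (hA : A ∈ D s x) (hB : B ∈ D s x) :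
    φ.cval x A B = 0 := by
  obtain ⟨v, w, lam, h, hs⟩ := hD.exists_isPencilBasis hx
  exact h.isotropic_skew s (hs s ▸ hA) (hs s ▸ hB)

theorem cext₃_eq_zero (hD : IsEigendistributionFamily g φ U D) (hT : SatisfiesTauCondition g φ)
    (s : Fin m → Bool) (hx : x ∈ U) {A B C : ℂ ⊗[ℝ] TangentSpace (𝓡 (2 * m)) x}
    (hA : A ∈ D s x) (hB : B ∈ D s x) (hC : C ∈ D s x) : cext₃ (extDeriv φ x) A B C = 0 := by
  obtain ⟨v, w, lam, h, hs⟩ := hD.exists_isPencilBasis hx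
  exact (isSkewTrilinear_extDeriv φ x).cext₃.eq_zero_of_mem_span
    (hT x v w lam h.isNullEigenbasis s) (hs s ▸ hA) (hs s ▸ hB) (hs s ▸ hC)

theorem apply_cnabla_eq_zero (hD : IsEigendistributionFamily g φ U D)
    (hφ : IsConformalKillingYano g φ) (hT : SatisfiesTauCondition g φ) (s : Fin m → Bool)
    (hV : IsOpen V) (hVU : V ⊆ U) (hx : x ∈ V) {B C : Π x : M, ℂ ⊗[ℝ] TangentSpace (𝓡 (2 * m)) x}
    (hX : SmoothCFieldOn X V) (hB : SmoothCFieldOn B V) (hC : SmoothCFieldOn C V)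
    (hXD : ∀ y ∈ V, X y ∈ D s y) (hBD : ∀ y ∈ V, B y ∈ D s y) (hCD : ∀ y ∈ V, C y ∈ D s y)
    {z z' : ℂ} (hz : z + z' ≠ 0) (hBz : ∀ A, φ.cval x A (B x) = z * g.cval x A (B x))
    (hCz : ∀ A, φ.cval x A (C x) = z' * g.cval x A (C x)) :
    g.cval x (B x) (cnabla g X C x) = 0 :=
  hφ.apply_cnabla_eq_zero hV hx hX hB hC
    (fun y hy => hD.isotropic s (hVU hy) (hBD y hy) (hCD y hy))
    (fun y hy => hD.isotropic_skew s (hVU hy) (hBD y hy) (hCD y hy))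
    (hD.isotropic s (hVU hx) (hXD x hx) (hBD x hx))
    (hD.isotropic s (hVU hx) (hXD x hx) (hCD x hx))
    (hD.cext₃_eq_zero hT s (hVU hx) (hXD x hx) (hBD x hx) (hCD x hx)) hz hBz hCz

theorem cnabla_mem (hD : IsEigendistributionFamily g φ U D) (hφ : IsConformalKillingYano g φ)
    (hs : ∀ x : M, HasSimpleSpectrum (g.cval x) (φ.cval x)) (hT : SatisfiesTauCondition g φ)
    (s : Fin m → Bool) (hV : IsOpen V) (hVU : V ⊆ U) (hX : SmoothCFieldOn X V)
    (hA : SmoothCFieldOn A V) (hXD : ∀ y ∈ V, X y ∈ D s y) (hAD : ∀ y ∈ V, A y ∈ D s y)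
    (hx : x ∈ V) : cnabla g X A x ∈ D s x := by
  obtain ⟨v, w, lam, h, hw⟩ := hD.exists_isPencilBasis_eq_span (hVU hx) s
  have hwD (μ : Fin m) : w μ ∈ D s x := hw ▸ Submodule.subset_span (mem_range_self μ)
  choose O hO hxO _ W hW hWD hWx using fun μ => (hD.1 s).exists_extension (hVU hx) (hwD μ)
  have hvanish (μ ν : Fin m) : g.cval x (w ν) (cnabla g X (W μ) x) = 0 := by
    let N := V ∩ (O μ ∩ O ν)
    have hN : IsOpen N := hV.inter ((hO μ).inter (hO ν))
    rw [← hWx ν]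
    exact hD.apply_cnabla_eq_zero hφ hT s hN (inter_subset_left.trans hVU) ⟨hx, hxO μ, hxO ν⟩
      (hX.mono inter_subset_left) ((hW ν).mono fun y hy => hy.2.2)
      ((hW μ).mono fun y hy => hy.2.1) (fun y hy => hXD y hy.1) (fun y hy => hWD ν y hy.2.2)
      (fun y hy => hWD μ y hy.2.1)
      (fun h₀ => h.lam_ne_neg_lam (hs x) ν μ (eq_neg_of_add_eq_zero_left h₀))
      (fun E => by rw [hWx, h.Ω_apply_w]) (fun E => by rw [hWx, h.Ω_apply_w])
  have horth (μ : Fin m) : g.cval x (cnabla g X A x) (w μ) = 0 := by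
    have hcompat := cval_cnabla_add_eq_zero g (hV.inter (hO μ)) ⟨hx, hxO μ⟩
      (hX.mono inter_subset_left) (hA.mono inter_subset_left) ((hW μ).mono inter_subset_right)
      fun y hy => hD.isotropic s (hVU hy.1) (hAD y hy.1) (hWD μ y hy.2)
    have hle : Submodule.span ℂ (range w) ≤ LinearMap.ker ((g.cval x).flip (cnabla g X (W μ) x)) :=
      Submodule.span_le.2 (range_subset_iff.2 (hvanish μ))
    have hzero : g.cval x (A x) (cnabla g X (W μ) x) = 0 := hle (hw ▸ hAD x hx)
    rwa [hzero, add_zero, hWx] at hcompat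
  rw [hw]
  exact h.mem_span_select_of_orthogonal (fun _ => false) horth

theorem isIntegrable (hD : IsEigendistributionFamily g φ U D) (hφ : IsConformalKillingYano g φ)
    (hs : ∀ x : M, HasSimpleSpectrum (g.cval x) (φ.cval x)) (hT : SatisfiesTauCondition g φ)
    (s : Fin m → Bool) : IsIntegrable (D s) U := by
  intro V hV hVU Z W hZ hW hZD hWD x hx
  rw [cbracket_eq_cnabla_sub g hV hZ hW hx]
  exact sub_mem (hD.cnabla_mem hφ hs hT s hV hVU hZ hW hZD hWD hx)
    (hD.cnabla_mem hφ hs hT s hV hVU hW hZ hWD hZD hx)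

end IsEigendistributionFamily

end Families

section ComplexStructures

variable {V : Type*} [AddCommGroup V] [Module ℝ V]

/-- `J` is the complex structure with `(1,0)`-space `D`: each vector is the real part of an element
of `D`, and the elements of `D` are of the form `a - i J a`. -/
structure IsComplexStructureOf (J : V →ₗ[ℝ] V) (D : Submodule ℂ (ℂ ⊗[ℝ] V)) : Prop where
  apply_cre : ∀ A ∈ D, J (cre A) = -cim A
  exists_cre_eq : ∀ a, ∃ A ∈ D, cre A = a

theorem exists_isComplexStructureOf [FiniteDimensional ℝ V] {D : Submodule ℂ (ℂ ⊗[ℝ] V)}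
    (hinj : ∀ A ∈ D, cre A = 0 → A = 0) (hrank : 2 * finrank ℂ D = finrank ℝ V) :
    ∃ J : V →ₗ[ℝ] V, IsComplexStructureOf J D := by
  let f : D.restrictScalars ℝ →ₗ[ℝ] V := cre.domRestrict (D.restrictScalars ℝ)
  have hf : Function.Injective f :=
    LinearMap.ker_eq_bot.1 (LinearMap.ker_eq_bot'.2 fun A hA => Subtype.ext (hinj A A.2 hA))
  have hr : finrank ℝ (D.restrictScalars ℝ) = finrank ℝ V := by
    rw [← hrank, ← Complex.finrank_real_complex]
    exact (finrank_mul_finrank ℝ ℂ D).symm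
  let e := LinearEquiv.ofInjectiveOfFinrankEq f hf hr
  refine ⟨-(cim ∘ₗ (D.restrictScalars ℝ).subtype ∘ₗ e.symm.toLinearMap), fun A hA => ?_,
    fun a => ⟨e.symm a, (e.symm a).2, e.apply_symm_apply a⟩⟩
  have he : e.symm (cre A) = ⟨A, hA⟩ := (LinearEquiv.symm_apply_eq e).2 rfl
  simp [he]

theorem cre_baseChange (J : V →ₗ[ℝ] V) (A : ℂ ⊗[ℝ] V) : cre (J.baseChange ℂ A) = J (cre A) := by
  induction A using TensorProduct.induction_on with
  | zero => simp
  | tmul z a => simp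
  | add x y hx hy => simp [hx, hy]

theorem cim_baseChange (J : V →ₗ[ℝ] V) (A : ℂ ⊗[ℝ] V) : cim (J.baseChange ℂ A) = J (cim A) := by
  induction A using TensorProduct.induction_on with
  | zero => simp
  | tmul z a => simp
  | add x y hx hy => simp [hx, hy]

namespace IsComplexStructureOf

variable {D : Submodule ℂ (ℂ ⊗[ℝ] V)} {J : V →ₗ[ℝ] V}

theorem apply_cim (h : IsComplexStructureOf J D) {A : ℂ ⊗[ℝ] V} (hA : A ∈ D) :
    J (cim A) = cre A := by
  simpa using h.apply_cre (-Complex.I • A) (D.smul_mem _ hA)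

theorem apply_apply (h : IsComplexStructureOf J D) (a : V) : J (J a) = -a := by
  obtain ⟨A, hA, rfl⟩ := h.exists_cre_eq a
  rw [h.apply_cre A hA, map_neg, h.apply_cim hA]

theorem cmk_mem (h : IsComplexStructureOf J D) (a : V) : cmk a (-J a) ∈ D := by
  obtain ⟨A, hA, rfl⟩ := h.exists_cre_eq a
  rwa [h.apply_cre A hA, neg_neg, cmk_cre_cim]

theorem cmk_mem' (h : IsComplexStructureOf J D) (a : V) : cmk (J a) a ∈ D := by
  simpa only [h.apply_apply, neg_neg] using h.cmk_mem (J a)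

theorem eq_eigenspace (h : IsComplexStructureOf J D) :
    D = End.eigenspace (J.baseChange ℂ) Complex.I := by
  ext A
  rw [End.mem_eigenspace_iff]
  refine ⟨fun hA => ctensor_ext ?_ ?_, fun hA => ?_⟩
  · simp [cre_baseChange, h.apply_cre A hA]
  · simp [cim_baseChange, h.apply_cim hA]
  · have hJ : J (cim A) = cre A := by simpa [cim_baseChange] using congrArg cim hA
    simpa only [hJ, cmk_cre_cim] using h.cmk_mem' (cim A)

end IsComplexStructureOf

end ComplexStructures

section LinearSystems

variable {n : ℕ} {M : Type*} [TopologicalSpace M] [ChartedSpace (EuclideanSpace ℝ (Fin n)) M]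
  {U : Set M}

theorem SmoothCOn.mul {f h : M → ℂ} (hf : SmoothCOn n f U) (hh : SmoothCOn n h U) :
    SmoothCOn n (fun x => f x * h x) U := by
  have hmul : ContDiff ℝ ∞ (fun z : ℂ × ℂ => z.1 * z.2) := contDiff_fst.mul contDiff_snd
  exact hmul.contMDiff.comp_contMDiffOn (hf.prodMk_space hh)

theorem SmoothCOn.det {k : ℕ} {N : M → Matrix (Fin k) (Fin k) ℂ}
    (hN : ∀ i j, SmoothCOn n (fun x => N x i j) U) : SmoothCOn n (fun x => (N x).det) U := by
  have hdet : ContDiff ℝ ∞ (fun N : Fin k → Fin k → ℂ => (Matrix.of N).det) := by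
    simp only [Matrix.det_apply', Matrix.of_apply]
    fun_prop
  have hN' : ContMDiffOn (𝓡 n) 𝓘(ℝ, Fin k → Fin k → ℂ) ∞ (fun x i j => N x i j) U :=
    contMDiffOn_pi_space.2 fun i => contMDiffOn_pi_space.2 (hN i)
  exact hdet.contMDiff.comp_contMDiffOn hN'

theorem SmoothCOn.of_mulVec_eq {k : ℕ} {N : M → Matrix (Fin k) (Fin k) ℂ} {c h : M → Fin k → ℂ}
    (hN : ∀ i j, SmoothCOn n (fun x => N x i j) U) (hh : ∀ i, SmoothCOn n (fun x => h x i) U)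
    (hdet : ∀ x ∈ U, (N x).det ≠ 0) (hc : ∀ x ∈ U, (N x).mulVec (c x) = h x) (i : Fin k) :
    SmoothCOn n (fun x => c x i) U := by
  have hcol : SmoothCOn n (fun x => ((N x).updateCol i (h x)).det) U :=
    SmoothCOn.det fun a b => by
      by_cases hb : b = i
      · subst hb
        simpa using hh a
      · simpa [hb] using hN a b
  refine (((SmoothCOn.det hN).inv hdet).mul hcol).congr fun x hx => ?_
  have hcramer : ((N x).updateCol i (h x)).det = (N x).det * c x i := by
    rw [← Matrix.cramer_apply, Matrix.cramer_eq_adjugate_mulVec, ← hc x hx, Matrix.mulVec_mulVec,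
      Matrix.adjugate_mul, Matrix.smul_mulVec, Matrix.one_mulVec, Pi.smul_apply, smul_eq_mul]
  rw [hcramer, inv_mul_cancel_left₀ (hdet x hx)]

end LinearSystems

theorem IsPencilBasis.zero_notMem_pencilEigenvalues {K W ι : Type*} [Field K] [AddCommGroup W]
    [Module K W] [Finite ι] [DecidableEq ι] {B Ω : LinearMap.BilinForm K W} {v w : ι → W}
    {lam : ι → K} (h : IsPencilBasis B Ω v w lam) (hs : HasSimpleSpectrum B Ω) :
    0 ∉ pencilEigenvalues B Ω := by
  rw [h.pencilEigenvalues_eq]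
  rintro ⟨μ | μ, hμ : _ = (0 : K)⟩ <;> refine h.lam_ne_neg_lam hs μ μ ?_
  · rw [show lam μ = 0 from hμ, neg_zero]
  · rw [show -lam μ = 0 from hμ, neg_eq_zero.1 hμ]

section Conjugation

variable {n : ℕ} {M : Type*} [TopologicalSpace M]
  [ChartedSpace (EuclideanSpace ℝ (Fin n)) M] [IsManifold (𝓡 n) ∞ M]
  {g : PseudoRiemannianMetric n M} {φ : TwoForm n M} {x : M}

theorem cval_cconj_eq_mul {l : ℂ ⊗[ℝ] TangentSpace (𝓡 n) x} {z : ℂ}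
    (h : ∀ A, φ.cval x A l = z * g.cval x A l) (A : ℂ ⊗[ℝ] TangentSpace (𝓡 n) x) :
    φ.cval x A (cconj l) = (starRingEnd ℂ) z * g.cval x A (cconj l) := by
  rw [← cconj_cconj A, φ.cval_cconj, g.cval_cconj, h, map_mul]

theorem cval_cconj_self (g : PseudoRiemannianMetric n M) (A : ℂ ⊗[ℝ] TangentSpace (𝓡 n) x) :
    g.cval x A (cconj A) =
      ((g.val x (cre A) (cre A) + g.val x (cim A) (cim A) : ℝ) : ℂ) := by
  rw [g.cval_eq]
  apply Complex.ext
  · simp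
  · simp [g.symm x (cim A)]

theorem cval_cconj_eq_two_mul {A B : ℂ ⊗[ℝ] TangentSpace (𝓡 n) x} (h : g.cval x A B = 0) :
    g.cval x A (cconj B) = 2 * g.cval x (1 ⊗ₜ cre A) (cconj B) := by
  have hA : (2 : ℂ) • ((1 : ℂ) ⊗ₜ[ℝ] cre A) = A + cconj A := by
    apply ctensor_ext <;> simp [two_smul]
  rw [← smul_eq_mul, ← LinearMap.smul_apply, ← map_smul, hA, map_add, LinearMap.add_apply,
    g.cval_cconj, h, map_zero, add_zero]

end Conjugation

namespace PseudoRiemannianMetric.IsRiemannian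

variable {n : ℕ} {M : Type*} [TopologicalSpace M]
  [ChartedSpace (EuclideanSpace ℝ (Fin n)) M] [IsManifold (𝓡 n) ∞ M]
  {g : PseudoRiemannianMetric n M}

section Pointwise

variable {x : M}

theorem val_self_eq_zero_of_add_eq_zero (hg : g.IsRiemannian) {a b : TangentSpace (𝓡 n) x}
    (h : g.val x a a + g.val x b b = 0) : a = 0 ∧ b = 0 := by
  have hnn (v : TangentSpace (𝓡 n) x) : 0 ≤ g.val x v v := by
    by_cases hv : v = 0
    · simp [hv]
    · exact (hg x v hv).le
  constructor <;> by_contra hne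
  · linarith [hg x a hne, hnn b]
  · linarith [hg x b hne, hnn a]

theorem eq_zero_of_cval_cconj_self (hg : g.IsRiemannian) {A : ℂ ⊗[ℝ] TangentSpace (𝓡 n) x}
    (h : g.cval x A (cconj A) = 0) : A = 0 := by
  rw [cval_cconj_self, Complex.ofReal_eq_zero] at h
  obtain ⟨hre, him⟩ := hg.val_self_eq_zero_of_add_eq_zero h
  exact ctensor_ext (hre.trans (map_zero _).symm) (him.trans (map_zero _).symm)

theorem re_eq_zero_of_mem_pencilEigenvalues (hg : g.IsRiemannian) {φ : TwoForm n M} {z : ℂ}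
    (hz : z ∈ pencilEigenvalues (g.cval x) (φ.cval x)) : z.re = 0 := by
  obtain ⟨l, hl, h⟩ := hz
  by_contra hne
  refine hl (hg.eq_zero_of_cval_cconj_self (apply_eq_zero_of_add_ne_zero (g.cval_isSymm x)
    (φ.cval_skew x) h (cval_cconj_eq_mul h) fun h₀ => hne ?_))
  simpa using congrArg Complex.re h₀

theorem isOrderable {m : ℕ} {M : Type*} [TopologicalSpace M]
    [ChartedSpace (EuclideanSpace ℝ (Fin (2 * m))) M] [IsManifold (𝓡 (2 * m)) ∞ M]
    {g : PseudoRiemannianMetric (2 * m) M} {φ : TwoForm (2 * m) M} {x : M} (hg : g.IsRiemannian)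
    (hs : HasSimpleSpectrum (g.cval x) (φ.cval x)) :
    IsOrderable (pencilEigenvalues (g.cval x) (φ.cval x)) where
  ne_zero z hz h₀ := by
    obtain ⟨v, w, lam, h⟩ := exists_isPencilBasis_complex (g.cval_nondegenerate x)
      (g.cval_isSymm x) (φ.cval_skew x) hs (finrank_complexified_tangentSpace x)
    have hre := hg.re_eq_zero_of_mem_pencilEigenvalues hz
    have hz₀ : z = 0 := Complex.ext hre (by simpa [hre] using h₀)
    exact h.zero_notMem_pencilEigenvalues hs (hz₀ ▸ hz)
  injOn z hz y hy h := by
    have hz₀ := hg.re_eq_zero_of_mem_pencilEigenvalues hz.1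
    have hy₀ := hg.re_eq_zero_of_mem_pencilEigenvalues hy.1
    exact Complex.ext (hz₀.trans hy₀.symm) (by simpa [hz₀, hy₀] using h)

theorem exists_isComplexStructureOf (hg : g.IsRiemannian)
    {D : Submodule ℂ (ℂ ⊗[ℝ] TangentSpace (𝓡 n) x)}
    (hiso : ∀ A ∈ D, ∀ B ∈ D, g.cval x A B = 0) (hrank : 2 * finrank ℂ D = n) :
    ∃ J : TangentSpace (𝓡 n) x →ₗ[ℝ] TangentSpace (𝓡 n) x, IsComplexStructureOf J D := by
  refine CKY.exists_isComplexStructureOf (fun A hA h₀ => hg.eq_zero_of_cval_cconj_self ?_)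
    (hrank.trans finrank_euclideanSpace_fin.symm)
  have hconj : cconj A = -A := by apply ctensor_ext <;> simp [h₀]
  rw [hconj, map_neg, hiso A hA A hA, neg_zero]

end Pointwise

end PseudoRiemannianMetric.IsRiemannian

section HermitianGram

variable {n : ℕ} {M : Type*} [TopologicalSpace M]
  [ChartedSpace (EuclideanSpace ℝ (Fin n)) M] [IsManifold (𝓡 n) ∞ M]
  {g : PseudoRiemannianMetric n M}

/-- The Gram matrix of complex tangent vectors for the sesquilinear extension of `g`, transposed so
that it acts on coefficient vectors. -/
def hermitianGram (g : PseudoRiemannianMetric n M) (x : M) {k : ℕ}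
    (Z : Fin k → ℂ ⊗[ℝ] TangentSpace (𝓡 n) x) : Matrix (Fin k) (Fin k) ℂ :=
  Matrix.of fun j i => g.cval x (Z i) (cconj (Z j))

theorem hermitianGram_mulVec {x : M} {k : ℕ} (Z : Fin k → ℂ ⊗[ℝ] TangentSpace (𝓡 n) x)
    (c : Fin k → ℂ) (j : Fin k) : (hermitianGram g x Z).mulVec c j =
      g.cval x (∑ i, c i • Z i) (cconj (Z j)) := by
  simp [hermitianGram, Matrix.mulVec, dotProduct, LinearMap.sum_apply, mul_comm]

theorem PseudoRiemannianMetric.IsRiemannian.det_hermitianGram_ne_zero (hg : g.IsRiemannian)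
    {x : M} {k : ℕ} {Z : Fin k → ℂ ⊗[ℝ] TangentSpace (𝓡 n) x} (hZ : LinearIndependent ℂ Z) :
    (hermitianGram g x Z).det ≠ 0 := by
  intro h₀
  obtain ⟨c, hc, hGc⟩ := Matrix.exists_mulVec_eq_zero_iff.2 h₀
  have horth (j : Fin k) : g.cval x (∑ i, c i • Z i) (cconj (Z j)) = 0 := by
    rw [← hermitianGram_mulVec, hGc, Pi.zero_apply]
  have hsum : ∑ i, c i • Z i = 0 := by
    apply hg.eq_zero_of_cval_cconj_self
    rw [map_sum cconj, map_sum]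
    refine Finset.sum_eq_zero fun j _ => ?_
    rw [map_smulₛₗ, map_smul, horth, smul_zero]
  exact hc (funext (Fintype.linearIndependent_iff.1 hZ c hsum))

variable {U : Set M} {A : Π x : M, ℂ ⊗[ℝ] TangentSpace (𝓡 n) x}

theorem SmoothCFieldOn.of_locally (h : ∀ p ∈ U, ∃ O : Set M, IsOpen O ∧ p ∈ O ∧
    SmoothCFieldOn A O) : SmoothCFieldOn A U := by
  constructor <;> intro p hp <;> obtain ⟨O, hO, hpO, hA⟩ := h p hp
  · exact (ContMDiffOn.contMDiffAt hA.1 (hO.mem_nhds hpO)).contMDiffWithinAt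
  · exact (ContMDiffOn.contMDiffAt hA.2 (hO.mem_nhds hpO)).contMDiffWithinAt

-- The coefficients of `A` in the frame `Z` solve the Gram system with right-hand side
-- `2 g (cre A, conj (Z j))`, because `conj A` is orthogonal to each `conj (Z j)`.
theorem PseudoRiemannianMetric.IsRiemannian.smoothCFieldOn_of_mem_span (hg : g.IsRiemannian)
    {k : ℕ} {Z : Fin k → Π x : M, ℂ ⊗[ℝ] TangentSpace (𝓡 n) x}
    (hZ : ∀ i, SmoothCFieldOn (Z i) U) (hli : ∀ x ∈ U, LinearIndependent ℂ fun i => Z i x)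
    (hiso : ∀ x ∈ U, ∀ j, g.cval x (A x) (Z j x) = 0)
    (hAZ : ∀ x ∈ U, A x ∈ Submodule.span ℂ (range fun i => Z i x))
    (hA : SmoothFieldOn (fun x => cre (A x)) U) : SmoothCFieldOn A U := by
  choose! c hc using fun x (hx : x ∈ U) => (Submodule.mem_span_range_iff_exists_fun ℂ).1 (hAZ x hx)
  have hcs (i : Fin k) : SmoothCOn n (fun x => c x i) U := by
    refine SmoothCOn.of_mulVec_eq (N := fun x => hermitianGram g x fun i => Z i x)
      (h := fun x j => 2 * g.cval x (1 ⊗ₜ cre (A x)) (cconj (Z j x)))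
      (fun j i => g.smoothCOn_cval (hZ i) (hZ j).cconj)
      (fun j => SmoothCOn.mul contMDiffOn_const (g.smoothCOn_cval hA.one_tmul (hZ j).cconj))
      (fun x hx => hg.det_hermitianGram_ne_zero (hli x hx)) (fun x hx => funext fun j => ?_) i
    rw [hermitianGram_mulVec, hc x hx, cval_cconj_eq_two_mul (hiso x hx j)]
  have hsum : SmoothCFieldOn (fun x => ∑ i, c x i • Z i x) U :=
    SmoothCFieldOn.sum fun i _ => (hZ i).smul (hcs i)
  exact ⟨hsum.1.congr fun x hx => by simp only [hc x hx],
    hsum.2.congr fun x hx => by simp only [hc x hx]⟩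

theorem PseudoRiemannianMetric.IsRiemannian.smoothCFieldOn_of_cre (hg : g.IsRiemannian)
    {D : Π x : M, Submodule ℂ (ℂ ⊗[ℝ] TangentSpace (𝓡 n) x)} {k : ℕ}
    (hD : IsSmoothDistribution D k U) (hiso : ∀ x ∈ U, ∀ A ∈ D x, ∀ B ∈ D x, g.cval x A B = 0)
    {V : Set M} (hV : IsOpen V) (hVU : V ⊆ U) (hAD : ∀ x ∈ V, A x ∈ D x)
    (hA : SmoothFieldOn (fun x => cre (A x)) V) : SmoothCFieldOn A V := by
  refine SmoothCFieldOn.of_locally fun p hp => ?_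
  obtain ⟨O, hO, hpO, -, Z, hZ, hspan⟩ := hD p (hVU hp)
  have hAZ : ∀ x ∈ V ∩ O, A x ∈ Submodule.span ℂ (range fun i => Z i x) := fun x hx =>
    (hspan x hx.2).2 ▸ hAD x hx.1
  have hZD (x : M) (hx : x ∈ V ∩ O) (j : Fin k) : Z j x ∈ D x :=
    (hspan x hx.2).2 ▸ Submodule.subset_span (mem_range_self j)
  exact ⟨V ∩ O, hV.inter hO, ⟨hp, hpO⟩, hg.smoothCFieldOn_of_mem_span
    (fun i => (hZ i).mono inter_subset_right) (fun x hx => (hspan x hx.2).1)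
    (fun x hx j => hiso x (hVU hx.1) _ (hAD x hx.1) _ (hZD x hx j)) hAZ
    (hA.mono inter_subset_left)⟩

end HermitianGram

section HermitianStructures

variable {n : ℕ} {M : Type*} [TopologicalSpace M]
  [ChartedSpace (EuclideanSpace ℝ (Fin n)) M] [IsManifold (𝓡 n) ∞ M]
  {g : PseudoRiemannianMetric n M} {U V : Set M}
  {D : Π x : M, Submodule ℂ (ℂ ⊗[ℝ] TangentSpace (𝓡 n) x)}
  {J : Π x : M, TangentSpace (𝓡 n) x →ₗ[ℝ] TangentSpace (𝓡 n) x}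

theorem IsComplexStructureOf.val_apply_apply {x : M} (hJ : IsComplexStructureOf (J x) (D x))
    (hiso : ∀ A ∈ D x, ∀ B ∈ D x, g.cval x A B = 0) (a b : TangentSpace (𝓡 n) x) :
    g.val x (J x a) (J x b) = g.val x a b := by
  have h := congrArg Complex.re (hiso _ (hJ.cmk_mem a) _ (hJ.cmk_mem b))
  simp only [g.cval_eq, cre_cmk, cim_cmk, map_neg, neg_neg, neg_apply, Complex.zero_re] at h
  exact (sub_eq_zero.1 h).symm

theorem PseudoRiemannianMetric.IsRiemannian.smoothFieldOn_complexStructure (hg : g.IsRiemannian)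
    {k : ℕ} (hD : IsSmoothDistribution D k U)
    (hiso : ∀ x ∈ U, ∀ A ∈ D x, ∀ B ∈ D x, g.cval x A B = 0)
    (hJ : ∀ x ∈ U, IsComplexStructureOf (J x) (D x)) (hV : IsOpen V) (hVU : V ⊆ U)
    {X : Π x : M, TangentSpace (𝓡 n) x} (hX : SmoothFieldOn X V) :
    SmoothFieldOn (fun x => J x (X x)) V := by
  have h : SmoothCFieldOn (fun x => cmk (X x) (-J x (X x))) V :=
    hg.smoothCFieldOn_of_cre hD hiso hV hVU (fun x hx => (hJ x (hVU hx)).cmk_mem (X x))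
      (by simpa only [cre_cmk] using hX)
  simpa only [cim_cmk, neg_neg] using h.2.neg

theorem IsIntegrable.nijenhuis_eq_zero (hInt : IsIntegrable D U)
    (hJ : ∀ x ∈ U, IsComplexStructureOf (J x) (D x)) (hV : IsOpen V) (hVU : V ⊆ U)
    (hsmooth : ∀ X : Π x : M, TangentSpace (𝓡 n) x, SmoothFieldOn X V →
      SmoothFieldOn (fun x => J x (X x)) V) {X Y : Π x : M, TangentSpace (𝓡 n) x}
    (hX : SmoothFieldOn X V) (hY : SmoothFieldOn Y V) {x : M} (hx : x ∈ V) :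
    VectorField.mlieBracket (𝓡 n) (fun y => J y (X y)) (fun y => J y (Y y)) x
        - J x (VectorField.mlieBracket (𝓡 n) (fun y => J y (X y)) Y x)
        - J x (VectorField.mlieBracket (𝓡 n) X (fun y => J y (Y y)) x)
        - VectorField.mlieBracket (𝓡 n) X Y x = 0 := by
  have hmem := hInt V hV hVU (fun y => cmk (J y (X y)) (X y)) (fun y => cmk (J y (Y y)) (Y y))
    (smoothCFieldOn_cmk (hsmooth X hX) hX) (smoothCFieldOn_cmk (hsmooth Y hY) hY)
    (fun y hy => (hJ y (hVU hy)).cmk_mem' (X y)) (fun y hy => (hJ y (hVU hy)).cmk_mem' (Y y)) x hx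
  have h := (hJ x (hVU hx)).apply_cim hmem
  simp only [cbracket, cre_cmk, cim_cmk, map_add] at h
  rw [eq_comm, sub_eq_iff_eq_add] at h
  rw [h]
  abel

theorem PseudoRiemannianMetric.IsRiemannian.exists_isHermitianStructure (hg : g.IsRiemannian)
    {k : ℕ} (hk : 2 * k = n) (hD : IsSmoothDistribution D k U)
    (hiso : ∀ x ∈ U, ∀ A ∈ D x, ∀ B ∈ D x, g.cval x A B = 0) (hInt : IsIntegrable D U) :
    ∃ J : Π x : M, TangentSpace (𝓡 n) x →ₗ[ℝ] TangentSpace (𝓡 n) x,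
      IsHermitianStructure g J U ∧
      ∀ x ∈ U, D x = End.eigenspace ((J x).baseChange ℂ) Complex.I := by
  have hrank (x : M) (hx : x ∈ U) : finrank ℂ (D x) = k := by
    obtain ⟨V, -, hxV, -, Z, -, hZ⟩ := hD x hx
    rw [(hZ x hxV).2, finrank_span_eq_card (hZ x hxV).1, Fintype.card_fin]
  choose! J hJ using fun x (hx : x ∈ U) =>
    hg.exists_isComplexStructureOf (hiso x hx) ((hrank x hx).symm ▸ hk)
  have hsmooth : ∀ V : Set M, IsOpen V → V ⊆ U → ∀ X : Π x : M, TangentSpace (𝓡 n) x,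
      SmoothFieldOn X V → SmoothFieldOn (fun x => J x (X x)) V := fun V hV hVU X hX =>
    hg.smoothFieldOn_complexStructure hD hiso hJ hV hVU hX
  exact ⟨J, ⟨fun x hx => (hJ x hx).apply_apply, fun x hx => (hJ x hx).val_apply_apply (hiso x hx),
    hsmooth, fun V hV hVU X Y hX hY x hx =>
      hInt.nijenhuis_eq_zero hJ hV hVU (hsmooth V hV hVU) hX hY hx⟩,
    fun x hx => (hJ x hx).eq_eigenspace⟩

end HermitianStructures

theorem IsEigendistributionFamily.exists_isHermitianStructure {m : ℕ} {M : Type*}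
    [TopologicalSpace M] [ChartedSpace (EuclideanSpace ℝ (Fin (2 * m))) M]
    [IsManifold (𝓡 (2 * m)) ∞ M] {g : PseudoRiemannianMetric (2 * m) M}
    {φ : TwoForm (2 * m) M} {U : Set M}
    {D : (Fin m → Bool) → Π x : M, Submodule ℂ (ℂ ⊗[ℝ] TangentSpace (𝓡 (2 * m)) x)}
    (hD : IsEigendistributionFamily g φ U D) (hg : g.IsRiemannian)
    (hInt : ∀ s, IsIntegrable (D s) U) :
    ∃ J : (Fin m → Bool) →
        Π x : M, TangentSpace (𝓡 (2 * m)) x →ₗ[ℝ] TangentSpace (𝓡 (2 * m)) x,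
      (∀ s, IsHermitianStructure g (J s) U) ∧
      (∀ s, ∀ x ∈ U, D s x = End.eigenspace ((J s x).baseChange ℂ) Complex.I) ∧
      (∀ x ∈ U, Function.Injective fun s => J s x) := by
  choose J hJ heig using fun s => hg.exists_isHermitianStructure rfl (hD.1 s)
    (fun x hx A hA B hB => hD.isotropic s hx hA hB) (hInt s)
  refine ⟨J, hJ, heig, fun x hx s t hst => hD.injective hx ?_⟩
  simp only [heig _ x hx, show J s x = J t x from hst]

section RealEigenspaces

variable {n : ℕ} {M : Type*} [TopologicalSpace M] [ChartedSpace (EuclideanSpace ℝ (Fin n)) M]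
  [IsManifold (𝓡 n) ∞ M] {g : PseudoRiemannianMetric n M} {φ : TwoForm n M} {x : M} {ρ : ℝ}

/-- The real eigenspace, for the eigenvalue `ρ`, of the endomorphism of `T_x M` obtained from `φ` by
raising an index. -/
def realEigenspace (g : PseudoRiemannianMetric n M) (φ : TwoForm n M) (x : M) (ρ : ℝ) :
    Submodule ℝ (TangentSpace (𝓡 n) x) :=
  LinearMap.ker (φ.val x + ρ • g.val x).toLinearMap

theorem mem_realEigenspace {k : TangentSpace (𝓡 n) x} :
    k ∈ realEigenspace g φ x ρ ↔ ∀ a, φ.val x a k = ρ * g.val x a k := by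
  rw [realEigenspace, LinearMap.mem_ker, ContinuousLinearMap.coe_coe,
    ContinuousLinearMap.ext_iff]
  refine forall_congr' fun a => ?_
  have h : (φ.val x + ρ • g.val x) k a = ρ * g.val x a k - φ.val x a k := by
    rw [add_apply, add_apply, smul_apply, smul_apply, φ.skew x a k, g.symm x a k, smul_eq_mul]
    ring
  rw [h, zero_apply, sub_eq_zero, eq_comm]

theorem val_eq_zero_of_mem_realEigenspace (hρ : ρ ≠ 0) {k l : TangentSpace (𝓡 n) x}
    (hk : k ∈ realEigenspace g φ x ρ) (hl : l ∈ realEigenspace g φ x ρ) : g.val x k l = 0 := by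
  have h₁ := mem_realEigenspace.1 hk l
  have h₂ := mem_realEigenspace.1 hl k
  rw [φ.skew, g.symm] at h₁
  have h : ρ * g.val x k l = 0 := by linarith
  exact (mul_eq_zero.1 h).resolve_left hρ

theorem cre_mem_realEigenspace {l : ℂ ⊗[ℝ] TangentSpace (𝓡 n) x}
    (hl : ∀ A, φ.cval x A l = ρ * g.cval x A l) : cre l ∈ realEigenspace g φ x ρ :=
  mem_realEigenspace.2 fun a => by
    simpa [φ.cval_eq, g.cval_eq] using congrArg Complex.re (hl (1 ⊗ₜ a))

theorem cim_mem_realEigenspace {l : ℂ ⊗[ℝ] TangentSpace (𝓡 n) x}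
    (hl : ∀ A, φ.cval x A l = ρ * g.cval x A l) : cim l ∈ realEigenspace g φ x ρ :=
  mem_realEigenspace.2 fun a => by
    simpa [φ.cval_eq, g.cval_eq] using congrArg Complex.im (hl (1 ⊗ₜ a))

theorem exists_mem_realEigenspace_ne_zero
    (hρ : (ρ : ℂ) ∈ pencilEigenvalues (g.cval x) (φ.cval x)) :
    ∃ k ∈ realEigenspace g φ x ρ, k ≠ 0 := by
  obtain ⟨l, hl₀, hl⟩ := hρ
  by_contra! h
  refine hl₀ (ctensor_ext ?_ ?_)
  · rw [h _ (cre_mem_realEigenspace hl), map_zero]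
  · rw [h _ (cim_mem_realEigenspace hl), map_zero]

theorem eq_of_mem_realEigenspace {σ : ℝ} {k : TangentSpace (𝓡 n) x} (hk₀ : k ≠ 0)
    (hρ : k ∈ realEigenspace g φ x ρ) (hσ : k ∈ realEigenspace g φ x σ) : ρ = σ := by
  by_contra h
  refine hk₀ (g.nondegenerate x k fun a => ?_)
  have hρσ := (mem_realEigenspace.1 hρ a).symm.trans (mem_realEigenspace.1 hσ a)
  rw [g.symm]
  by_contra ha
  exact h (mul_right_cancel₀ ha hρσ)

theorem cval_self_eq_zero_iff {A : ℂ ⊗[ℝ] TangentSpace (𝓡 n) x} :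
    g.cval x A A = 0 ↔
      g.val x (cre A) (cre A) = g.val x (cim A) (cim A) ∧ g.val x (cre A) (cim A) = 0 := by
  rw [g.cval_eq, Complex.ext_iff, g.symm x (cim A) (cre A)]
  simp [sub_eq_zero]

end RealEigenspaces

section LorentzianPoint

variable {n : ℕ} {M : Type*} [TopologicalSpace M] [ChartedSpace (EuclideanSpace ℝ (Fin n)) M]
  [IsManifold (𝓡 n) ∞ M] {g : PseudoRiemannianMetric n M} {φ : TwoForm n M} {x : M}

-- A vector `t` as in the definition of `IsLorentzian` pairs nontrivially with `l`, and a suitable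
-- combination of `k` and `l` is a null vector orthogonal to `t`, hence zero.
theorem PseudoRiemannianMetric.IsLorentzian.exists_eq_smul (hg : g.IsLorentzian)
    {k l : TangentSpace (𝓡 n) x} (hk : g.val x k k = 0) (hl : g.val x l l = 0)
    (hkl : g.val x k l = 0) (hl₀ : l ≠ 0) : ∃ c : ℝ, k = c • l := by
  obtain ⟨t, -, ht⟩ := hg x
  have htl : g.val x t l ≠ 0 := fun h => by simpa [hl] using ht l hl₀ h
  have hlk : g.val x l k = 0 := by rw [g.symm, hkl]
  have h₀ : g.val x t l • k - g.val x t k • l = 0 := by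
    by_contra hne
    simpa [hk, hl, hkl, hlk] using ht _ hne (by simp [mul_comm])
  exact ⟨(g.val x t l)⁻¹ * g.val x t k, by
    rw [mul_smul, ← sub_eq_zero.1 h₀, smul_smul, inv_mul_cancel₀ htl, one_smul]⟩

theorem PseudoRiemannianMetric.IsLorentzian.eq_span_singleton (hg : g.IsLorentzian)
    {k : TangentSpace (𝓡 n) x} {N : Submodule ℝ (TangentSpace (𝓡 n) x)}
    (hN : ∀ a ∈ N, ∀ b ∈ N, g.val x a b = 0) (hk : k ∈ N) (hk₀ : k ≠ 0) :
    N = Submodule.span ℝ {k} := by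
  refine le_antisymm (fun l hl => ?_) ((Submodule.span_singleton_le_iff_mem k N).2 hk)
  obtain ⟨c, rfl⟩ := hg.exists_eq_smul (hN l hl l hl) (hN k hk k hk) (hN l hl k hk) hk₀
  exact Submodule.smul_mem _ c (Submodule.mem_span_singleton_self k)

theorem PseudoRiemannianMetric.IsLorentzian.realEigenspace_eq_span (hg : g.IsLorentzian) {ρ : ℝ}
    (hρ : ρ ≠ 0) {k : TangentSpace (𝓡 n) x} (hk : k ∈ realEigenspace g φ x ρ) (hk₀ : k ≠ 0) :
    realEigenspace g φ x ρ = Submodule.span ℝ {k} :=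
  hg.eq_span_singleton (fun _ ha _ hb => val_eq_zero_of_mem_realEigenspace hρ ha hb) hk hk₀

theorem PseudoRiemannianMetric.IsLorentzian.exists_eq_smul_one_tmul (hg : g.IsLorentzian)
    {l : ℂ ⊗[ℝ] TangentSpace (𝓡 n) x} (hl₀ : l ≠ 0) (hl : g.cval x l l = 0)
    (hlc : g.cval x l (cconj l) = 0) :
    ∃ (c : ℂ) (k : TangentSpace (𝓡 n) x), c ≠ 0 ∧ k ≠ 0 ∧ l = c • (1 ⊗ₜ[ℝ] k) := by
  obtain ⟨heq, hab⟩ := cval_self_eq_zero_iff.1 hl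
  rw [cval_cconj_self, Complex.ofReal_eq_zero] at hlc
  have ha : g.val x (cre l) (cre l) = 0 := by linarith
  have hb : g.val x (cim l) (cim l) = 0 := by linarith
  by_cases h₀ : cre l = 0
  · exact ⟨Complex.I, cim l, Complex.I_ne_zero,
      fun h => hl₀ (ctensor_ext (by rw [h₀, map_zero]) (by rw [h, map_zero])),
      ctensor_ext (by simp [h₀]) (by simp)⟩
  · obtain ⟨c, hc⟩ := hg.exists_eq_smul hb ha (by rw [g.symm, hab]) h₀
    exact ⟨⟨1, c⟩, cre l, fun h => by simpa using congrArg Complex.re h, h₀,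
      ctensor_ext (by simp) (by simpa using hc)⟩

theorem PseudoRiemannianMetric.IsLorentzian.exists_mem_realEigenspace (hg : g.IsLorentzian)
    {l : ℂ ⊗[ℝ] TangentSpace (𝓡 n) x} (hl₀ : l ≠ 0) {z : ℂ}
    (hl : ∀ A, φ.cval x A l = z * g.cval x A l) (hz : z.re ≠ 0) :
    z = z.re ∧ ∃ (c : ℂ), ∃ k ∈ realEigenspace g φ x z.re,
      c ≠ 0 ∧ k ≠ 0 ∧ l = c • (1 ⊗ₜ[ℝ] k) := by
  have hlc := cval_cconj_eq_mul hl
  obtain ⟨c, k, hc, hk₀, rfl⟩ := hg.exists_eq_smul_one_tmul hl₀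
    (apply_eq_zero_of_add_ne_zero (g.cval_isSymm x) (φ.cval_skew x) hl hl
      fun h => hz (by simpa using congrArg Complex.re h))
    (apply_eq_zero_of_add_ne_zero (g.cval_isSymm x) (φ.cval_skew x) hl hlc
      fun h => hz (by simpa using congrArg Complex.re h))
  have hk : ∀ a, (φ.val x a k : ℂ) = z * g.val x a k := fun a => by
    have h := hl (1 ⊗ₜ a)
    rw [map_smul, map_smul, g.cval_tmul, φ.cval_eq, smul_eq_mul, smul_eq_mul] at h
    exact mul_left_cancel₀ hc (by rw [mul_left_comm, ← h]; simp [Complex.ext_iff])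
  obtain ⟨a, ha⟩ : ∃ a, g.val x a k ≠ 0 := by
    by_contra! h
    exact hk₀ (g.nondegenerate x k fun a => by rw [g.symm, h])
  have hzre : z = z.re := Complex.ext rfl (by simpa [ha] using (congrArg Complex.im (hk a)).symm)
  exact ⟨hzre, c, k,
    mem_realEigenspace.2 fun a => by simpa using congrArg Complex.re (hk a), hc, hk₀, rfl⟩

theorem PseudoRiemannianMetric.IsLorentzian.eq_re_of_mem_pencilEigenvalues (hg : g.IsLorentzian)
    {z : ℂ} (hz : z ∈ pencilEigenvalues (g.cval x) (φ.cval x)) (hre : z.re ≠ 0) : z = z.re := by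
  obtain ⟨l, hl₀, hl⟩ := hz
  exact (hg.exists_mem_realEigenspace hl₀ hl hre).1

-- Eigenvectors for `z` and `y` are real, null and orthogonal, hence proportional.
theorem PseudoRiemannianMetric.IsLorentzian.eq_of_mul_pos (hg : g.IsLorentzian) {ρ : ℝ} {z : ℂ}
    (hρ : (ρ : ℂ) ∈ pencilEigenvalues (g.cval x) (φ.cval x))
    (hz : z ∈ pencilEigenvalues (g.cval x) (φ.cval x)) (hpos : 0 < z.re * ρ) : z = ρ := by
  have hz' : z = z.re := hg.eq_re_of_mem_pencilEigenvalues hz (left_ne_zero_of_mul hpos.ne')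
  obtain ⟨k, hk, hk₀⟩ := exists_mem_realEigenspace_ne_zero hρ
  obtain ⟨l, hl, hl₀⟩ := exists_mem_realEigenspace_ne_zero (hz' ▸ hz)
  have hlk : g.val x l k = 0 := by
    have h₁ := mem_realEigenspace.1 hk l
    have h₂ := mem_realEigenspace.1 hl k
    rw [φ.skew, g.symm] at h₂
    have h : (z.re + ρ) * g.val x l k = 0 := by linarith
    refine (mul_eq_zero.1 h).resolve_left fun h₀ => ?_
    rw [eq_neg_of_add_eq_zero_left h₀] at hpos
    nlinarith [sq_nonneg ρ]
  obtain ⟨c, rfl⟩ := hg.exists_eq_smul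
    (val_eq_zero_of_mem_realEigenspace (left_ne_zero_of_mul hpos.ne') hl hl)
    (val_eq_zero_of_mem_realEigenspace (right_ne_zero_of_mul hpos.ne') hk hk) hlk hk₀
  rw [hz', eq_of_mem_realEigenspace hl₀ hl (Submodule.smul_mem _ c hk)]

-- The combination of `a` and `b` orthogonal to `t` has a norm of the same sign as `a` and `b`.
theorem val_mul_val_neg_of_conformal {t a b : TangentSpace (𝓡 n) x}
    (ht : ∀ v, v ≠ 0 → g.val x t v = 0 → g.val x t t * g.val x v v < 0)
    (hab : g.val x a b = 0) (heq : g.val x a a = g.val x b b) (ha : g.val x a a ≠ 0) :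
    g.val x t t * g.val x a a < 0 := by
  set α := g.val x t a
  set β := g.val x t b
  have hba : g.val x b a = 0 := by rw [g.symm, hab]
  have hnorm : g.val x (β • a - α • b) (β • a - α • b) = (β ^ 2 + α ^ 2) * g.val x a a := by
    simp only [map_sub, map_smul, sub_apply, smul_apply, smul_eq_mul, hab, hba, ← heq]
    ring
  by_cases h₀ : β • a - α • b = 0
  · have hsum : β ^ 2 + α ^ 2 = 0 :=
      (mul_eq_zero.1 (hnorm.symm.trans (by simp [h₀]))).resolve_right ha
    have hα : α = 0 := by nlinarith [sq_nonneg α, sq_nonneg β]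
    exact ht a (fun h => ha (by simp [h])) hα
  · have hneg := ht _ h₀ (by simp [α, β, mul_comm])
    rw [hnorm, mul_left_comm] at hneg
    exact (pos_iff_neg_of_mul_neg hneg).1
      ((by positivity : 0 ≤ β ^ 2 + α ^ 2).lt_of_ne' (left_ne_zero_of_mul hneg.ne))

theorem val_mul_neg_of_null {t : TangentSpace (𝓡 n) x}
    (ht : ∀ v, v ≠ 0 → g.val x t v = 0 → g.val x t t * g.val x v v < 0)
    {l : ℂ ⊗[ℝ] TangentSpace (𝓡 n) x} (hl : g.cval x l l = 0) {r : ℝ} (hr₀ : r ≠ 0)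
    (hr : g.cval x l (cconj l) = r) : g.val x t t * r < 0 := by
  obtain ⟨heq, hab⟩ := cval_self_eq_zero_iff.1 hl
  rw [cval_cconj_self, Complex.ofReal_inj, ← heq] at hr
  have ha : g.val x (cre l) (cre l) ≠ 0 := fun h => hr₀ (by rw [← hr, h, add_zero])
  have := val_mul_val_neg_of_conformal ht hab heq ha
  rw [← hr, mul_add]
  linarith

end LorentzianPoint

section LorentzianEigenbasis

variable {m : ℕ} {M : Type*} [TopologicalSpace M]
  [ChartedSpace (EuclideanSpace ℝ (Fin (2 * m))) M] [IsManifold (𝓡 (2 * m)) ∞ M]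
  {g : PseudoRiemannianMetric (2 * m) M} {φ : TwoForm (2 * m) M} {x : M}
  {v w : Fin m → ℂ ⊗[ℝ] TangentSpace (𝓡 (2 * m)) x} {lam : Fin m → ℂ}

theorem PseudoRiemannianMetric.IsLorentzian.isOrderable (hg : g.IsLorentzian)
    (hs : HasSimpleSpectrum (g.cval x) (φ.cval x)) :
    IsOrderable (pencilEigenvalues (g.cval x) (φ.cval x)) := by
  have hreal : ∀ z ∈ pencilEigenvalues (g.cval x) (φ.cval x), z.re = 0 ∨ z.im = 0 := fun z hz =>
    or_iff_not_imp_left.2 fun hre => by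
      rw [hg.eq_re_of_mem_pencilEigenvalues hz hre, Complex.ofReal_im]
  refine ⟨fun z hz h₀ => ?_, fun z ⟨hz, hz₀⟩ y ⟨hy, hy₀⟩ hzy => ?_⟩
  · obtain ⟨v, w, lam, h⟩ := exists_isPencilBasis_complex (g.cval_nondegenerate x)
      (g.cval_isSymm x) (φ.cval_skew x) hs (finrank_complexified_tangentSpace x)
    have hz0 : z = 0 := by
      rcases hreal z hz with h | h <;> exact Complex.ext (by simp_all) (by simp_all)
    exact h.zero_notMem_pencilEigenvalues hs (hz0 ▸ hz)
  · simp only at hzy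
    rcases hreal z hz with h | h <;> rcases hreal y hy with h' | h' <;>
      exact Complex.ext (by linarith) (by linarith)

theorem IsPencilBasis.exists_cconj_w_eq_smul (h : IsPencilBasis (g.cval x) (φ.cval x) v w lam)
    (hs : HasSimpleSpectrum (g.cval x) (φ.cval x)) {μ : Fin m} (hre : (lam μ).re = 0) :
    ∃ r : ℝ, r ≠ 0 ∧ g.cval x (w μ) (cconj (w μ)) = r ∧ cconj (w μ) = (r : ℂ) • v μ := by
  have hw : cconj (w μ) = g.cval x (cconj (w μ)) (w μ) • v μ := h.eq_smul_v hs fun A => by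
    rw [cval_cconj_eq_mul fun A => h.Ω_apply_w A μ]
    congr 1
    exact Complex.ext (by simp [hre]) (by simp)
  rw [g.cval_symm, cval_cconj_self] at hw
  refine ⟨_, fun hr => h.linearIndependent.ne_zero (Sum.inr μ) ?_, cval_cconj_self g _, hw⟩
  rw [hr, Complex.ofReal_zero, zero_smul] at hw
  rw [Sum.elim_inr, ← cconj_cconj (w μ), hw, map_zero]

theorem IsPencilBasis.val_self_eq_sum (h : IsPencilBasis (g.cval x) (φ.cval x) v w lam)
    {r : Fin m → ℝ} (hr₀ : ∀ μ, r μ ≠ 0) (hr : ∀ μ, cconj (w μ) = (r μ : ℂ) • v μ)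
    (t : TangentSpace (𝓡 (2 * m)) x) :
    g.val x t t = 2 * ∑ μ, Complex.normSq (g.cval x (1 ⊗ₜ[ℝ] t) (w μ)) / r μ := by
  have hvw : ∀ μ, g.cval x (1 ⊗ₜ[ℝ] t) (w μ) * g.cval x (1 ⊗ₜ[ℝ] t) (v μ)
      = ((Complex.normSq (g.cval x (1 ⊗ₜ[ℝ] t) (w μ)) / r μ : ℝ) : ℂ) := fun μ => by
    have hconj : (r μ : ℂ) * g.cval x (1 ⊗ₜ[ℝ] t) (v μ)
        = (starRingEnd ℂ) (g.cval x (1 ⊗ₜ[ℝ] t) (w μ)) := by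
      rw [← g.cval_cconj, cconj_one_tmul, hr, map_smul, smul_eq_mul]
    rw [Complex.ofReal_div, eq_div_iff (Complex.ofReal_ne_zero.2 (hr₀ μ)), ← Complex.mul_conj,
      ← hconj]
    ring
  have hexp := congrArg (g.cval x (1 ⊗ₜ[ℝ] t)) (h.eq_sum (1 ⊗ₜ[ℝ] t))
  simp only [map_add, map_sum, map_smul, smul_eq_mul, g.cval_tmul,
    mul_comm (g.cval x (1 ⊗ₜ[ℝ] t) (v _)), hvw, ← Complex.ofReal_sum,
    ← Complex.ofReal_add, Complex.ofReal_inj] at hexp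
  exact hexp.trans (two_mul _).symm

-- If all eigenvalues were imaginary, `V_μ` would be proportional to the conjugate of `V^μ`, and the
-- planes spanned by their real and imaginary parts would all have the sign opposite to `t`.
theorem PseudoRiemannianMetric.IsLorentzian.exists_re_ne_zero (hg : g.IsLorentzian)
    (hs : HasSimpleSpectrum (g.cval x) (φ.cval x))
    (h : IsPencilBasis (g.cval x) (φ.cval x) v w lam) : ∃ μ, (lam μ).re ≠ 0 := by
  by_contra! hre
  obtain ⟨t, ht₀, ht⟩ := hg x
  choose r hr₀ hr hconj using fun μ => h.exists_cconj_w_eq_smul hs (hre μ)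
  have hterm : ∀ μ, g.val x t t * (Complex.normSq (g.cval x (1 ⊗ₜ[ℝ] t) (w μ)) / r μ) ≤ 0 :=
    fun μ => by
      have hsign : g.val x t t * r μ < 0 := val_mul_neg_of_null ht (h.ww μ μ) (hr₀ μ) (hr μ)
      rw [← mul_div_mul_right _ _ (hr₀ μ), ← mul_div_assoc, mul_left_comm]
      exact div_nonpos_of_nonpos_of_nonneg
        (mul_nonpos_of_nonneg_of_nonpos (Complex.normSq_nonneg _) hsign.le) (mul_self_nonneg _)
  have hpos : 0 < g.val x t t * g.val x t t := mul_self_pos.2 ht₀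
  have hsum := Finset.sum_nonpos fun μ (_ : μ ∈ Finset.univ) => hterm μ
  rw [← Finset.mul_sum] at hsum
  nth_rw 2 [h.val_self_eq_sum hr₀ hconj t] at hpos
  linarith

theorem PseudoRiemannianMetric.IsLorentzian.exists_pos_mem_pencilEigenvalues (hg : g.IsLorentzian)
    (hs : HasSimpleSpectrum (g.cval x) (φ.cval x)) :
    ∃ r : ℝ, 0 < r ∧ (r : ℂ) ∈ pencilEigenvalues (g.cval x) (φ.cval x) := by
  obtain ⟨v, w, lam, h⟩ := exists_isPencilBasis_complex (g.cval_nondegenerate x)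
    (g.cval_isSymm x) (φ.cval_skew x) hs (finrank_complexified_tangentSpace x)
  obtain ⟨μ, hμ⟩ := hg.exists_re_ne_zero hs h
  rcases lt_or_gt_of_ne hμ with hneg | hpos
  · have hmem : -lam μ ∈ pencilEigenvalues (g.cval x) (φ.cval x) := h.swap.lam_mem μ
    refine ⟨(-lam μ).re, by simpa using hneg, ?_⟩
    rwa [← hg.eq_re_of_mem_pencilEigenvalues hmem (by simpa using hμ)]
  · exact ⟨_, hpos, hg.eq_re_of_mem_pencilEigenvalues (h.lam_mem μ) hμ ▸ h.lam_mem μ⟩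

theorem PseudoRiemannianMetric.IsLorentzian.realPoints_eq_realEigenspace_iff (hg : g.IsLorentzian)
    {ρ : ℝ} (hρ : ρ ≠ 0) {k : TangentSpace (𝓡 (2 * m)) x} (hk : k ∈ realEigenspace g φ x ρ)
    (hk₀ : k ≠ 0) {D : Submodule ℂ (ℂ ⊗[ℝ] TangentSpace (𝓡 (2 * m)) x)}
    (hD : ∀ A ∈ D, ∀ B ∈ D, g.cval x A B = 0) :
    realPoints D = realEigenspace g φ x ρ ↔ (1 : ℂ) ⊗ₜ[ℝ] k ∈ D := by
  refine ⟨fun h => (h.symm ▸ hk : k ∈ realPoints D), fun h => ?_⟩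
  rw [hg.realEigenspace_eq_span hρ hk hk₀]
  refine hg.eq_span_singleton (fun a ha b hb => ?_) h hk₀
  simpa [g.cval_tmul] using hD _ ha _ hb

theorem PseudoRiemannianMetric.IsLorentzian.realPoints_span_select_eq_iff (hg : g.IsLorentzian)
    (h : IsPencilBasis (g.cval x) (φ.cval x) v w lam) {μ : Fin m} {ρ : ℝ} (hρ : ρ ≠ 0)
    (hμ : lam μ = ρ) (s : Fin m → Bool) :
    realPoints (Submodule.span ℂ (range (select v w s))) = realEigenspace g φ x ρ ↔
      s μ = false := by
  have hw := fun A => h.Ω_apply_w A μ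
  rw [hμ] at hw
  obtain ⟨-, c, k, hk, hc, hk₀, hwk⟩ := hg.exists_mem_realEigenspace
    (h.linearIndependent.ne_zero (Sum.inr μ)) hw (by simpa using hρ)
  rw [Sum.elim_inr] at hwk
  rw [← h.w_mem_span_select_iff s μ, hg.realPoints_eq_realEigenspace_iff hρ hk hk₀
    fun A hA B hB => h.isotropic s hA hB, hwk, Submodule.smul_mem_iff _ hc]

theorem PseudoRiemannianMetric.IsLorentzian.realPoints_span_select_eq_neg_iff
    (hg : g.IsLorentzian) (h : IsPencilBasis (g.cval x) (φ.cval x) v w lam) {μ : Fin m} {ρ : ℝ}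
    (hρ : ρ ≠ 0) (hμ : lam μ = ρ) (s : Fin m → Bool) :
    realPoints (Submodule.span ℂ (range (select v w s))) = realEigenspace g φ x (-ρ) ↔
      s μ = true := by
  rw [← select_swap v w s, hg.realPoints_span_select_eq_iff h.swap (μ := μ)
    (neg_ne_zero.2 hρ) (by simp [hμ])]
  simp

end LorentzianEigenbasis

section RealCovariantDerivative

variable {n : ℕ} {M : Type*} [TopologicalSpace M] [ChartedSpace (EuclideanSpace ℝ (Fin n)) M]
  [IsManifold (𝓡 n) ∞ M] (g : PseudoRiemannianMetric n M) {X Y : Π x : M, TangentSpace (𝓡 n) x}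
  {x : M}

theorem diffFieldAt_zero : DiffFieldAt (fun _ => 0 : Π x : M, TangentSpace (𝓡 n) x) x :=
  smoothFieldOn_zero.diffFieldAt isOpen_univ (mem_univ x)

theorem leviCivita_zero_right (hX : DiffFieldAt X x) : leviCivita g X (fun _ => 0) x = 0 := by
  refine (leviCivita_unique g hX diffFieldAt_zero 0 fun _ _ => ?_).symm
  have hzero : (fun _ => 0 : Π x : M, TangentSpace (𝓡 n) x) = 0 := rfl
  simp [koszul, hzero, dirDeriv, VectorField.mlieBracket_zero_right,
    VectorField.mlieBracket_zero_left, mvfderiv_const]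

theorem leviCivita_zero_left (hX : DiffFieldAt X x) : leviCivita g (fun _ => 0) X x = 0 := by
  have hbracket := mlieBracket_eq_leviCivita_sub g diffFieldAt_zero hX
  have hzero : (fun _ => 0 : Π x : M, TangentSpace (𝓡 n) x) = 0 := rfl
  rw [leviCivita_zero_right g hX, sub_zero, hzero, VectorField.mlieBracket_zero_left] at hbracket
  exact hbracket.symm

theorem cnabla_one_tmul (hX : DiffFieldAt X x) (hY : DiffFieldAt Y x) :
    cnabla g (fun y => 1 ⊗ₜ X y) (fun y => 1 ⊗ₜ Y y) x = 1 ⊗ₜ leviCivita g X Y x := by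
  simp only [cnabla, cre_tmul, cim_tmul, Complex.one_re, Complex.one_im, one_smul, zero_smul,
    leviCivita_zero_right g hX, leviCivita_zero_left g hY,
    leviCivita_zero_right g diffFieldAt_zero]
  apply ctensor_ext <;> simp

theorem DiffFieldAt.eventually_ne_zero (hX : DiffFieldAt X x) (hX₀ : X x ≠ 0) :
    ∀ᶠ y in 𝓝 x, X y ≠ 0 := by
  let e := trivializationAt (EuclideanSpace ℝ (Fin n)) (TangentSpace (𝓡 n) : M → Type _) x
  have hzero {y : M} (hy : y ∈ e.baseSet) : (e ⟨y, X y⟩).2 = 0 ↔ X y = 0 :=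
    (e.continuousLinearEquivAt ℝ y hy).map_eq_zero_iff
  have hcont : ContinuousAt (fun y => (e ⟨y, X y⟩).2) x :=
    ((mdifferentiableAt_section _ _).1 hX).continuousAt
  have hx : x ∈ e.baseSet := FiberBundle.mem_baseSet_trivializationAt' x
  filter_upwards [hcont.eventually_ne ((hzero hx).not.2 hX₀), e.open_baseSet.mem_nhds hx]
    with y hy hyb
  exact (hzero hyb).not.1 hy

end RealCovariantDerivative

section RealEigenfunctions

variable {n : ℕ} {M : Type*} [TopologicalSpace M] [ChartedSpace (EuclideanSpace ℝ (Fin n)) M]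
  [IsManifold (𝓡 n) ∞ M] {g : PseudoRiemannianMetric n M} {φ : TwoForm n M} {ρ : M → ℝ}

/-- A real eigenvalue function of `φ` that is everywhere positive or everywhere negative. In
Lorentzian signature there is exactly one of each sign. No continuity is assumed. -/
structure IsRealEigenfunction (g : PseudoRiemannianMetric n M) (φ : TwoForm n M)
    (ρ : M → ℝ) : Prop where
  mem : ∀ x, (ρ x : ℂ) ∈ pencilEigenvalues (g.cval x) (φ.cval x)
  mul_pos : ∀ x y, 0 < ρ x * ρ y

namespace IsRealEigenfunction

theorem ne_zero (hρ : IsRealEigenfunction g φ ρ) (x : M) : ρ x ≠ 0 :=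
  left_ne_zero_of_mul (hρ.mul_pos x x).ne'

theorem neg (hρ : IsRealEigenfunction g φ ρ)
    (hs : ∀ x, HasSimpleSpectrum (g.cval x) (φ.cval x)) : IsRealEigenfunction g φ (-ρ) where
  mem x := by
    simpa using neg_mem_pencilEigenvalues (g.cval_nondegenerate x) (g.cval_isSymm x)
      (φ.cval_skew x) (hs x) (hρ.mem x)
  mul_pos x y := by simpa using hρ.mul_pos x y

theorem cond (hρ : IsRealEigenfunction g φ ρ)
    (hs : ∀ x, HasSimpleSpectrum (g.cval x) (φ.cval x)) (b : Bool) :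
    IsRealEigenfunction g φ (bif b then ρ else -ρ) := by
  cases b
  exacts [hρ.neg hs, hρ]

theorem realEigenspace_ne_neg (hρ : IsRealEigenfunction g φ ρ) (x : M) :
    realEigenspace g φ x (ρ x) ≠ realEigenspace g φ x (-ρ x) := fun h => by
  obtain ⟨k, hk, hk₀⟩ := exists_mem_realEigenspace_ne_zero (hρ.mem x)
  exact hρ.ne_zero x (self_eq_neg.1 (eq_of_mem_realEigenspace hk₀ hk (h ▸ hk)))

end IsRealEigenfunction

theorem IsSmoothEigenpairOn.const_smul {U : Set M} {Z : Π x : M, ℂ ⊗[ℝ] TangentSpace (𝓡 n) x}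
    {Λ : M → ℂ} (h : IsSmoothEigenpairOn g φ Z Λ U) (c : ℂ) :
    IsSmoothEigenpairOn g φ (fun x => c • Z x) Λ U :=
  ⟨h.smooth_field.const_smul c, h.smooth_value, fun x hx A => by
    rw [map_smul, map_smul, h.apply_eq x hx, smul_eq_mul, smul_eq_mul, mul_left_comm]⟩

theorem IsSmoothEigenpairOn.eventually_cre_ne_zero_and_eq {U : Set M}
    {Z : Π x : M, ℂ ⊗[ℝ] TangentSpace (𝓡 n) x} {Λ : M → ℂ} (h : IsSmoothEigenpairOn g φ Z Λ U)
    (hU : IsOpen U) {p : M} (hp : p ∈ U) (hg : g.IsLorentzian) (hρ : IsRealEigenfunction g φ ρ)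
    (hZ : cre (Z p) ≠ 0) (hΛ : Λ p = ρ p) : ∀ᶠ x in 𝓝 p, cre (Z x) ≠ 0 ∧ Λ x = ρ x := by
  have hcont : ContinuousAt (fun x => (Λ x).re * ρ p) p :=
    (Complex.continuous_re.continuousAt.comp
      (h.smooth_value.continuousOn.continuousAt (hU.mem_nhds hp))).mul continuousAt_const
  have hpos : ∀ᶠ x in 𝓝 p, 0 < (Λ x).re * ρ p :=
    hcont.eventually_const_lt (by simpa [hΛ] using hρ.mul_pos p p)
  filter_upwards [hpos, (h.smooth_field.1.diffFieldAt hU hp).eventually_ne_zero hZ,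
    hU.mem_nhds hp] with x hx hx₀ hxU
  refine ⟨hx₀, hg.eq_of_mul_pos (hρ.mem x) ⟨Z x, fun h₀ => hx₀ (by simp [h₀]), h.apply_eq x hxU⟩ ?_⟩
  have hsq : 0 < (Λ x).re * ρ x * (ρ p * ρ p) := by
    linear_combination mul_pos hx (hρ.mul_pos p x)
  exact pos_of_mul_pos_left hsq (mul_self_nonneg _)

end RealEigenfunctions

theorem ncard_setOf_apply_eq {ι κ : Type*} [Fintype ι] [Fintype κ] (i : ι) (c : κ) :
    {s : ι → κ | s i = c}.ncard = Fintype.card κ ^ (Fintype.card ι - 1) := by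
  classical
  have h := Fintype.card_filter_piFinset_const_eq_of_mem (Finset.univ : Finset κ) i
    (Finset.mem_univ c)
  rw [← ncard_coe_finset] at h
  simpa using h

section PrincipalLines

variable {m : ℕ} {M : Type*} [TopologicalSpace M]
  [ChartedSpace (EuclideanSpace ℝ (Fin (2 * m))) M] [IsManifold (𝓡 (2 * m)) ∞ M]
  {g : PseudoRiemannianMetric (2 * m) M} {φ : TwoForm (2 * m) M} {ρ : M → ℝ} {x : M}

theorem PseudoRiemannianMetric.IsLorentzian.exists_pos_isRealEigenfunction (hg : g.IsLorentzian)
    (hs : ∀ x, HasSimpleSpectrum (g.cval x) (φ.cval x)) :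
    ∃ r : M → ℝ, IsRealEigenfunction g φ r ∧ ∀ x, 0 < r x := by
  choose r hpos hr using fun x => hg.exists_pos_mem_pencilEigenvalues (hs x)
  exact ⟨r, ⟨hr, fun x y => mul_pos (hpos x) (hpos y)⟩, hpos⟩

theorem exists_isPencilBasis_lam_eq (hs : HasSimpleSpectrum (g.cval x) (φ.cval x)) {z : ℂ}
    (hz : z ∈ pencilEigenvalues (g.cval x) (φ.cval x)) :
    ∃ (v w : Fin m → ℂ ⊗[ℝ] TangentSpace (𝓡 (2 * m)) x) (lam : Fin m → ℂ) (μ : Fin m),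
      IsPencilBasis (g.cval x) (φ.cval x) v w lam ∧ lam μ = z := by
  obtain ⟨v, w, lam, h⟩ := exists_isPencilBasis_complex (g.cval_nondegenerate x)
    (g.cval_isSymm x) (φ.cval_skew x) hs (finrank_complexified_tangentSpace x)
  rw [h.pencilEigenvalues_eq] at hz
  obtain ⟨μ | μ, hμ⟩ := hz
  · exact ⟨v, w, lam, μ, h, hμ⟩
  · exact ⟨w, v, -lam, μ, h.swap, hμ⟩

theorem PseudoRiemannianMetric.IsLorentzian.exists_isSmoothEigenpairOn_cre_ne_zero
    (hg : g.IsLorentzian) (hs : HasSimpleSpectrum (g.cval x) (φ.cval x)) {r : ℝ} (hr₀ : r ≠ 0)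
    (hr : (r : ℂ) ∈ pencilEigenvalues (g.cval x) (φ.cval x)) :
    ∃ (U : Set M) (Z : Π x : M, ℂ ⊗[ℝ] TangentSpace (𝓡 (2 * m)) x) (Λ : M → ℂ), IsOpen U ∧
      x ∈ U ∧ IsSmoothEigenpairOn g φ Z Λ U ∧ cre (Z x) ≠ 0 ∧ Λ x = r := by
  obtain ⟨v, w, lam, μ, h, hμ⟩ := exists_isPencilBasis_lam_eq hs hr
  obtain ⟨U, Z, Λ, hU, hx, hZ, hZx, hΛx⟩ := h.exists_isSmoothEigenpairOn hs μ
  obtain ⟨-, c, k, -, hc, hk₀, hwk⟩ := hg.exists_mem_realEigenspace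
    (h.linearIndependent.ne_zero (Sum.inr μ)) (fun A => h.Ω_apply_w A μ)
    (by simpa [hμ] using hr₀)
  refine ⟨U, _, Λ, hU, hx, hZ.const_smul c⁻¹, ?_, hΛx.trans hμ⟩
  rw [Sum.elim_inr] at hwk
  simpa [hZx, hwk, smul_smul, inv_mul_cancel₀ hc] using hk₀

theorem IsRealEigenfunction.exists_smoothFieldOn (hρ : IsRealEigenfunction g φ ρ)
    (hg : g.IsLorentzian) (hs : HasSimpleSpectrum (g.cval x) (φ.cval x)) :
    ∃ V : Set M, IsOpen V ∧ x ∈ V ∧ ∃ k : Π y : M, TangentSpace (𝓡 (2 * m)) y,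
      SmoothFieldOn k V ∧
        ∀ y ∈ V, k y ≠ 0 ∧ realEigenspace g φ y (ρ y) = Submodule.span ℝ {k y} := by
  obtain ⟨U, Z, Λ, hU, hx, hZ, hZx, hΛx⟩ :=
    hg.exists_isSmoothEigenpairOn_cre_ne_zero hs (hρ.ne_zero x) (hρ.mem x)
  obtain ⟨V, hV, hVo, hxV⟩ := eventually_nhds_iff.1
    ((hZ.eventually_cre_ne_zero_and_eq hU hx hg hρ hZx hΛx).and (hU.mem_nhds hx))
  refine ⟨V, hVo, hxV, _, hZ.smooth_field.1.mono fun y hy => (hV y hy).2, fun y hy => ?_⟩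
  obtain ⟨⟨hy₀, hΛy⟩, hyU⟩ := hV y hy
  exact ⟨hy₀, hg.realEigenspace_eq_span (hρ.ne_zero y)
    (cre_mem_realEigenspace (hΛy ▸ hZ.apply_eq y hyU)) hy₀⟩

namespace IsEigendistributionFamily

variable {U V : Set M}
  {D : (Fin m → Bool) → Π x : M, Submodule ℂ (ℂ ⊗[ℝ] TangentSpace (𝓡 (2 * m)) x)}

theorem exists_realPoints_iff (hD : IsEigendistributionFamily g φ U D) (hx : x ∈ U)
    (hg : g.IsLorentzian) {r : ℝ} (hr₀ : r ≠ 0)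
    (hr : (r : ℂ) ∈ pencilEigenvalues (g.cval x) (φ.cval x)) :
    ∃ (μ : Fin m) (c : Bool), ∀ s, (realPoints (D s x) = realEigenspace g φ x r ↔ s μ = c) ∧
      (realPoints (D s x) = realEigenspace g φ x (-r) ↔ s μ = !c) := by
  obtain ⟨v, w, lam, h, hspan⟩ := hD.exists_isPencilBasis hx
  rw [h.pencilEigenvalues_eq] at hr
  simp only [hspan]
  obtain ⟨μ | μ, hμ⟩ := hr
  · exact ⟨μ, false, fun s => ⟨hg.realPoints_span_select_eq_iff h hr₀ hμ s,
      hg.realPoints_span_select_eq_neg_iff h hr₀ hμ s⟩⟩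
  · have hμ' : lam μ = (-r : ℝ) := by simp [← hμ]
    refine ⟨μ, true, fun s => ⟨?_, hg.realPoints_span_select_eq_iff h (neg_ne_zero.2 hr₀) hμ' s⟩⟩
    simpa using hg.realPoints_span_select_eq_neg_iff h (neg_ne_zero.2 hr₀) hμ' s

theorem ncard_realPoints_eq (hD : IsEigendistributionFamily g φ U D) (hx : x ∈ U)
    (hg : g.IsLorentzian) {r : ℝ} (hr₀ : r ≠ 0)
    (hr : (r : ℂ) ∈ pencilEigenvalues (g.cval x) (φ.cval x)) :
    {s | realPoints (D s x) = realEigenspace g φ x r}.ncard = 2 ^ (m - 1) := by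
  obtain ⟨μ, c, h⟩ := hD.exists_realPoints_iff hx hg hr₀ hr
  simp only [fun s => (h s).1]
  simpa using ncard_setOf_apply_eq μ c

theorem leviCivita_mem_realPoints (hD : IsEigendistributionFamily g φ U D)
    (hφ : IsConformalKillingYano g φ) (hs : ∀ x : M, HasSimpleSpectrum (g.cval x) (φ.cval x))
    (hT : SatisfiesTauCondition g φ) (s : Fin m → Bool) (hV : IsOpen V) (hVU : V ⊆ U)
    {k l : Π x : M, TangentSpace (𝓡 (2 * m)) x} (hk : SmoothFieldOn k V) (hl : SmoothFieldOn l V)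
    (hkD : ∀ y ∈ V, k y ∈ realPoints (D s y)) (hlD : ∀ y ∈ V, l y ∈ realPoints (D s y))
    (hx : x ∈ V) : leviCivita g k l x ∈ realPoints (D s x) := by
  have hmem := hD.cnabla_mem hφ hs hT s hV hVU hk.one_tmul hl.one_tmul hkD hlD hx
  rwa [cnabla_one_tmul g (hk.diffFieldAt hV hx) (hl.diffFieldAt hV hx)] at hmem

theorem mem_of_orthogonal (hD : IsEigendistributionFamily g φ U D) (s : Fin m → Bool) (hx : x ∈ U)
    {A : ℂ ⊗[ℝ] TangentSpace (𝓡 (2 * m)) x} (hA : ∀ B ∈ D s x, g.cval x A B = 0) : A ∈ D s x := by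
  obtain ⟨v, w, lam, h, hspan⟩ := hD.exists_isPencilBasis hx
  rw [hspan] at hA ⊢
  exact h.mem_span_select_of_orthogonal s fun μ => hA _ (Submodule.subset_span (mem_range_self μ))

theorem eventually_realPoints_ne (hD : IsEigendistributionFamily g φ U D) (s : Fin m → Bool)
    (hx : x ∈ U) (hg : g.IsLorentzian) (hs : HasSimpleSpectrum (g.cval x) (φ.cval x))
    (hρ : IsRealEigenfunction g φ ρ) (hne : realPoints (D s x) ≠ realEigenspace g φ x (ρ x)) :
    ∀ᶠ y in 𝓝 x, realPoints (D s y) ≠ realEigenspace g φ y (ρ y) := by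
  obtain ⟨V, hV, hxV, k, hk, hkV⟩ := hρ.exists_smoothFieldOn hg hs
  have hmem : ∀ y ∈ V, k y ∈ realEigenspace g φ y (ρ y) := fun y hy =>
    (hkV y hy).2 ▸ Submodule.mem_span_singleton_self _
  obtain ⟨B, hB, hkB⟩ : ∃ B ∈ D s x, g.cval x (1 ⊗ₜ[ℝ] k x) B ≠ 0 := by
    by_contra! horth
    exact hne ((hg.realPoints_eq_realEigenspace_iff (hρ.ne_zero x) (hmem x hxV) (hkV x hxV).1
      fun A hA B hB => hD.isotropic s hx hA hB).2 (hD.mem_of_orthogonal s hx horth))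
  obtain ⟨O, hO, hxO, hOU, Z, hZ, hZD, rfl⟩ := (hD.1 s).exists_extension hx hB
  have hcont : ContinuousAt (fun y => g.cval y (1 ⊗ₜ[ℝ] k y) (Z y)) x :=
    (g.smoothCOn_cval (hk.mono inter_subset_left).one_tmul
      (hZ.mono inter_subset_right)).continuousOn.continuousAt ((hV.inter hO).mem_nhds ⟨hxV, hxO⟩)
  filter_upwards [hcont.eventually_ne hkB, hV.mem_nhds hxV, hO.mem_nhds hxO] with y hy hyV hyO heq
  have hky : k y ∈ realPoints (D s y) := heq ▸ hmem y hyV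
  exact hy (hD.isotropic s (hOU hyO) hky (hZD y hyO))

-- `D s` contains exactly one of the eigenlines for `ρ` and `-ρ` at each point, and not containing a
-- given one of them is an open condition.
theorem eventually_realPoints_eq (hD : IsEigendistributionFamily g φ U D) (s : Fin m → Bool)
    (hx : x ∈ U) (hg : g.IsLorentzian) (hs : ∀ x : M, HasSimpleSpectrum (g.cval x) (φ.cval x))
    (hρ : IsRealEigenfunction g φ ρ) (h : realPoints (D s x) = realEigenspace g φ x (ρ x)) :
    ∀ᶠ y in 𝓝[U] x, realPoints (D s y) = realEigenspace g φ y (ρ y) := by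
  have hdich : ∀ y ∈ U, realPoints (D s y) = realEigenspace g φ y (ρ y) ↔
      realPoints (D s y) ≠ realEigenspace g φ y ((-ρ) y) := fun y hy => by
    obtain ⟨μ, c, hμ⟩ := hD.exists_realPoints_iff hy hg (hρ.ne_zero y) (hρ.mem y)
    rw [Pi.neg_apply, (hμ s).1, Ne, (hμ s).2, Bool.not_eq_not]
  filter_upwards [self_mem_nhdsWithin, nhdsWithin_le_nhds
    (hD.eventually_realPoints_ne s hx hg (hs x) (hρ.neg hs) ((hdich x hx).1 h))] with y hyU hy
  exact (hdich y hyU).2 hy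

theorem realPoints_eq_of_isPreconnected (hD : IsEigendistributionFamily g φ U D)
    (hU : IsPreconnected U) (hg : g.IsLorentzian)
    (hs : ∀ x : M, HasSimpleSpectrum (g.cval x) (φ.cval x)) (hρ : IsRealEigenfunction g φ ρ)
    (s : Fin m → Bool) (hx : x ∈ U) {y : M} (hy : y ∈ U)
    (h : realPoints (D s x) = realEigenspace g φ x (ρ x)) :
    realPoints (D s y) = realEigenspace g φ y (ρ y) := by
  refine (hU.induction₂ (fun y z => realPoints (D s y) = realEigenspace g φ y (ρ y) ↔
    realPoints (D s z) = realEigenspace g φ z (ρ z)) (fun z hz => ?_)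
    (fun _ _ _ _ _ _ => Iff.trans) (fun _ _ _ _ => Iff.symm) hx hy).1 h
  by_cases hz₀ : realPoints (D s z) = realEigenspace g φ z (ρ z)
  · exact (hD.eventually_realPoints_eq s hz hg hs hρ hz₀).mono fun y => iff_of_true hz₀
  · exact nhdsWithin_le_nhds ((hD.eventually_realPoints_ne s hz hg (hs z) hρ hz₀).mono
      fun y => iff_of_false hz₀)

theorem ncard_forall_realPoints_eq (hD : IsEigendistributionFamily g φ U D) (hU : IsConnected U)
    (hg : g.IsLorentzian) (hs : ∀ x : M, HasSimpleSpectrum (g.cval x) (φ.cval x))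
    (hρ : IsRealEigenfunction g φ ρ) :
    {s | ∀ x ∈ U, realPoints (D s x) = realEigenspace g φ x (ρ x)}.ncard = 2 ^ (m - 1) := by
  obtain ⟨x, hx⟩ := hU.nonempty
  rw [← hD.ncard_realPoints_eq hx hg (hρ.ne_zero x) (hρ.mem x)]
  congr 1
  ext s
  exact ⟨fun h => h x hx, fun h y hy =>
    hD.realPoints_eq_of_isPreconnected hU.isPreconnected hg hs hρ s hx hy h⟩

end IsEigendistributionFamily

theorem IsRealEigenfunction.isGeodesicNullCongruence (hρ : IsRealEigenfunction g φ ρ)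
    (hg : g.IsLorentzian) (hφ : IsConformalKillingYano g φ)
    (hs : ∀ x : M, HasSimpleSpectrum (g.cval x) (φ.cval x)) (hT : SatisfiesTauCondition g φ) :
    IsGeodesicNullCongruence g (fun x => realEigenspace g φ x (ρ x)) where
  smooth x := hρ.exists_smoothFieldOn hg (hs x)
  null x _ hk := val_eq_zero_of_mem_realEigenspace (hρ.ne_zero x) hk hk
  geodesic V hV k hk hkρ x hx := by
    obtain ⟨U, hU, hxU, D, hD⟩ := exists_local_isEigendistributionFamily (hs x)
    obtain ⟨μ, c, hμ⟩ := hD.exists_realPoints_iff hxU hg (hρ.ne_zero x) (hρ.mem x)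
    have hx' := (hμ fun _ => c).1.2 rfl
    have heq := hD.eventually_realPoints_eq _ hxU hg hs hρ hx'
    rw [hU.nhdsWithin_eq hxU] at heq
    obtain ⟨O, hO, hOo, hxO⟩ := eventually_nhds_iff.1
      (heq.and ((hV.inter hU).mem_nhds ⟨hx, hxU⟩))
    have hkO := hk.mono fun y hy => (hO y hy).2.1
    have hkD : ∀ y ∈ O, k y ∈ realPoints (D (fun _ => c) y) := fun y hy =>
      (hO y hy).1 ▸ hkρ y (hO y hy).2.1
    exact hx' ▸ hD.leviCivita_mem_realPoints hφ hs hT _ hOo (fun y hy => (hO y hy).2.2) hkO hkO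
      hkD hkD hxO

end PrincipalLines

section GlobalLorentzianFamily

variable {m : ℕ} {M : Type*} [TopologicalSpace M]
  [ChartedSpace (EuclideanSpace ℝ (Fin (2 * m))) M] [IsManifold (𝓡 (2 * m)) ∞ M]
  {g : PseudoRiemannianMetric (2 * m) M} {φ : TwoForm (2 * m) M}

theorem PseudoRiemannianMetric.IsLorentzian.lam_eq_of_isOrderedHalf (hg : g.IsLorentzian) {x : M}
    {v w : Fin m → ℂ ⊗[ℝ] TangentSpace (𝓡 (2 * m)) x} {lam : Fin m → ℂ}
    (h : IsPencilBasis (g.cval x) (φ.cval x) v w lam) (ho : IsOrderedHalf lam) {r : ℝ} (hr₀ : 0 < r)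
    (hr : (r : ℂ) ∈ pencilEigenvalues (g.cval x) (φ.cval x)) {μ : Fin m} (hμ : ∀ ν, μ ≤ ν) :
    lam μ = r := by
  obtain ⟨ν, hν⟩ : ∃ ν, lam ν = r := by
    rw [h.pencilEigenvalues_eq] at hr
    obtain ⟨ν | ν, hν⟩ := hr
    · exact ⟨ν, hν⟩
    · have hpos := ho.pos ν
      rw [show lam ν = -r from neg_eq_iff_eq_neg.1 hν] at hpos
      exact absurd hpos (by simpa using hr₀.le)
  rcases (hμ ν).eq_or_lt with rfl | hlt
  · exact hν
  · have hmono : (lam μ).im - (lam μ).re < (lam ν).im - (lam ν).re := ho.strictMono hlt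
    rw [hν, Complex.ofReal_im, Complex.ofReal_re] at hmono
    exact hg.eq_of_mul_pos hr (h.lam_mem μ) (mul_pos (by linarith [ho.pos μ]) hr₀)

theorem PseudoRiemannianMetric.IsLorentzian.exists_isEigendistributionFamily [Nonempty M]
    (hg : g.IsLorentzian) (hs : ∀ x : M, HasSimpleSpectrum (g.cval x) (φ.cval x)) {r : M → ℝ}
    (hr : IsRealEigenfunction g φ r) (hr₀ : ∀ x, 0 < r x) :
    ∃ D, IsEigendistributionFamily g φ univ D ∧
      {s | ∀ x, realPoints (D s x) = realEigenspace g φ x (r x)}.ncard = 2 ^ (m - 1) ∧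
      {s | ∀ x, realPoints (D s x) = realEigenspace g φ x (-r x)}.ncard = 2 ^ (m - 1) := by
  obtain ⟨v, w, lam, h, hD⟩ :=
    exists_global_isEigendistributionFamily hs fun x => hg.isOrderable (hs x)
  obtain ⟨x₀⟩ := ‹Nonempty M›
  obtain ⟨ν, -⟩ := hg.exists_re_ne_zero (hs x₀) (h x₀).1
  have : NeZero m := ⟨ν.pos.ne'⟩
  have hlam (x : M) : lam x 0 = r x :=
    hg.lam_eq_of_isOrderedHalf (h x).1 (h x).2 (hr₀ x) (hr.mem x) Fin.zero_le
  have hiff s (x : M) := hg.realPoints_span_select_eq_iff (h x).1 (hr₀ x).ne' (hlam x) s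
  have hiff_neg s (x : M) := hg.realPoints_span_select_eq_neg_iff (h x).1 (hr₀ x).ne' (hlam x) s
  refine ⟨_, hD, ?_, ?_⟩
  · simpa [hiff] using ncard_setOf_apply_eq (0 : Fin m) false
  · simpa [hiff_neg] using ncard_setOf_apply_eq (0 : Fin m) true

end GlobalLorentzianFamily

end CKY

end

theorem theorem1 {m : ℕ} {M : Type*} [TopologicalSpace M] [Nonempty M]
    [ChartedSpace (EuclideanSpace ℝ (Fin (2 * m))) M] [IsManifold (𝓡 (2 * m)) ∞ M]
    (g : CKY.PseudoRiemannianMetric (2 * m) M) (φ : CKY.TwoForm (2 * m) M)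
    (hφ : CKY.IsConformalKillingYano g φ)
    -- `2m` distinct eigenvalues, so `φ` is diagonalisable; they come in pairs `±z`, so none is `0`
    (hdist : ∀ x : M, (CKY.eigenvalues g φ x).ncard = 2 * m) :
    -- the `2^m` distributions exist, as smooth distributions near each point
    (∀ p : M, ∃ U : Set M, IsOpen U ∧ p ∈ U ∧ ∃ D, CKY.IsEigendistributionFamily g φ U D) ∧
    -- the condition on `τ = dφ` holds if `θ^μ ∧ τ (V^μ, ·, ·) = 0 = θ_μ ∧ τ (V_μ, ·, ·)` for all
    -- `μ`, if `φ` is closed, and in dimension four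
    (∀ (x : M) (v w : Fin m → ℂ ⊗[ℝ] TangentSpace (𝓡 (2 * m)) x) (lam : Fin m → ℂ),
      CKY.IsNullEigenbasis g φ x v w lam →
        (((∀ μ, CKY.WedgeContractionVanish g φ x (w μ) ∧ CKY.WedgeContractionVanish g φ x (v μ)) ∨
            (∀ a b c, CKY.extDeriv φ x a b c = 0) ∨ m = 2) →
          CKY.TauComponentsVanish φ x v w)) ∧
    -- under the condition on `τ`, the distributions are integrable
    ((∀ (x : M) (v w : Fin m → ℂ ⊗[ℝ] TangentSpace (𝓡 (2 * m)) x) (lam : Fin m → ℂ),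
      CKY.IsNullEigenbasis g φ x v w lam → CKY.TauComponentsVanish φ x v w) →
      (∀ U : Set M, IsOpen U → ∀ D, CKY.IsEigendistributionFamily g φ U D →
        (∀ x ∈ U, Function.Injective fun s => D s x) ∧
        (∀ s, ∀ x ∈ U, finrank ℂ (D s x) = m ∧ ∀ A ∈ D s x, ∀ B ∈ D s x, g.cval x A B = 0) ∧
        (∀ s, CKY.IsIntegrable (D s) U)) ∧
      -- Euclidean signature: `2^m` distinct Hermitian structures on `M`, and on each open set `U`
      -- carrying the distributions, which are the `(1,0)`-tangent spaces of the structures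
      (g.IsRiemannian →
        (∃ D, CKY.IsEigendistributionFamily g φ univ D) ∧
        ∀ U : Set M, IsOpen U → ∀ D, CKY.IsEigendistributionFamily g φ U D →
          ∃ J : (Fin m → Bool) →
              Π x : M, TangentSpace (𝓡 (2 * m)) x →ₗ[ℝ] TangentSpace (𝓡 (2 * m)) x,
            (∀ s, CKY.IsHermitianStructure g (J s) U) ∧
            (∀ s, ∀ x ∈ U, D s x = Module.End.eigenspace ((J s x).baseChange ℂ) Complex.I) ∧
            (∀ x ∈ U, Function.Injective fun s => J s x)) ∧
      -- Lorentzian signature: two geodesic null congruences, each from `2^(m-1)` distributions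
      (g.IsLorentzian →
        ∃ L : Bool → Π x : M, Submodule ℝ (TangentSpace (𝓡 (2 * m)) x),
          (∀ b, CKY.IsGeodesicNullCongruence g (L b)) ∧
          (∀ x, L true x ≠ L false x) ∧
          (∃ D, CKY.IsEigendistributionFamily g φ univ D ∧
            ∀ b, {s | ∀ x, CKY.realPoints (D s x) = L b x}.ncard = 2 ^ (m - 1)) ∧
          (∀ U : Set M, IsOpen U → ∀ D, CKY.IsEigendistributionFamily g φ U D →
            (∀ x ∈ U, ∀ b, {s | CKY.realPoints (D s x) = L b x}.ncard = 2 ^ (m - 1)) ∧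
            (IsConnected U →
              ∀ b, {s | ∀ x ∈ U, CKY.realPoints (D s x) = L b x}.ncard = 2 ^ (m - 1))))) := by
  have hs (x : M) : CKY.HasSimpleSpectrum (g.cval x) (φ.cval x) :=
    CKY.hasSimpleSpectrum_iff.2 (hdist x)
  refine ⟨fun p => CKY.exists_local_isEigendistributionFamily (hs p),
    fun x v w lam h => h.tauComponentsVanish, fun hT => ?_⟩
  have hInt {U D} (hD : CKY.IsEigendistributionFamily g φ U D) (s) : CKY.IsIntegrable (D s) U :=
    hD.isIntegrable hφ hs hT s
  refine ⟨fun U _ D hD => ⟨fun x hx => hD.injective hx, fun s x hx =>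
    ⟨hD.finrank_eq hx s, fun A hA B hB => hD.isotropic s hx hA hB⟩, hInt hD⟩,
    fun hg => ?riemannian, fun hg => ?lorentzian⟩
  case riemannian =>
    obtain ⟨v, w, lam, -, hD⟩ :=
      CKY.exists_global_isEigendistributionFamily hs fun x => hg.isOrderable (hs x)
    exact ⟨⟨_, hD⟩, fun U _ D hD => hD.exists_isHermitianStructure hg (hInt hD)⟩
  case lorentzian =>
    obtain ⟨r, hr, hr₀⟩ := hg.exists_pos_isRealEigenfunction hs
    obtain ⟨D, hD, hpos, hneg⟩ := hg.exists_isEigendistributionFamily hs hr hr₀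
    exact ⟨fun b x => CKY.realEigenspace g φ x ((bif b then r else -r) x),
      fun b => (hr.cond hs b).isGeodesicNullCongruence hg hφ hs hT,
      fun x => hr.realEigenspace_ne_neg x,
      ⟨D, hD, Bool.forall_bool.2 ⟨hneg, hpos⟩⟩,
      fun U _ D hD =>
        ⟨fun x hx b => hD.ncard_realPoints_eq hx hg ((hr.cond hs b).ne_zero x)
          ((hr.cond hs b).mem x),
        fun hU b => hD.ncard_forall_realPoints_eq hU hg hs (hr.cond hs b)⟩⟩
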